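/- Let $A\in\mathbb C^{n\times n}$ be an orthogonal projection ($A^\dagger=A=A^2$), $A^\perp=I-A$, and let $h,\tilde h\in\mathbb C^{n\times n}$ satisfy $h=AhA=Ah=hA$ and $\tilde h=A\tilde hA=A\tilde h=\tilde hA$. Let $Q,\tilde Q$ be $n\times n$ complex matrix functions in $L^1(0,\infty)$. Consider the problem $L=L(Q,A,h)$: $$-Y''+Q(x)Y=\lambda Y,\quad x>0,\qquad T(Y):=A(Y'(0)-hY(0))-A^\perp Y(0)=0,$$ and the model problem $\tilde L=L(\tilde Q,A,\tilde h)$; objects with a tilde belong to $\tilde L$ and are defined in the same way. Let $\lambda=\rho^2$ and $\Omega=\{\rho:\operatorname{Im}\rho\ge 0,\ \rho\neq 0\}$, so that $\Omega$ is identified with the $\lambda$-plane cut along $\lambda\ge 0$, with the two sides of the cut $\lambda>0$ included ($\rho>0$ is the upper side, $\rho<0$ the lower side). For $\rho\in\Omega$ let $e(x,\rho)$ be the Jost solution, that is, the continuous solution on $[0,\infty)$, with $e^{-i\rho x}e(x,\rho)$ bounded, of $$e(x,\rho)=e^{i\rho x}I+\int_x^\infty\frac{\sin\rho(t-x)}{\rho}\,Q(t)e(t,\rho)\,dt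 .$$ Put $J(\rho)=T(e(\cdot,\rho))$, $\Lambda=\{\rho^2:\rho\in\Omega,\ \det J(\rho)=0\}$, let $\phi(x,\lambda)=e(x,\rho)J(\rho)^{-1}$ be the Weyl solution and $M(\lambda)=A\phi(0,\lambda)+A^\perp\phi'(0,\lambda)$ the Weyl matrix. For $\lambda\in\mathbb C$ let $\varphi(x,\lambda)$ be the solution of $-Y''+QY=\lambda Y$, and $\varphi^*(x,\lambda)$ the solution of $-Z''+ZQ=\lambda Z$, both with the initial values $A$ and $A^\perp+h$ of the function and of its derivative at $x=0$. With $\langle Z,Y\rangle=Z'Y-ZY'$ let $$\tilde D(x,\lambda,\mu)=\frac{\langle\tilde\varphi^*(x,\mu),\tilde\varphi(x,\lambda)\rangle}{\lambda-\mu}=\int_0^x\tilde\varphi^*(t,\mu)\tilde\varphi(t,\lambda)\,dt,\qquad \tilde r(x,\lambda,\mu)=(M(\mu)-\tilde M(\mu))\tilde D(x,\lambda,\mu)$$ (the first expression for $\lambda\ne\mu$). Let $\gamma=\gamma'\cup\gamma''$, where $\gamma'$ is a closed piecewise $C^1$ contour in the $\lambda$-plane that meets $[0,\infty)$ in exactly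 one point $a>0$, passing through it once, and goes around every point of $\Lambda\cup\tilde\Lambda\cup\{0\}$ exactly once counterclockwise (no such point lies on it), and $\gamma''$ is the two-sided cut along $[a,\infty)$; $\gamma$ is traversed along the upper side of the cut from $+\infty$ to $a$, then along $\gamma'$, then along the lower side of the cut from $a$ to $+\infty$. Then for all $x\ge 0$ and $\lambda\in\mathbb C$ the integral below converges absolutely and $$\tilde\varphi(x,\lambda)=\varphi(x,\lambda)+\frac1{2\pi i}\int_\gamma\varphi(x,\mu)\,\tilde r(x,\lambda,\mu)\,d\mu .$$ -/

import Mathlib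

open MeasureTheory Set
open scoped Matrix Matrix.Norms.L2Operator

noncomputable section

namespace MatrixSchrodinger

/-- Complex `n × n` matrices. The norm (here the `ℓ²` operator norm) is only used to express
boundedness and integrability, for which all norms on this space are equivalent. -/
abbrev Mat (n : ℕ) : Type := Matrix (Fin n) (Fin n) ℂ

variable {n : ℕ}

/-- The derivative `Y'(x)` of a matrix function on the half-line `[0, ∞)`
(one-sided at `x = 0`). -/
def D (Y : ℝ → Mat n) (x : ℝ) : Mat n := derivWithin Y (Ici 0) x

/-- `A` is an orthogonal projection and `h = A h A = A h = h A`. -/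
structure IsBoundaryData (A h : Mat n) : Prop where
  adjoint : Aᴴ = A
  idem : A * A = A
  left_right : h = A * h * A
  left : h = A * h
  right : h = h * A

/-- The complementary projection `A^⊥ = I - A`. -/
def perp (A : Mat n) : Mat n := 1 - A

/-- The boundary form `T(Y) = A (Y'(0) - h Y(0)) - A^⊥ Y(0)`. -/
def T (A h : Mat n) (Y : ℝ → Mat n) : Mat n :=
  A * (D Y 0 - h * Y 0) - perp A * Y 0

/-- `Y` solves `-Y'' + Q Y = lam Y` on the half-line in the Carathéodory sense: `Y` is
differentiable on `[0, ∞)` and `Y'` is the integral of `(Q - lam) Y`. -/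
structure IsSolution (Q : ℝ → Mat n) (lam : ℂ) (Y : ℝ → Mat n) : Prop where
  differentiable : DifferentiableOn ℝ Y (Ici 0)
  equation : ∀ x, 0 ≤ x → D Y x = D Y 0 + ∫ t in (0 : ℝ)..x, (Q t * Y t - lam • Y t)

/-- `Z` solves the transposed equation `-Z'' + Z Q = lam Z` on the half-line. -/
structure IsAdjSolution (Q : ℝ → Mat n) (lam : ℂ) (Z : ℝ → Mat n) : Prop where
  differentiable : DifferentiableOn ℝ Z (Ici 0)
  equation : ∀ x, 0 ≤ x → D Z x = D Z 0 + ∫ t in (0 : ℝ)..x, (Z t * Q t - lam • Z t)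

/-- `φ(·, lam)`: the solution of `-Y'' + Q Y = lam Y` with `φ(0) = A`, `φ'(0) = A^⊥ + h`.
It exists and its values on `[0, ∞)` are unique for integrable `Q`. -/
def phi (Q : ℝ → Mat n) (A h : Mat n) (lam : ℂ) : ℝ → Mat n :=
  Classical.epsilon fun Y => IsSolution Q lam Y ∧ Y 0 = A ∧ D Y 0 = perp A + h

/-- `φ*(·, lam)`: the solution of `-Z'' + Z Q = lam Z` with `φ*(0) = A`, `φ*'(0) = A^⊥ + h`. -/
def phiStar (Q : ℝ → Mat n) (A h : Mat n) (lam : ℂ) : ℝ → Mat n :=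
  Classical.epsilon fun Z => IsAdjSolution Q lam Z ∧ Z 0 = A ∧ D Z 0 = perp A + h

/-- The punctured closed upper half-plane `Ω`; the map `rho ↦ rho²` identifies it with the
`lam`-plane cut along the positive half-line, with both sides of the cut included
(`rho > 0` is the upper side, `rho < 0` the lower side). -/
def Omega : Set ℂ := {rho | 0 ≤ rho.im ∧ rho ≠ 0}

/-- `e` solves the Jost integral equation
`e(x) = exp(i rho x) I + ∫_x^∞ (sin (rho (t - x)) / rho) Q(t) e(t) dt`, `x ≥ 0`.
The bound makes the integral absolutely convergent. -/
structure IsJost (Q : ℝ → Mat n) (rho : ℂ) (e : ℝ → Mat n) : Prop where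
  continuous : ContinuousOn e (Ici 0)
  bound : ∃ C : ℝ, ∀ x, 0 ≤ x → ‖e x‖ ≤ C * Real.exp (-(rho.im * x))
  equation : ∀ x : ℝ, 0 ≤ x → e x = Complex.exp (Complex.I * rho * x) • (1 : Mat n) +
    ∫ t in Ioi x, (Complex.sin (rho * ((t : ℂ) - x)) / rho) • (Q t * e t)

/-- The Jost solution `e(·, rho)`, for `rho ∈ Ω`. It exists and its values on `[0, ∞)` are
unique for integrable `Q`. -/
def jost (Q : ℝ → Mat n) (rho : ℂ) : ℝ → Mat n :=
  Classical.epsilon fun e => IsJost Q rho e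

/-- The Jost matrix `J(rho) = T(e(·, rho))`. -/
def jostMatrix (Q : ℝ → Mat n) (A h : Mat n) (rho : ℂ) : Mat n := T A h (jost Q rho)

/-- The Weyl solution `e(x, rho) J(rho)⁻¹`. -/
def weylSolution (Q : ℝ → Mat n) (A h : Mat n) (rho : ℂ) : ℝ → Mat n :=
  fun x => jost Q rho x * (jostMatrix Q A h rho)⁻¹

/-- The Weyl matrix `M`, at the point of the cut plane given by `rho ∈ Ω`. -/
def weylMatrix (Q : ℝ → Mat n) (A h : Mat n) (rho : ℂ) : Mat n :=
  A * weylSolution Q A h rho 0 + perp A * D (weylSolution Q A h rho) 0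

/-- The set `Λ = {rho² : rho ∈ Ω, det J(rho) = 0}`. -/
def Lam (Q : ℝ → Mat n) (A h : Mat n) : Set ℂ :=
  {z | ∃ rho ∈ Omega, (jostMatrix Q A h rho).det = 0 ∧ z = rho ^ 2}

/-- `⟨Z, Y⟩ = Z' Y - Z Y'` at the point `x`. -/
def wronskian (Z Y : ℝ → Mat n) (x : ℝ) : Mat n := D Z x * Y x - Z x * D Y x

/-- The kernel `D(x, lam, mu) = ∫_0^x φ*(t, mu) φ(t, lam) dt`. -/
def kernelD (Q : ℝ → Mat n) (A h : Mat n) (x : ℝ) (lam mu : ℂ) : Mat n :=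
  ∫ t in (0 : ℝ)..x, phiStar Q A h mu t * phi Q A h lam t

/-- `r̃(x, lam, mu) = (M(mu) - M̃(mu)) D̃(x, lam, mu)`, at the point `mu = tau²` of the cut plane
given by `tau ∈ Ω`. -/
def rTilde (Q Qt : ℝ → Mat n) (A h ht : Mat n) (x : ℝ) (lam tau : ℂ) : Mat n :=
  (weylMatrix Q A h tau - weylMatrix Qt A ht tau) * kernelD Qt A ht x lam (tau ^ 2)

/-- The square root with positive imaginary part of a number outside `[0, ∞)`. -/
def upperSqrt (mu : ℂ) : ℂ := Complex.I * (-mu) ^ (1 / 2 : ℂ)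

/-- The winding number of the closed curve `c : [0, 1] → ℂ` about `z`. -/
def winding (c : ℝ → ℂ) (z : ℂ) : ℂ :=
  (2 * Real.pi * Complex.I)⁻¹ * ∫ s in (0 : ℝ)..1, deriv c s / (c s - z)

/-- `c : [0, 1] → ℂ` is a closed piecewise `C¹` contour which starts and ends at the point `a > 0`,
does not meet the half-line `[0, ∞)` otherwise, and goes once, counterclockwise, around every
point of `S`. -/
structure IsEncircling (c : ℝ → ℂ) (a : ℝ) (S : Set ℂ) : Prop where
  pos : 0 < a
  start : c 0 = a
  finish : c 1 = a
  continuous : ContinuousOn c (Icc 0 1)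
  piecewise : ∃ P : Set ℝ, P.Finite ∧
    (∀ s ∈ Ioo (0 : ℝ) 1 \ P, DifferentiableAt ℝ c s) ∧
    ContinuousOn (deriv c) (Ioo (0 : ℝ) 1 \ P) ∧
    ∃ C : ℝ, ∀ s ∈ Ioo (0 : ℝ) 1 \ P, ‖deriv c s‖ ≤ C
  off_cut : ∀ s ∈ Ioo (0 : ℝ) 1, ∀ t : ℝ, 0 ≤ t → c s ≠ t
  encircles : ∀ z ∈ S, z ∉ c '' Icc 0 1 ∧ winding c z = 1

/-- Absolute convergence of the integral over `γ = γ' ∪ γ''` of a function `F` on `Ω` (regarded as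
a function of `mu = tau²` in the cut plane), where `γ'` is given by `c` and `γ''` is the
two-sided cut along `[a, ∞)`. -/
def GammaIntegrable (c : ℝ → ℂ) (a : ℝ) (F : ℂ → Mat n) : Prop :=
  IntervalIntegrable (fun s => deriv c s • F (upperSqrt (c s))) volume 0 1 ∧
  IntegrableOn (fun t : ℝ => F (Real.sqrt t : ℂ)) (Ioi a) ∧
  IntegrableOn (fun t : ℝ => F (-(Real.sqrt t : ℂ))) (Ioi a)

/-- The integral `∫_γ F dmu`: along the upper side of the cut from `+∞` to `a`, then along `γ'`,
then along the lower side of the cut from `a` to `+∞`. -/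
def gammaIntegral (c : ℝ → ℂ) (a : ℝ) (F : ℂ → Mat n) : Mat n :=
  -(∫ t in Ioi a, F (Real.sqrt t : ℂ)) +
  (∫ s in (0 : ℝ)..1, deriv c s • F (upperSqrt (c s))) +
  ∫ t in Ioi a, F (-(Real.sqrt t : ℂ))

end MatrixSchrodinger

end

/-! Write mu for the spectral variable of the integral, and let S be the solution with initial
values (-A^⊥, A). The Weyl solution is Φ = S + φ M, and the adjoint problem has Φ* = S* + M φ*, with
the same Weyl matrix M. For fixed lam the integrand is G = φ(mu) (M - M̃)(mu) D̃(lam, mu). By the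
Lagrange identity, D̃ is the Wronskian of φ̃*(mu) and φ̃(lam) divided by lam - mu.

Add to G the term E(mu)/(lam - mu), where the entire function E (`entirePart`) is built from S, φ,
S̃*, φ̃*. In the sum, φ (M - M̃) φ̃* turns into Φ φ̃* - φ Φ̃*, and likewise with φ̃*' and Φ̃*'. The
growth of φ is now compensated by the decay of Φ: as rho → ∞ in the closed upper half-plane, Φ φ̃*'
- φ Φ̃*' = -I + O(1/rho) and Φ φ̃* - φ Φ̃* = O(1/rho) (`comparison_asymptotics_fst`,
`comparison_asymptotics_snd`). Hence mu (G + E/(lam - mu)) tends to φ̃(lam), and its integral over a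
large circle tends to 2πi φ̃(lam) (`tendsto_decayingIntegrand`, `tendsto_arcPiece`).

Take lam inside γ'. By Cauchy's theorem the integral of the sum over γ, cut off at a large circle,
equals the integral over the circle. The term with E is single valued in mu, so the two sides of the
cut cancel. On γ' it contributes 2πi φ(lam), because E(lam) = -φ(lam) (`entirePart_self`). Letting
the circle grow gives ∫_γ G = 2πi (φ̃ - φ)(lam). It is enough to do this on a small open set of lam
near 0 (`gammaIntegral_eq_of_near_zero`): both sides are entire in lam, and the identity theorem
does the rest (`gammaIntegral_eq_sub`).

Three ingredients carry the argument. First, Volterra equations construct the Jost solution and the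
initial value solutions, and give their analyticity in the parameter and their asymptotics. With Q
merely integrable the remainders are O(1/rho), which suffices. The weight U = A/(i rho) - A^⊥, the
leading term of J⁻¹, balances the two boundary conditions, and M - M̃ = U B U with B bounded. On the
cut this gives G = O(|mu|^(-3/2)), hence absolute convergence.

Second, the adjoint Weyl solution must decay like the Weyl solution. It does because the Wronskian
of the Jost solution and the transposed Jost solution is zero, so that transposing the problem
transposes the Weyl matrix (`weyl_adjoint_identity`).

Third, the contour argument takes place in the rho-plane, where the two sides of the cut are the two
half-axes. The curve c lifts to an arc from √a to -√a. The functions are continuous only up to the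
real axis, so Cauchy's theorem, in Dixon's homological form, is applied to slightly shifted
functions (`IsCycle.cauchy_upper`). The singular points lie outside the keyhole contour in the sense
of index: c and the large circle both wind once around their squares and enter with opposite signs
(`IsEncircling.keyhole_index`). -/

noncomputable section

namespace MatrixSchrodinger

/-! ### Indefinite integrals of locally integrable functions and the product rule. -/

section Primitive

variable {E : Type*} [NormedAddCommGroup E] [NormedSpace ℝ E]

/-- On `[0, ∞)`, the function `F` is an indefinite integral of the locally integrable `f`. -/
structure IsPrimitive (F f : ℝ → E) : Prop where
  integrable : ∀ x, 0 ≤ x → IntervalIntegrable f volume 0 x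
  eq : ∀ x, 0 ≤ x → F x = F 0 + ∫ t in (0 : ℝ)..x, f t

namespace IsPrimitive

variable {F G f g : ℝ → E}

lemma sub_eq (hF : IsPrimitive F f) {a b : ℝ} (ha : 0 ≤ a) (hb : 0 ≤ b) :
    F b - F a = ∫ t in a..b, f t := by
  rw [hF.eq b hb, hF.eq a ha,
    ← intervalIntegral.integral_interval_sub_left (hF.integrable b hb) (hF.integrable a ha)]
  abel

lemma continuousOn (hF : IsPrimitive F f) : ContinuousOn F (Ici 0) := by
  intro x hx
  have h1 : ContinuousOn (fun y => F 0 + ∫ t in (0 : ℝ)..y, f t) (Icc 0 (x + 1)) := by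
    have := intervalIntegral.continuousOn_primitive_interval' (hF.integrable (x + 1)
      (by have : (0 : ℝ) ≤ x := hx; linarith)) left_mem_uIcc
    rw [uIcc_of_le (by have : (0 : ℝ) ≤ x := hx; linarith)] at this
    exact continuousOn_const.add this
  have h2 : ContinuousOn F (Icc 0 (x + 1)) := h1.congr fun y hy => hF.eq y hy.1
  refine (h2 x ⟨hx, by linarith⟩).mono_of_mem_nhdsWithin ?_
  rw [← Ici_inter_Iic]
  exact inter_mem_nhdsWithin _ (Iic_mem_nhds (by linarith))

lemma congr (hF : IsPrimitive F f) (hg : ∀ x, 0 < x → f x = g x) : IsPrimitive F g := by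
  refine ⟨fun x hx => (hF.integrable x hx).congr fun t ht => ?_, fun x hx => ?_⟩
  · rw [uIoc_of_le hx] at ht
    exact hg t ht.1
  · rw [hF.eq x hx]
    congr 1
    refine intervalIntegral.integral_congr_ae (Filter.Eventually.of_forall fun t ht => ?_)
    rw [uIoc_of_le hx] at ht
    exact hg t ht.1

lemma congr_left (hF : IsPrimitive F f) (hg : ∀ x, 0 ≤ x → F x = G x) : IsPrimitive G f :=
  ⟨hF.integrable, fun x hx => by rw [← hg x hx, ← hg 0 le_rfl, hF.eq x hx]⟩

lemma add (hF : IsPrimitive F f) (hG : IsPrimitive G g) :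
    IsPrimitive (fun x => F x + G x) (fun x => f x + g x) :=
  ⟨fun x hx => (hF.integrable x hx).add (hG.integrable x hx), fun x hx => by
    rw [intervalIntegral.integral_add (hF.integrable x hx) (hG.integrable x hx), hF.eq x hx,
      hG.eq x hx]
    abel⟩

lemma neg (hF : IsPrimitive F f) : IsPrimitive (fun x => -F x) (fun x => -f x) :=
  ⟨fun x hx => (hF.integrable x hx).neg, fun x hx => by
    rw [intervalIntegral.integral_neg, hF.eq x hx]
    abel⟩

lemma sub (hF : IsPrimitive F f) (hG : IsPrimitive G g) :
    IsPrimitive (fun x => F x - G x) (fun x => f x - g x) := by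
  simpa only [sub_eq_add_neg] using hF.add hG.neg

lemma const (c : E) : IsPrimitive (fun _ => c) (fun _ => (0 : E)) :=
  ⟨fun _ _ => intervalIntegrable_const, fun x _ => by simp⟩

lemma eq_zero (hF : IsPrimitive F f) (hf : ∀ x, 0 < x → f x = 0) {x : ℝ} (hx : 0 ≤ x) :
    F x = F 0 := by
  have := (hF.congr (g := fun _ => 0) hf).eq x hx
  simpa using this

lemma clm {E' : Type*} [NormedAddCommGroup E'] [NormedSpace ℝ E'] [CompleteSpace E]
    [CompleteSpace E'] (L : E →L[ℝ] E')
    (hF : IsPrimitive F f) : IsPrimitive (fun x => L (F x)) (fun x => L (f x)) :=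
  ⟨fun x hx => ⟨L.integrable_comp (hF.integrable x hx).1, L.integrable_comp (hF.integrable x hx).2⟩,
   fun x hx => by
    rw [L.intervalIntegral_comp_comm (hF.integrable x hx), hF.eq x hx, map_add]⟩

lemma of_integral (hf : ∀ x, 0 ≤ x → IntervalIntegrable f volume 0 x) (c : E) :
    IsPrimitive (fun x => c + ∫ t in (0 : ℝ)..x, f t) f :=
  ⟨hf, fun x _ => by simp⟩

variable [CompleteSpace E]

lemma of_hasDerivAt (hF : ∀ x, 0 ≤ x → HasDerivAt F (f x) x) (hf : ContinuousOn f (Ici 0)) :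
    IsPrimitive F f := by
  have hi : ∀ x, 0 ≤ x → IntervalIntegrable f volume 0 x := fun x hx =>
    (hf.mono (by rw [uIcc_of_le hx]; exact fun t ht => ht.1)).intervalIntegrable
  refine ⟨hi, fun x hx => ?_⟩
  rw [intervalIntegral.integral_eq_sub_of_hasDerivAt (fun t ht => hF t ?_) (hi x hx)]
  · abel
  · rw [uIcc_of_le hx] at ht
    exact ht.1

lemma of_hasDerivWithinAt (hF : ∀ x, 0 ≤ x → HasDerivWithinAt F (f x) (Ici 0) x)
    (hf : ContinuousOn f (Ici 0)) : IsPrimitive F f := by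
  have hi : ∀ x, 0 ≤ x → IntervalIntegrable f volume 0 x := fun x hx =>
    (hf.mono (by rw [uIcc_of_le hx]; exact fun t ht => ht.1)).intervalIntegrable
  refine ⟨hi, fun x hx => ?_⟩
  rw [intervalIntegral.integral_eq_sub_of_hasDerivAt_of_le hx
    (fun t ht => ((hF t ht.1).mono fun y hy => hy.1).continuousWithinAt)
    (fun t ht => (hF t ht.1.le).hasDerivAt (Ici_mem_nhds ht.1)) (hi x hx)]
  abel

lemma hasDerivWithinAt (hF : IsPrimitive F f) (hf : ContinuousOn f (Ici 0)) {x : ℝ}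
    (hx : 0 ≤ x) : HasDerivWithinAt F (f x) (Ici 0) x := by
  have key : HasDerivWithinAt (fun y => F 0 + ∫ t in (0 : ℝ)..y, f t) (f x) (Ici 0) x := by
    refine HasDerivWithinAt.const_add _ ?_
    rcases hx.eq_or_lt with rfl | hx0
    · exact intervalIntegral.integral_hasDerivWithinAt_right (hF.integrable 0 le_rfl)
        (hf.stronglyMeasurableAtFilter_nhdsWithin measurableSet_Ici 0 |>.filter_mono
          (nhdsWithin_mono _ Ioi_subset_Ici_self)) ((hf 0 self_mem_Ici).mono Ioi_subset_Ici_self)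
    · refine (intervalIntegral.integral_hasDerivAt_right (hF.integrable x hx) ?_
        (hf.continuousAt (Ici_mem_nhds hx0))).hasDerivWithinAt
      exact (hf.mono Ioi_subset_Ici_self).stronglyMeasurableAtFilter isOpen_Ioi x hx0
  exact key.congr (fun y hy => hF.eq y hy) (hF.eq x hx)

lemma derivWithin_eq (hF : IsPrimitive F f) (hf : ContinuousOn f (Ici 0)) {x : ℝ}
    (hx : 0 ≤ x) : derivWithin F (Ici 0) x = f x :=
  (hF.hasDerivWithinAt hf hx).derivWithin (uniqueDiffOn_Ici 0 x hx)

end IsPrimitive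

section Product

variable {R : Type*} [NormedRing R] [NormedAlgebra ℝ R] [CompleteSpace R]

omit [CompleteSpace R] in
-- Fubini on the square (0, x]², split along its diagonal into two triangles. This replaces
-- integration by parts, which needs a derivative everywhere; the order of the factors is kept
-- because the ring is not commutative.
lemma integral_mul_integral_eq {f g : ℝ → R} {x : ℝ} (hx : 0 ≤ x)
    (hf : IntervalIntegrable f volume 0 x) (hg : IntervalIntegrable g volume 0 x) :
    (∫ t in (0 : ℝ)..x, f t) * (∫ t in (0 : ℝ)..x, g t) =
      (∫ t in (0 : ℝ)..x, f t * ∫ s in (0 : ℝ)..t, g s) +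
        ∫ t in (0 : ℝ)..x, (∫ s in (0 : ℝ)..t, f s) * g t := by
  set ν := volume.restrict (Ioc (0 : ℝ) x) with hν
  have hf' : Integrable f ν := (intervalIntegrable_iff_integrableOn_Ioc_of_le hx).1 hf
  have hg' : Integrable g ν := (intervalIntegrable_iff_integrableOn_Ioc_of_le hx).1 hg
  have hP : Integrable (Function.uncurry fun t s => f t * g s) (ν.prod ν) := hf'.mul_prod hg'
  have hm1 : MeasurableSet {p : ℝ × ℝ | p.2 ≤ p.1} := measurableSet_le measurable_snd measurable_fst
  have hm2 : MeasurableSet {p : ℝ × ℝ | p.1 < p.2} := measurableSet_lt measurable_fst measurable_snd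
  have h1 := hP.indicator hm1
  have h2 := hP.indicator hm2
  have e1 : ∀ t ∈ Ioc (0 : ℝ) x,
      ∫ s, {p : ℝ × ℝ | p.2 ≤ p.1}.indicator (Function.uncurry fun t s => f t * g s) (t, s) ∂ν
        = f t * ∫ s in (0 : ℝ)..t, g s := by
    intro t ht
    have : (fun s => {p : ℝ × ℝ | p.2 ≤ p.1}.indicator
        (Function.uncurry fun t s => f t * g s) (t, s)) =
        (Iic t).indicator fun s => f t * g s := by
      ext s
      by_cases h : s ≤ t <;> simp [indicator, h]
    rw [this, integral_indicator measurableSet_Iic, hν, Measure.restrict_restrict measurableSet_Iic,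
      intervalIntegral.integral_of_le ht.1.le, ← integral_const_mul_of_integrable
        (hg'.mono_measure (Measure.restrict_mono (Ioc_subset_Ioc_right ht.2) le_rfl))]
    congr 2
    ext s
    simp only [mem_inter_iff, mem_Iic, mem_Ioc]
    constructor
    · rintro ⟨a, b, c⟩; exact ⟨b, a⟩
    · rintro ⟨a, b⟩; exact ⟨b, a, b.trans ht.2⟩
  have e2 : ∀ s ∈ Ioc (0 : ℝ) x,
      ∫ t, {p : ℝ × ℝ | p.1 < p.2}.indicator (Function.uncurry fun t s => f t * g s) (t, s) ∂ν
        = (∫ t in (0 : ℝ)..s, f t) * g s := by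
    intro s hs
    have : (fun t => {p : ℝ × ℝ | p.1 < p.2}.indicator
        (Function.uncurry fun t s => f t * g s) (t, s)) =
        (Iio s).indicator fun t => f t * g s := by
      ext t
      by_cases h : t < s <;> simp [indicator, h]
    -- The diagonal was counted in the other triangle, so the slice is an open interval; its right
    -- endpoint is a null set.
    rw [this, integral_indicator measurableSet_Iio, hν, Measure.restrict_restrict measurableSet_Iio,
      intervalIntegral.integral_of_le hs.1.le, integral_Ioc_eq_integral_Ioo,
      ← integral_mul_const_of_integrable (IntegrableOn.mono_set hf'
        (fun y hy => ⟨hy.1, hy.2.le.trans hs.2⟩ : Ioo 0 s ⊆ Ioc 0 x))]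
    congr 2
    ext t
    simp only [mem_inter_iff, mem_Iio, mem_Ioc, mem_Ioo]
    constructor
    · rintro ⟨a, b, c⟩; exact ⟨b, a⟩
    · rintro ⟨a, b⟩; exact ⟨b, a, b.le.trans hs.2⟩
  have hsum : ∫ p, Function.uncurry (fun t s => f t * g s) p ∂(ν.prod ν) =
      (∫ p, {p : ℝ × ℝ | p.2 ≤ p.1}.indicator (Function.uncurry fun t s => f t * g s) p ∂(ν.prod ν))
      + ∫ p, {p : ℝ × ℝ | p.1 < p.2}.indicator (Function.uncurry fun t s => f t * g s) p
          ∂(ν.prod ν) := by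
    rw [← integral_add h1 h2]
    refine integral_congr_ae (Filter.Eventually.of_forall fun p => ?_)
    by_cases h : p.2 ≤ p.1 <;> simp [indicator, h]
  have hprod : ∫ p, Function.uncurry (fun t s => f t * g s) p ∂(ν.prod ν) =
      (∫ t, f t ∂ν) * ∫ s, g s ∂ν := by
    rw [integral_prod _ hP]
    simp only [Function.uncurry]
    rw [← integral_mul_const_of_integrable hf']
    exact integral_congr_ae (Filter.Eventually.of_forall fun t =>
      integral_const_mul_of_integrable hg')
  rw [hprod, integral_prod _ h1, integral_prod_symm _ h2] at hsum
  simp only [intervalIntegral.integral_of_le hx]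
  rw [← hν]
  refine hsum.trans (congrArg₂ _ ?_ ?_)
  · exact setIntegral_congr_fun measurableSet_Ioc e1
  · exact setIntegral_congr_fun measurableSet_Ioc e2

omit [CompleteSpace R] in
/-- The product rule for indefinite integrals. -/
lemma IsPrimitive.mul {F G f g : ℝ → R} (hF : IsPrimitive F f) (hG : IsPrimitive G g) :
    IsPrimitive (fun x => F x * G x) (fun x => f x * G x + F x * g x) := by
  have i1 : ∀ x, 0 ≤ x → IntervalIntegrable (fun t => f t * G t) volume 0 x := fun x hx =>
    (hF.integrable x hx).mul_continuousOn
      (hG.continuousOn.mono (by rw [uIcc_of_le hx]; exact fun t ht => ht.1))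
  have i2 : ∀ x, 0 ≤ x → IntervalIntegrable (fun t => F t * g t) volume 0 x := fun x hx =>
    (hG.integrable x hx).continuousOn_mul
      (hF.continuousOn.mono (by rw [uIcc_of_le hx]; exact fun t ht => ht.1))
  refine ⟨fun x hx => (i1 x hx).add (i2 x hx), fun x hx => ?_⟩
  have hf := hF.integrable x hx
  have hg := hG.integrable x hx
  have pf := hF.sub (.const (F 0))
  have pg := hG.sub (.const (G 0))
  rw [intervalIntegral.integral_add (i1 x hx) (i2 x hx)]
  have hfx : ∀ t, 0 ≤ t → ∫ s in (0 : ℝ)..t, f s = F t - F 0 := fun t ht => by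
    rw [hF.eq t ht]; abel
  have hgx : ∀ t, 0 ≤ t → ∫ s in (0 : ℝ)..t, g s = G t - G 0 := fun t ht => by
    rw [hG.eq t ht]; abel
  have key := integral_mul_integral_eq hx hf hg
  -- Fubini speaks of F - F 0 and G - G 0; this and the next identity restore the initial values.
  have c1 : ∫ t in (0 : ℝ)..x, f t * ∫ s in (0 : ℝ)..t, g s =
      (∫ t in (0 : ℝ)..x, f t * G t) - (F x - F 0) * G 0 := by
    rw [← hfx x hx, intervalIntegral.integral_of_le hx, intervalIntegral.integral_of_le hx,
      intervalIntegral.integral_of_le hx, ← integral_mul_const_of_integrable hf.1,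
      ← integral_sub (i1 x hx).1 (hf.1.mul_const _)]
    refine setIntegral_congr_fun measurableSet_Ioc fun t ht => ?_
    rw [hgx t ht.1.le, mul_sub]
  have c2 : ∫ t in (0 : ℝ)..x, (∫ s in (0 : ℝ)..t, f s) * g t =
      (∫ t in (0 : ℝ)..x, F t * g t) - F 0 * (G x - G 0) := by
    rw [← hgx x hx, intervalIntegral.integral_of_le hx, intervalIntegral.integral_of_le hx,
      intervalIntegral.integral_of_le hx, ← integral_const_mul_of_integrable hg.1,
      ← integral_sub (i2 x hx).1 (hg.1.const_mul _)]
    refine setIntegral_congr_fun measurableSet_Ioc fun t ht => ?_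
    rw [hfx t ht.1.le, sub_mul]
  rw [c1, c2, hfx x hx, hgx x hx] at key
  have : (∫ t in (0 : ℝ)..x, f t * G t) + (∫ t in (0 : ℝ)..x, F t * g t) =
      (F x - F 0) * (G x - G 0) + (F x - F 0) * G 0 + F 0 * (G x - G 0) := by
    rw [key]; abel
  rw [this]
  noncomm_ring

omit [CompleteSpace R] in
lemma IsPrimitive.mul_const {F f : ℝ → R} (hF : IsPrimitive F f) (c : R) :
    IsPrimitive (fun x => F x * c) (fun x => f x * c) :=
  (hF.mul (IsPrimitive.const c)).congr fun x _ => by simp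

end Product

end Primitive

end MatrixSchrodinger

namespace MatrixSchrodinger

/-! ### Integrals depending on a parameter. -/

section Parametric

variable {α : Type*} [MeasurableSpace α] {ν : Measure α}
  {E : Type*} [NormedAddCommGroup E] [NormedSpace ℂ E]

/-- A locally dominated integral of holomorphic functions is holomorphic. -/
lemma differentiableOn_integral {F : ℂ → α → E} {U : Set ℂ} (hU : IsOpen U)
    (hm : ∀ z ∈ U, AEStronglyMeasurable (F z) ν)
    (hd : ∀ᵐ s ∂ν, DifferentiableOn ℂ (fun z => F z s) U)
    (hb : ∀ z₀ ∈ U, ∃ r > 0, ∃ g : α → ℝ, Integrable g ν ∧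
      ∀ᵐ s ∂ν, ∀ z ∈ Metric.ball z₀ r ∩ U, ‖F z s‖ ≤ g s) :
    DifferentiableOn ℂ (fun z => ∫ s, F z s ∂ν) U := by
  intro z₀ hz₀
  obtain ⟨r₁, hr₁, g, hg, hbd⟩ := hb z₀ hz₀
  obtain ⟨r₂, hr₂, hsub⟩ := Metric.isOpen_iff.1 hU z₀ hz₀
  set r := min r₁ r₂ with hr
  have hr0 : 0 < r := lt_min hr₁ hr₂
  have hrU : Metric.ball z₀ r ⊆ U := (Metric.ball_subset_ball (min_le_right _ _)).trans hsub
  have hrb : ∀ᵐ s ∂ν, ∀ z ∈ Metric.ball z₀ r, ‖F z s‖ ≤ g s := by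
    filter_upwards [hbd] with s hs z hz
    exact hs z ⟨Metric.ball_subset_ball (min_le_left _ _) hz, hrU hz⟩
  have hda : ∀ᵐ s ∂ν, ∀ z ∈ Metric.ball z₀ r,
      HasDerivAt (fun z => F z s) (deriv (fun z => F z s) z) z := by
    filter_upwards [hd] with s hs z hz
    exact (hs.differentiableAt (hU.mem_nhds (hrU hz))).hasDerivAt
  have hInt : Integrable (F z₀) ν := hg.mono' (hm z₀ hz₀) (by
    filter_upwards [hrb] with s hs
    exact hs z₀ (Metric.mem_ball_self hr0))
  -- The derivative is measurable as a limit of difference quotients. The increments r/(n+2) are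
  -- nonzero and smaller than r already for n = 0.
  have hmd : AEStronglyMeasurable (fun s => deriv (fun z => F z s) z₀) ν := by
    have hseq : Filter.Tendsto (fun n : ℕ => z₀ + ((r / (n + 2) : ℝ) : ℂ)) Filter.atTop
        (nhdsWithin z₀ {z₀}ᶜ) := by
      refine tendsto_nhdsWithin_iff.2 ⟨?_, Filter.Eventually.of_forall fun n => ?_⟩
      · have h1 : Filter.Tendsto (fun n : ℕ => r / ((n : ℝ) + 2)) Filter.atTop (nhds 0) :=
          Filter.Tendsto.div_atTop tendsto_const_nhds
            (Filter.tendsto_atTop_add_const_right _ _ tendsto_natCast_atTop_atTop)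
        have h2 := (Complex.continuous_ofReal.tendsto 0).comp h1
        simpa [Function.comp_def] using h2.const_add z₀
      · have : (0 : ℝ) < r / (n + 2) := by positivity
        simp only [mem_compl_iff, mem_singleton_iff, add_eq_left, Complex.ofReal_eq_zero]
        exact this.ne'
    refine aestronglyMeasurable_of_tendsto_ae Filter.atTop
      (f := fun (n : ℕ) s => slope (fun z => F z s) z₀ (z₀ + ((r / (n + 2) : ℝ) : ℂ)))
      (fun n => ?_) ?_
    · have hmem : z₀ + ((r / (n + 2) : ℝ) : ℂ) ∈ Metric.ball z₀ r := by
        have h0 : (0 : ℝ) < r / (n + 2) := by positivity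
        have h1 : r / ((n : ℝ) + 2) < r := div_lt_self hr0 (by
          have : (0 : ℝ) ≤ n := n.cast_nonneg
          linarith)
        rw [Metric.mem_ball, dist_self_add_left, Complex.norm_real, Real.norm_of_nonneg h0.le]
        exact h1
      simp only [slope_def_module]
      exact ((hm _ (hrU hmem)).sub (hm _ hz₀)).const_smul _
    · filter_upwards [hda] with s hs
      exact (hasDerivAt_iff_tendsto_slope.1 (hs z₀ (Metric.mem_ball_self hr0))).comp hseq
  have hball : Metric.ball z₀ (r / 2) ∈ nhds z₀ := Metric.ball_mem_nhds _ (by positivity)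
  refine ((hasDerivAt_integral_of_dominated_loc_of_deriv_le (bound := fun s => g s / (r / 4))
    (F' := fun z s => deriv (fun z => F z s) z)
    hball ?_ hInt hmd ?_ (hg.div_const _) ?_).2).differentiableAt.differentiableWithinAt
  · filter_upwards [Metric.ball_mem_nhds z₀ hr0] with z hz using hm z (hrU hz)
  · filter_upwards [hrb, hd] with s hs hds z hz
    -- Cauchy's estimate on circles of radius r/4 about points of the half-size ball; this is the
    -- origin of the dominating function g/(r/4).
    have hcb : Metric.closedBall z (r / 4) ⊆ Metric.ball z₀ r := by
      intro w hw
      rw [Metric.mem_closedBall] at hw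
      rw [Metric.mem_ball] at hz ⊢
      linarith [dist_triangle w z z₀]
    refine Complex.norm_deriv_le_of_forall_mem_sphere_norm_le (by positivity) ?_ fun w hw =>
      hs w (hcb (Metric.sphere_subset_closedBall hw))
    refine DifferentiableOn.diffContOnCl ?_
    rw [closure_ball _ (by positivity)]
    exact hds.mono (hcb.trans hrU)
  · filter_upwards [hda] with s hs z hz
    exact hs z (Metric.ball_subset_ball (by linarith) hz)

/-- A locally dominated integral of continuous functions is continuous. -/
lemma continuousOn_integral_of_local_bound {X : Type*} [PseudoMetricSpace X]
    {G : Type*} [NormedAddCommGroup G] [NormedSpace ℝ G] {F : X → α → G} {S : Set X}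
    (hm : ∀ z ∈ S, AEStronglyMeasurable (F z) ν)
    (hd : ∀ᵐ s ∂ν, ContinuousOn (fun z => F z s) S)
    (hb : ∀ z₀ ∈ S, ∃ r > 0, ∃ g : α → ℝ, Integrable g ν ∧
      ∀ᵐ s ∂ν, ∀ z ∈ Metric.ball z₀ r ∩ S, ‖F z s‖ ≤ g s) :
    ContinuousOn (fun z => ∫ s, F z s ∂ν) S := by
  intro z₀ hz₀
  obtain ⟨r, hr, g, hg, hbd⟩ := hb z₀ hz₀
  have hmem : ∀ᶠ z in nhdsWithin z₀ S, z ∈ Metric.ball z₀ r ∩ S :=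
    Filter.inter_mem (mem_nhdsWithin_of_mem_nhds (Metric.ball_mem_nhds _ hr)) self_mem_nhdsWithin
  refine continuousWithinAt_of_dominated (bound := g) ?_ ?_ hg ?_
  · filter_upwards [hmem] with z hz using hm z hz.2
  · filter_upwards [hmem] with z hz
    filter_upwards [hbd] with s hs using hs z hz
  · filter_upwards [hd] with s hs using hs z₀ hz₀

end Parametric

/-! ### Volterra equations: Grönwall's inequality and Picard iteration. -/

section Volterra

/-- Majorants for a Volterra operator `u ↦ ∫_{I x} k(x, t) u(t) dt` on `X`. -/
structure VolterraMajorant (I : ℝ → Set ℝ) (X : Set ℝ) (κ σ : ℝ → ℝ) : Prop where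
  meas : MeasurableSet X
  measI : ∀ x ∈ X, MeasurableSet (I x)
  sub : ∀ x ∈ X, I x ⊆ X
  nonneg : ∀ x ∈ X, 0 ≤ κ x
  integrable : IntegrableOn κ X
  cont : ContinuousOn σ X
  sigma_nonneg : ∀ x ∈ X, 0 ≤ σ x
  bdd : ∃ B, ∀ x ∈ X, σ x ≤ B
  pow : ∀ (n : ℕ), ∀ x ∈ X, ∫ t in I x, κ t * σ t ^ n ≤ σ x ^ (n + 1) / (n + 1)

variable {I : ℝ → Set ℝ} {X : Set ℝ} {κ σ : ℝ → ℝ}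

lemma VolterraMajorant.integrableOn_mul (H : VolterraMajorant I X κ σ) {g : ℝ → ℝ}
    (hg : ContinuousOn g X) {C : ℝ} (hC : ∀ x ∈ X, ‖g x‖ ≤ C) :
    IntegrableOn (fun t => κ t * g t) X :=
  Integrable.mul_bdd H.integrable (hg.aestronglyMeasurable H.meas)
    ((ae_restrict_iff' H.meas).2 (Filter.Eventually.of_forall hC))

lemma VolterraMajorant.integrableOn_pow (H : VolterraMajorant I X κ σ) (n : ℕ) :
    IntegrableOn (fun t => κ t * σ t ^ n) X := by
  obtain ⟨B, hB⟩ := H.bdd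
  refine H.integrableOn_mul (H.cont.pow n) (C := B ^ n) fun x hx => ?_
  rw [Real.norm_of_nonneg (pow_nonneg (H.sigma_nonneg x hx) n)]
  exact pow_le_pow_left₀ (H.sigma_nonneg x hx) (hB x hx) n

/-- The inductive step of both Grönwall's inequality and the Picard bounds: one more integration
raises the power and produces the next factorial. -/
lemma VolterraMajorant.integral_mul_pow_div_le (H : VolterraMajorant I X κ σ) (n : ℕ) {C x : ℝ}
    (hC : 0 ≤ C) (hx : x ∈ X) :
    ∫ t in I x, κ t * (C * (σ t ^ n / n.factorial)) ≤
      C * (σ x ^ (n + 1) / (n + 1).factorial) := by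
  have h : ∀ t, κ t * (C * (σ t ^ n / n.factorial)) = (C / n.factorial) * (κ t * σ t ^ n) := by
    intro t; ring
  simp only [h, integral_const_mul]
  refine (mul_le_mul_of_nonneg_left (H.pow n x hx) (by positivity)).trans_eq ?_
  rw [Nat.factorial_succ]
  push_cast
  field_simp

/-- Grönwall's inequality for a Volterra operator. -/
theorem VolterraMajorant.gronwall (H : VolterraMajorant I X κ σ) {u : ℝ → ℝ} {C : ℝ}
    (hu : ContinuousOn u X) (hu0 : ∀ x ∈ X, 0 ≤ u x) (hub : ∃ B, ∀ x ∈ X, u x ≤ B) (hC : 0 ≤ C)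
    (hle : ∀ x ∈ X, u x ≤ C + ∫ t in I x, κ t * u t) {x : ℝ} (hx : x ∈ X) :
    u x ≤ C * Real.exp (σ x) := by
  obtain ⟨B, hB⟩ := hub
  have hB0 : 0 ≤ B := (hu0 x hx).trans (hB x hx)
  have hun : ∀ x ∈ X, ‖u x‖ ≤ B := fun x hx => by
    rw [Real.norm_of_nonneg (hu0 x hx)]; exact hB x hx
  -- Iterating the hypothesis n times gives a partial sum of the exponential series and a remainder
  -- controlled by the a priori bound B. The remainder disappears as n → ∞.
  have key : ∀ n : ℕ, ∀ x ∈ X, u x ≤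
      (∑ k ∈ Finset.range n, C * (σ x ^ k / k.factorial)) + B * (σ x ^ n / n.factorial) := by
    intro n
    induction n with
    | zero => intro x hx; simpa using hB x hx
    | succ n ih =>
      intro x hx
      have hik : ∀ (k : ℕ) (D : ℝ), IntegrableOn (fun t => κ t * (D * (σ t ^ k / k.factorial)))
          (I x) := fun k D => by
        have := ((H.integrableOn_pow k).mono_set (H.sub x hx)).const_mul (D / k.factorial)
        refine this.congr (Filter.Eventually.of_forall fun t => ?_)
        simp only
        ring
      have h1 : ∫ t in I x, κ t * u t ≤ ∫ t in I x,
          ((∑ k ∈ Finset.range n, κ t * (C * (σ t ^ k / k.factorial))) +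
            κ t * (B * (σ t ^ n / n.factorial))) := by
        refine setIntegral_mono_on ((H.integrableOn_mul hu hun).mono_set (H.sub x hx)) ?_
          (H.measI x hx) fun t ht => ?_
        · exact (integrable_finsetSum _ fun k _ => hik k C).add (hik n B)
        · rw [← Finset.mul_sum, ← mul_add]
          exact mul_le_mul_of_nonneg_left (ih t (H.sub x hx ht)) (H.nonneg t (H.sub x hx ht))
      rw [integral_add (integrable_finsetSum _ fun k _ => hik k C) (hik n B),
        integral_finsetSum _ fun k _ => hik k C] at h1
      refine (hle x hx).trans ?_
      rw [Finset.sum_range_succ']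
      have h2 : ∑ k ∈ Finset.range n, ∫ t in I x, κ t * (C * (σ t ^ k / k.factorial)) ≤
          ∑ k ∈ Finset.range n, C * (σ x ^ (k + 1) / (k + 1).factorial) :=
        Finset.sum_le_sum fun k _ => H.integral_mul_pow_div_le k hC hx
      have h3 := H.integral_mul_pow_div_le n hB0 hx
      have h4 : C * (σ x ^ 0 / (Nat.factorial 0 : ℕ)) = C := by simp
      rw [h4]
      linarith
  have hlim : Filter.Tendsto (fun n : ℕ =>
      (∑ k ∈ Finset.range n, C * (σ x ^ k / k.factorial)) + B * (σ x ^ n / n.factorial))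
      Filter.atTop (nhds (C * Real.exp (σ x) + B * 0)) := by
    refine Filter.Tendsto.add ?_ ((FloorSemiring.tendsto_pow_div_factorial_atTop _).const_mul B)
    have : HasSum (fun k : ℕ => σ x ^ k / k.factorial) (Real.exp (σ x)) := by
      rw [Real.exp_eq_exp_ℝ]
      exact NormedSpace.expSeries_div_hasSum_exp (σ x)
    exact (this.mul_left C).tendsto_sum_nat
  have := ge_of_tendsto' hlim fun n => key n x hx
  simpa using this

variable {E : Type*} [NormedAddCommGroup E] [NormedSpace ℂ E]

/-- The Picard increments of the Volterra equation `u(x) = e₀ + ∫_{I x} k(p, x, t) u(t) dt`. -/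
def volterraIter (I : ℝ → Set ℝ) (k : ℂ → ℝ → ℝ → E →L[ℂ] E) (e₀ : E) : ℕ → ℂ → ℝ → E
  | 0 => fun _ _ => e₀
  | m + 1 => fun p x => ∫ t in I x, k p x t (volterraIter I k e₀ m p t)

/-- The solution of the Volterra equation `u(x) = e₀ + ∫_{I x} k(p, x, t) u(t) dt`. -/
def volterraSol (I : ℝ → Set ℝ) (k : ℂ → ℝ → ℝ → E →L[ℂ] E) (e₀ : E) (p : ℂ) (x : ℝ) : E :=
  ∑' m, volterraIter I k e₀ m p x

/-- A kernel depending on a parameter `p ∈ S`, dominated by `κ`. -/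
structure IsVolterraKernel (I : ℝ → Set ℝ) (X : Set ℝ) (κ : ℝ → ℝ) (S : Set ℂ)
    (k : ℂ → ℝ → ℝ → E →L[ℂ] E) : Prop where
  bound : ∀ p ∈ S, ∀ x ∈ X, ∀ t ∈ I x, ‖k p x t‖ ≤ κ t
  meas : ∀ p ∈ S, ∀ x ∈ X, AEStronglyMeasurable (k p x) (volume.restrict (I x))
  cont : ∀ p ∈ S, ∀ g : ℝ → E, ContinuousOn g X → (∃ C, ∀ t ∈ X, ‖g t‖ ≤ C) →
    ContinuousOn (fun x => ∫ t in I x, k p x t (g t)) X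
  cont_param : ∀ x ∈ X, ∀ t ∈ I x, ContinuousOn (fun p => k p x t) S

variable {S : Set ℂ} {k : ℂ → ℝ → ℝ → E →L[ℂ] E}

section

variable (H : VolterraMajorant I X κ σ) (K : IsVolterraKernel I X κ S k) (e₀ : E)
include H K

/-- Both claims go through one induction: continuity of the next iterate needs the current one to be
continuous and bounded. -/
lemma IsVolterraKernel.iter_aux (m : ℕ) {p : ℂ} (hp : p ∈ S) :
    ContinuousOn (volterraIter I k e₀ m p) X ∧
      ∀ x ∈ X, ‖volterraIter I k e₀ m p x‖ ≤ ‖e₀‖ * (σ x ^ m / m.factorial) := by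
  obtain ⟨B, hB⟩ := H.bdd
  induction m with
  | zero => exact ⟨continuousOn_const, fun x _ => by simp [volterraIter]⟩
  | succ m ih =>
    refine ⟨K.cont p hp _ ih.1 ⟨‖e₀‖ * (B ^ m / m.factorial), fun t ht => (ih.2 t ht).trans ?_⟩,
      fun x hx => ?_⟩
    · have := H.sigma_nonneg t ht
      have := hB t ht
      gcongr
    · refine le_trans ?_ (H.integral_mul_pow_div_le m (norm_nonneg e₀) hx)
      refine norm_integral_le_of_norm_le ?_ ((ae_restrict_iff' (H.measI x hx)).2
        (Filter.Eventually.of_forall fun t ht => ?_))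
      · refine (((H.integrableOn_pow m).mono_set (H.sub x hx)).const_mul
          (‖e₀‖ / m.factorial)).congr (Filter.Eventually.of_forall fun t => ?_)
        simp only
        ring
      · have htX := H.sub x hx ht
        refine (ContinuousLinearMap.le_opNorm _ _).trans ?_
        exact mul_le_mul (K.bound p hp x hx t ht) (ih.2 t htX) (norm_nonneg _) (H.nonneg t htX)

lemma IsVolterraKernel.aestronglyMeasurable {p : ℂ} (hp : p ∈ S) {x : ℝ} (hx : x ∈ X)
    {g : ℝ → E} (hg : ContinuousOn g X) :
    AEStronglyMeasurable (fun t => k p x t (g t)) (volume.restrict (I x)) :=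
  (ContinuousLinearMap.id ℂ (E →L[ℂ] E)).aestronglyMeasurable_comp₂ (K.meas p hp x hx)
    ((hg.mono (H.sub x hx)).aestronglyMeasurable (H.measI x hx))

/-- A summable bound uniform in the point and the parameter. By the Weierstrass test, continuity and
holomorphy pass from the iterates to the sum. -/
lemma IsVolterraKernel.iter_bound {B : ℝ} (hB : ∀ x ∈ X, σ x ≤ B) (m : ℕ) {p : ℂ} (hp : p ∈ S)
    {x : ℝ} (hx : x ∈ X) :
    ‖volterraIter I k e₀ m p x‖ ≤ ‖e₀‖ * (B ^ m / m.factorial) := by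
  refine ((K.iter_aux H e₀ m hp).2 x hx).trans ?_
  have := H.sigma_nonneg x hx
  have := hB x hx
  gcongr

lemma IsVolterraKernel.iter_continuousOn_param (m : ℕ) {x : ℝ} (hx : x ∈ X) :
    ContinuousOn (fun p => volterraIter I k e₀ m p x) S := by
  obtain ⟨B, hB⟩ := H.bdd
  induction m generalizing x with
  | zero => exact continuousOn_const
  | succ m ih =>
    refine continuousOn_integral_of_local_bound
      (fun p hp => K.aestronglyMeasurable H hp hx (K.iter_aux H e₀ m hp).1) ?_ fun p₀ hp₀ =>
      ⟨1, one_pos, fun t => κ t * (‖e₀‖ * (B ^ m / m.factorial)),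
        ((H.integrable.mono_set (H.sub x hx)).mul_const _), ?_⟩
    · refine (ae_restrict_iff' (H.measI x hx)).2 (Filter.Eventually.of_forall fun t ht => ?_)
      exact (K.cont_param x hx t ht).clm_apply (ih (H.sub x hx ht))
    · refine (ae_restrict_iff' (H.measI x hx)).2 (Filter.Eventually.of_forall fun t ht p hp => ?_)
      refine (ContinuousLinearMap.le_opNorm _ _).trans ?_
      exact mul_le_mul (K.bound p hp.2 x hx t ht) (K.iter_bound H e₀ hB m hp.2 (H.sub x hx ht))
        (norm_nonneg _) (H.nonneg t (H.sub x hx ht))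

lemma IsVolterraKernel.iter_differentiableOn_param {U : Set ℂ} (hU : IsOpen U) (hUS : U ⊆ S)
    (hk : ∀ x ∈ X, ∀ t ∈ I x, DifferentiableOn ℂ (fun p => k p x t) U) (m : ℕ) {x : ℝ}
    (hx : x ∈ X) : DifferentiableOn ℂ (fun p => volterraIter I k e₀ m p x) U := by
  obtain ⟨B, hB⟩ := H.bdd
  induction m generalizing x with
  | zero => exact differentiableOn_const _
  | succ m ih =>
    refine differentiableOn_integral hU
      (fun p hp => K.aestronglyMeasurable H (hUS hp) hx (K.iter_aux H e₀ m (hUS hp)).1) ?_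
      fun p₀ hp₀ => ⟨1, one_pos, fun t => κ t * (‖e₀‖ * (B ^ m / m.factorial)),
        ((H.integrable.mono_set (H.sub x hx)).mul_const _), ?_⟩
    · refine (ae_restrict_iff' (H.measI x hx)).2 (Filter.Eventually.of_forall fun t ht => ?_)
      exact (hk x hx t ht).clm_apply (ih (H.sub x hx ht))
    · refine (ae_restrict_iff' (H.measI x hx)).2 (Filter.Eventually.of_forall fun t ht p hp => ?_)
      refine (ContinuousLinearMap.le_opNorm _ _).trans ?_
      exact mul_le_mul (K.bound p (hUS hp.2) x hx t ht)
        (K.iter_bound H e₀ hB m (hUS hp.2) (H.sub x hx ht))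
        (norm_nonneg _) (H.nonneg t (H.sub x hx ht))

variable [CompleteSpace E]

lemma IsVolterraKernel.sol_continuousOn_param {x : ℝ} (hx : x ∈ X) :
    ContinuousOn (fun p => volterraSol I k e₀ p x) S := by
  obtain ⟨B, hB⟩ := H.bdd
  exact continuousOn_tsum (fun m => K.iter_continuousOn_param H e₀ m hx)
    ((Real.summable_pow_div_factorial B).mul_left ‖e₀‖)
    fun m p hp => K.iter_bound H e₀ hB m hp hx

lemma IsVolterraKernel.sol_differentiableOn_param {U : Set ℂ} (hU : IsOpen U) (hUS : U ⊆ S)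
    (hk : ∀ x ∈ X, ∀ t ∈ I x, DifferentiableOn ℂ (fun p => k p x t) U) {x : ℝ} (hx : x ∈ X) :
    DifferentiableOn ℂ (fun p => volterraSol I k e₀ p x) U := by
  obtain ⟨B, hB⟩ := H.bdd
  exact Complex.differentiableOn_tsum_of_summable_norm
    ((Real.summable_pow_div_factorial B).mul_left ‖e₀‖)
    (fun m => K.iter_differentiableOn_param H e₀ hU hUS hk m hx) hU
    fun m p hp => K.iter_bound H e₀ hB m (hUS hp) hx

lemma IsVolterraKernel.sol_continuousOn {p : ℂ} (hp : p ∈ S) :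
    ContinuousOn (volterraSol I k e₀ p) X := by
  obtain ⟨B, hB⟩ := H.bdd
  exact continuousOn_tsum (fun m => (K.iter_aux H e₀ m hp).1)
    ((Real.summable_pow_div_factorial B).mul_left ‖e₀‖)
    fun m x hx => K.iter_bound H e₀ hB m hp hx

omit [CompleteSpace E] in
lemma IsVolterraKernel.norm_sol_le {p : ℂ} (hp : p ∈ S) {x : ℝ} (hx : x ∈ X) :
    ‖volterraSol I k e₀ p x‖ ≤ ‖e₀‖ * Real.exp (σ x) := by
  have : HasSum (fun k : ℕ => σ x ^ k / k.factorial) (Real.exp (σ x)) := by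
    rw [Real.exp_eq_exp_ℝ]
    exact NormedSpace.expSeries_div_hasSum_exp (σ x)
  exact tsum_of_norm_bounded (this.mul_left ‖e₀‖) fun m => (K.iter_aux H e₀ m hp).2 x hx

/-- The Picard series may be integrated term by term by dominated convergence, and the operator
shifts its terms by one. -/
lemma IsVolterraKernel.sol_eq {p : ℂ} (hp : p ∈ S) {x : ℝ} (hx : x ∈ X) :
    volterraSol I k e₀ p x = e₀ + ∫ t in I x, k p x t (volterraSol I k e₀ p t) := by
  obtain ⟨B, hB⟩ := H.bdd
  have hsum : ∀ t ∈ X, Summable fun m => volterraIter I k e₀ m p t := fun t ht =>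
    Summable.of_norm_bounded ((Real.summable_pow_div_factorial B).mul_left ‖e₀‖)
      fun m => K.iter_bound H e₀ hB m hp ht
  have hs := (Real.summable_pow_div_factorial B).mul_left ‖e₀‖
  have key : HasSum (fun m => ∫ t in I x, k p x t (volterraIter I k e₀ m p t))
      (∫ t in I x, k p x t (volterraSol I k e₀ p t)) := by
    refine hasSum_integral_of_dominated_convergence
      (fun m t => κ t * (‖e₀‖ * (B ^ m / m.factorial)))
      (fun m => K.aestronglyMeasurable H hp hx (K.iter_aux H e₀ m hp).1) (fun m => ?_) ?_ ?_ ?_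
    · refine (ae_restrict_iff' (H.measI x hx)).2 (Filter.Eventually.of_forall fun t ht => ?_)
      refine (ContinuousLinearMap.le_opNorm _ _).trans ?_
      exact mul_le_mul (K.bound p hp x hx t ht) (K.iter_bound H e₀ hB m hp (H.sub x hx ht))
        (norm_nonneg _) (H.nonneg t (H.sub x hx ht))
    · exact Filter.Eventually.of_forall fun t => hs.mul_left _
    · simp only [tsum_mul_left]
      exact (H.integrable.mono_set (H.sub x hx)).mul_const _
    · refine (ae_restrict_iff' (H.measI x hx)).2 (Filter.Eventually.of_forall fun t ht => ?_)
      exact (hsum t (H.sub x hx ht)).hasSum.mapL (k p x t)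
  rw [volterraSol, (hsum x hx).tsum_eq_zero_add, ← key.tsum_eq]
  rfl

end

end Volterra

end MatrixSchrodinger

namespace MatrixSchrodinger

/-! ### Majorants for integration over (0, x] and over (x, ∞). -/

section Majorants

lemma IsPrimitive.pow_succ {σ κ : ℝ → ℝ} (h : IsPrimitive σ κ) (m : ℕ) :
    IsPrimitive (fun x => σ x ^ (m + 1)) (fun x => (m + 1) * (κ x * σ x ^ m)) := by
  induction m with
  | zero => simpa using h
  | succ m ih =>
    refine ((ih.mul h).congr fun x _ => ?_).congr_left fun x _ => by ring
    push_cast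
    ring

/-- The majorant of a Volterra operator on `[0, b]` integrating over `(0, x]`. -/
lemma forwardMajorant {κ : ℝ → ℝ} (hκ : ∀ x, 0 ≤ x → IntervalIntegrable κ volume 0 x)
    (h0 : ∀ t, 0 ≤ κ t) {b : ℝ} (hb : 0 ≤ b) :
    VolterraMajorant (fun x => Ioc 0 x) (Icc 0 b) κ (fun x => ∫ t in (0 : ℝ)..x, κ t) := by
  have hp : IsPrimitive (fun x => ∫ t in (0 : ℝ)..x, κ t) κ := by
    simpa using IsPrimitive.of_integral hκ 0
  have hnn : ∀ x, 0 ≤ x → 0 ≤ ∫ t in (0 : ℝ)..x, κ t := fun x hx =>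
    intervalIntegral.integral_nonneg hx fun t _ => h0 t
  refine ⟨measurableSet_Icc, fun _ _ => measurableSet_Ioc, fun x hx t ht =>
    ⟨ht.1.le, ht.2.trans hx.2⟩, fun x _ => h0 x,
    (intervalIntegrable_iff_integrableOn_Icc_of_le hb).1 (hκ b hb),
    hp.continuousOn.mono fun x hx => hx.1, fun x hx => hnn x hx.1,
    ⟨∫ t in (0 : ℝ)..b, κ t, fun x hx => ?_⟩, fun m x hx => ?_⟩
  · exact intervalIntegral.integral_mono_interval le_rfl hx.1 hx.2
      (Filter.Eventually.of_forall h0) (hκ b hb)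
  -- Here the required inequality is an equality: σ vanishes at 0 and the derivative of σ^(m+1) is
  -- (m+1) κ σ^m.
  · have h := (hp.pow_succ m).eq x hx.1
    simp only [intervalIntegral.integral_const_mul, intervalIntegral.integral_same] at h
    rw [← intervalIntegral.integral_of_le hx.1, le_div_iff₀ (by positivity), h]
    simp [mul_comm]

lemma isPrimitive_tail {E : Type*} [NormedAddCommGroup E] [NormedSpace ℝ E] {g : ℝ → E}
    (hg : IntegrableOn g (Ioi 0)) :
    IsPrimitive (fun x => ∫ t in Ioi x, g t) (fun t => -g t) := by
  have hInt : ∀ x, 0 ≤ x → IntervalIntegrable g volume 0 x := fun x hx =>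
    (intervalIntegrable_iff_integrableOn_Ioc_of_le hx).2 (hg.mono_set Ioc_subset_Ioi_self)
  refine (IsPrimitive.of_integral (fun x hx => (hInt x hx).neg)
    (∫ t in Ioi 0, g t)).congr_left fun x hx => ?_
  change (∫ t in Ioi 0, g t) + ∫ t in (0 : ℝ)..x, -g t = _
  rw [intervalIntegral.integral_neg, intervalIntegral.integral_of_le hx,
    ← Ioc_union_Ioi_eq_Ioi hx, setIntegral_union (Ioc_disjoint_Ioi le_rfl)
    measurableSet_Ioi (hg.mono_set Ioc_subset_Ioi_self) (hg.mono_set (Ioi_subset_Ioi hx))]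
  abel

/-- The majorant of a Volterra operator on `[0, ∞)` integrating over `(x, ∞)`. -/
lemma backwardMajorant {κ : ℝ → ℝ} (hκ : IntegrableOn κ (Ioi 0)) (h0 : ∀ t, 0 ≤ κ t) :
    VolterraMajorant (fun x => Ioi x) (Ici 0) κ (fun x => ∫ t in Ioi x, κ t) := by
  have hnn : ∀ x, 0 ≤ ∫ t in Ioi x, κ t := fun x => integral_nonneg h0
  have hp := isPrimitive_tail hκ
  refine ⟨measurableSet_Ici, fun _ _ => measurableSet_Ioi, fun x hx t ht =>
    (le_trans (mem_Ici.1 hx) (mem_Ioi.1 ht).le : (0 : ℝ) ≤ t), fun x _ => h0 x, (integrableOn_Ici_iff_integrableOn_Ioi).2 hκ,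
    hp.continuousOn, fun x _ => hnn x, ⟨∫ t in Ioi 0, κ t, fun x hx => ?_⟩, fun m x hx => ?_⟩
  · exact setIntegral_mono_set hκ (Filter.Eventually.of_forall h0)
      (Ioi_subset_Ioi hx).eventuallyLE
  · have hq := hp.pow_succ m
    have hi : IntegrableOn (fun t => κ t * (∫ s in Ioi t, κ s) ^ m) (Ioi x) := by
      refine Integrable.mul_bdd (c := (∫ t in Ioi 0, κ t) ^ m)
        (hκ.mono_set (Ioi_subset_Ioi hx)) (((hp.continuousOn.pow m).mono
          fun t (ht : x < t) => (le_trans hx ht.le : (0 : ℝ) ≤ t)).aestronglyMeasurable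
            measurableSet_Ioi)
        ((ae_restrict_iff' measurableSet_Ioi).2 (Filter.Eventually.of_forall fun t ht => ?_))
      rw [Real.norm_of_nonneg (pow_nonneg (hnn t) m)]
      refine pow_le_pow_left₀ (hnn t) (setIntegral_mono_set hκ (Filter.Eventually.of_forall h0)
        (Ioi_subset_Ioi (le_trans hx (le_of_lt ht))).eventuallyLE) m
    -- Up to a finite b the integral is (σ(x)^(m+1) - σ(b)^(m+1))/(m+1). The term at b is dropped by
    -- its sign before b → ∞.
    refine le_of_tendsto (intervalIntegral_tendsto_integral_Ioi x hi Filter.tendsto_id) ?_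
    filter_upwards [Filter.eventually_ge_atTop x] with b hb
    have hx0 : (0 : ℝ) ≤ x := hx
    have h := hq.sub_eq hx0 (hx0.trans hb)
    simp only [intervalIntegral.integral_const_mul, neg_mul, intervalIntegral.integral_neg] at h
    rw [id, le_div_iff₀ (by positivity)]
    have := pow_nonneg (hnn b) (m + 1)
    nlinarith

end Majorants

/-! ### The differential equation and its initial value problem. -/

section Equation

variable {R : Type*} [NormedRing R] [NormedAlgebra ℂ R] [CompleteSpace R]

lemma IsPrimitive.smul {s s' : ℝ → ℂ} {F f : ℝ → R} (hs : IsPrimitive s s')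
    (hF : IsPrimitive F f) :
    IsPrimitive (fun x => s x • F x) (fun x => s' x • F x + s x • f x) := by
  have h := (hs.clm ((Algebra.linearMap ℂ R).toContinuousLinearMap.restrictScalars ℝ)).mul hF
  simpa [Algebra.algebraMap_eq_smul_one] using h

lemma IsPrimitive.const_smul {F f : ℝ → R} (hF : IsPrimitive F f) (c : ℂ) :
    IsPrimitive (fun x => c • F x) (fun x => c • f x) :=
  ((IsPrimitive.const c).smul hF).congr fun x _ => by simp

/-- `Y` solves `-Y'' + Q Y = lam Y` with derivative `Y'`. -/
structure SolvesWith (Q : ℝ → R) (lam : ℂ) (Y Y' : ℝ → R) : Prop where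
  fst : IsPrimitive Y Y'
  snd : IsPrimitive Y' (fun t => Q t * Y t - lam • Y t)

/-- `Z` solves `-Z'' + Z Q = lam Z` with derivative `Z'`. -/
structure AdjSolvesWith (Q : ℝ → R) (lam : ℂ) (Z Z' : ℝ → R) : Prop where
  fst : IsPrimitive Z Z'
  snd : IsPrimitive Z' (fun t => Z t * Q t - lam • Z t)

namespace SolvesWith

variable {Q : ℝ → R} {lam mu : ℂ} {Y Y' Z Z' : ℝ → R}

omit [CompleteSpace R] in
lemma add (h : SolvesWith Q lam Y Y') (k : SolvesWith Q lam Z Z') :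
    SolvesWith Q lam (fun x => Y x + Z x) (fun x => Y' x + Z' x) :=
  ⟨h.fst.add k.fst, (h.snd.add k.snd).congr fun x _ => by rw [mul_add, smul_add]; abel⟩

omit [CompleteSpace R] in
lemma sub (h : SolvesWith Q lam Y Y') (k : SolvesWith Q lam Z Z') :
    SolvesWith Q lam (fun x => Y x - Z x) (fun x => Y' x - Z' x) :=
  ⟨h.fst.sub k.fst, (h.snd.sub k.snd).congr fun x _ => by rw [mul_sub, smul_sub]; abel⟩

omit [CompleteSpace R] in
lemma mul_const (h : SolvesWith Q lam Y Y') (c : R) :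
    SolvesWith Q lam (fun x => Y x * c) (fun x => Y' x * c) :=
  ⟨h.fst.mul_const c, (h.snd.mul_const c).congr fun x _ => by
    rw [sub_mul, mul_assoc, smul_mul_assoc]⟩

omit [CompleteSpace R] in
/-- The derivative of the Wronskian. -/
lemma wronskian (h : SolvesWith Q lam Y Y') (k : AdjSolvesWith Q mu Z Z') :
    IsPrimitive (fun x => Z' x * Y x - Z x * Y' x) (fun x => (lam - mu) • (Z x * Y x)) := by
  refine ((k.snd.mul h.fst).sub (k.fst.mul h.snd)).congr fun x _ => ?_
  rw [sub_mul, mul_sub, mul_smul_comm, smul_mul_assoc, sub_smul, mul_assoc]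
  abel

omit [CompleteSpace R] in
-- Grönwall's inequality with constant zero for ‖Y‖ + ‖Y'‖, whose growth rate is at most 1 + ‖Q‖ +
-- ‖lam‖.
lemma eq_zero (hQ : ∀ x, 0 ≤ x → IntervalIntegrable Q volume 0 x) (h : SolvesWith Q lam Y Y')
    (h0 : Y 0 = 0) (h1 : Y' 0 = 0) {x : ℝ} (hx : 0 ≤ x) : Y x = 0 ∧ Y' x = 0 := by
  set κ : ℝ → ℝ := fun t => 1 + ‖Q t‖ + ‖lam‖ with hκ
  have hκi : ∀ x, 0 ≤ x → IntervalIntegrable κ volume 0 x := fun x hx =>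
    (intervalIntegrable_const.add (hQ x hx).norm).add intervalIntegrable_const
  have H := forwardMajorant hκi (fun t => by positivity) hx
  have hsub : Icc 0 x ⊆ Ici (0 : ℝ) := fun t ht => ht.1
  have cY := h.fst.continuousOn
  have cY' := h.snd.continuousOn
  have cu : ContinuousOn (fun t => ‖Y t‖ + ‖Y' t‖) (Ici 0) := cY.norm.add cY'.norm
  have hu := H.gronwall (C := 0) (cu.mono hsub) (fun t _ => by positivity)
    (by
      obtain ⟨B, hB⟩ := (isCompact_Icc.image_of_continuousOn (cu.mono hsub)).bddAbove
      exact ⟨B, fun t ht => hB (mem_image_of_mem _ ht)⟩) le_rfl (fun y hy => ?_)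
    (right_mem_Icc.2 hx)
  · simp only [zero_mul] at hu
    have a1 := norm_nonneg (Y x)
    have a2 := norm_nonneg (Y' x)
    exact ⟨norm_eq_zero.1 (by linarith), norm_eq_zero.1 (by linarith)⟩
  · have hy0 : (0 : ℝ) ≤ y := hy.1
    have hIcc : uIcc 0 y ⊆ Ici (0 : ℝ) := by rw [uIcc_of_le hy0]; exact fun t ht => ht.1
    have b1 : ‖Y y‖ ≤ ∫ t in (0 : ℝ)..y, ‖Y' t‖ := by
      rw [h.fst.eq y hy0, h0, zero_add]
      exact intervalIntegral.norm_integral_le_integral_norm hy0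
    have i1 : IntervalIntegrable (fun t => ‖Y' t‖) volume 0 y :=
      (cY'.norm.mono hIcc).intervalIntegrable
    have i2 : IntervalIntegrable (fun t => (‖Q t‖ + ‖lam‖) * ‖Y t‖) volume 0 y :=
      ((hQ y hy0).norm.add intervalIntegrable_const).mul_continuousOn (cY.norm.mono hIcc)
    have b2 : ‖Y' y‖ ≤ ∫ t in (0 : ℝ)..y, (‖Q t‖ + ‖lam‖) * ‖Y t‖ := by
      rw [h.snd.eq y hy0, h1, zero_add]
      refine intervalIntegral.norm_integral_le_of_norm_le hy0
        (Filter.Eventually.of_forall fun t _ => ?_) i2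
      refine (norm_sub_le _ _).trans ?_
      rw [add_mul, norm_smul]
      gcongr
      exact norm_mul_le _ _
    rw [zero_add, ← intervalIntegral.integral_of_le hy0]
    refine (add_le_add b1 b2).trans ?_
    rw [← intervalIntegral.integral_add i1 i2]
    refine intervalIntegral.integral_mono_on hy0 (i1.add i2)
      ((hκi y hy0).mul_continuousOn (cu.mono hIcc)) fun t _ => ?_
    have a1 := norm_nonneg (Y t)
    have a2 := norm_nonneg (Y' t)
    have a3 := norm_nonneg (Q t)
    have a4 := norm_nonneg lam
    simp only [hκ]
    nlinarith [mul_nonneg a3 a2, mul_nonneg a4 a2]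

omit [CompleteSpace R] in
lemma unique (hQ : ∀ x, 0 ≤ x → IntervalIntegrable Q volume 0 x) (h : SolvesWith Q lam Y Y')
    (k : SolvesWith Q lam Z Z') (h0 : Y 0 = Z 0) (h1 : Y' 0 = Z' 0) {x : ℝ} (hx : 0 ≤ x) :
    Y x = Z x ∧ Y' x = Z' x := by
  have := (h.sub k).eq_zero hQ (sub_eq_zero.2 h0) (sub_eq_zero.2 h1) hx
  exact ⟨sub_eq_zero.1 this.1, sub_eq_zero.1 this.2⟩

end SolvesWith

/-- The potential as a coefficient of the first order system for the pair `(Y, Y')`. -/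
def potentialCoeff : R →L[ℂ] ((R × R) →L[ℂ] (R × R)) :=
  ((ContinuousLinearMap.compL ℂ (R × R) R (R × R)) (ContinuousLinearMap.inr ℂ R R)).comp
    (((ContinuousLinearMap.compL ℂ (R × R) R R).flip (ContinuousLinearMap.fst ℂ R R)).comp
      (ContinuousLinearMap.mul ℂ R))

/-- The coefficient of the first order system for the pair `(Y, Y')`. -/
def systemKernel (Q : ℝ → R) (p : ℂ) (_ t : ℝ) : (R × R) →L[ℂ] (R × R) :=
  (ContinuousLinearMap.inl ℂ R R).comp (ContinuousLinearMap.snd ℂ R R) + potentialCoeff (Q t) -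
    p • (ContinuousLinearMap.inr ℂ R R).comp (ContinuousLinearMap.fst ℂ R R)

/-- The solution, with its derivative, of the initial value problem for `-Y'' + Q Y = lam Y`. -/
def ivpSol (Q : ℝ → R) (Y₀ Y₁ : R) (lam : ℂ) (x : ℝ) : R × R :=
  volterraSol (fun x => Ioc 0 x) (systemKernel Q) (Y₀, Y₁) lam x

omit [CompleteSpace R] in
lemma systemKernel_apply (Q : ℝ → R) (p : ℂ) (x t : ℝ) (u : R × R) :
    systemKernel Q p x t u = (u.2, Q t * u.1 - p • u.1) := by
  simp [systemKernel, potentialCoeff]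

lemma differentiable_const_sub_smul_const {V : Type*} [NormedAddCommGroup V] [NormedSpace ℂ V]
    (a b : V) : Differentiable ℂ fun p : ℂ => a - p • b := by fun_prop

omit [CompleteSpace R] in
lemma differentiable_systemKernel (Q : ℝ → R) (x t : ℝ) :
    Differentiable ℂ fun p => systemKernel Q p x t := by
  unfold systemKernel
  exact differentiable_const_sub_smul_const (V := (R × R) →L[ℂ] (R × R)) _ _

/-- The spectral parameter is confined to a disc of radius M so that one majorant, 1 + ‖Q‖ + M,
serves all its values. -/
lemma isVolterraKernel_systemKernel {Q : ℝ → R}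
    (hQ : ∀ x, 0 ≤ x → IntervalIntegrable Q volume 0 x) {M b : ℝ} (hb : 0 ≤ b) :
    IsVolterraKernel (fun x => Ioc 0 x) (Icc 0 b) (fun t => 1 + ‖Q t‖ + M)
      (Metric.closedBall 0 M) (systemKernel Q) := by
  have hmeas : ∀ p x, x ∈ Icc 0 b → AEStronglyMeasurable (systemKernel Q p x)
      (volume.restrict (Ioc 0 x)) := fun p x hx => by
    exact (aestronglyMeasurable_const.add (potentialCoeff.continuous.comp_aestronglyMeasurable
      (hQ x hx.1).1.aestronglyMeasurable)).sub aestronglyMeasurable_const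
  have hbd : ∀ p ∈ Metric.closedBall (0 : ℂ) M, ∀ x t, ‖systemKernel Q p x t‖ ≤ 1 + ‖Q t‖ + M := by
    intro p hp x t
    have hpM : ‖p‖ ≤ M := mem_closedBall_zero_iff.1 hp
    have hM : 0 ≤ M := (norm_nonneg p).trans hpM
    refine ContinuousLinearMap.opNorm_le_bound _ (by positivity) fun u => ?_
    rw [systemKernel_apply, Prod.norm_def]
    have h1 : ‖u.1‖ ≤ ‖u‖ := norm_fst_le u
    have h2 : ‖u.2‖ ≤ ‖u‖ := norm_snd_le u
    have h0 := norm_nonneg u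
    have hQ0 := norm_nonneg (Q t)
    refine max_le ?_ ?_
    · exact h2.trans (by nlinarith [mul_nonneg hQ0 h0, mul_nonneg hM h0])
    · refine (norm_sub_le _ _).trans ?_
      have h3 : ‖Q t * u.1‖ ≤ ‖Q t‖ * ‖u‖ := (norm_mul_le _ _).trans (by gcongr)
      have h4 : ‖p • u.1‖ ≤ M * ‖u‖ := by rw [norm_smul]; gcongr
      linarith
  refine ⟨fun p hp x _ t _ => hbd p hp x t, fun p _ x hx => hmeas p x hx, fun p hp g hg hC => ?_,
    fun x _ t _ => ?_⟩
  · have hi : IntegrableOn (fun t => systemKernel Q p 0 t (g t)) (Icc 0 b) := by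
      have h1 : IntegrableOn (fun t => (g t).2) (Icc 0 b) := hg.snd.integrableOn_Icc
      have h2 : IntegrableOn (fun t => p • (g t).1) (Icc 0 b) :=
        (hg.fst.const_smul p).integrableOn_Icc
      have h3 : IntegrableOn (fun t => Q t * (g t).1) (Icc 0 b) := by
        refine (intervalIntegrable_iff_integrableOn_Icc_of_le hb).1 ((hQ b hb).mul_continuousOn ?_)
        rw [uIcc_of_le hb]
        exact hg.fst
      simp only [systemKernel_apply]
      exact h1.prodMk (h3.sub h2)
    exact intervalIntegral.continuousOn_primitive hi
  · exact (differentiable_systemKernel Q x t).continuous.continuousOn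

section

variable {Q : ℝ → R} (hQ : ∀ x, 0 ≤ x → IntervalIntegrable Q volume 0 x) (Y₀ Y₁ : R)
include hQ

/-- The Picard series involves neither the interval nor the disc used to prove its convergence. Both
may be fitted to the point at hand, here [0, x] and radius ‖lam‖. -/
lemma ivpSol_eq (lam : ℂ) {x : ℝ} (hx : 0 ≤ x) :
    ivpSol Q Y₀ Y₁ lam x = (Y₀, Y₁) + ∫ t in (0 : ℝ)..x,
      ((ivpSol Q Y₀ Y₁ lam t).2, Q t * (ivpSol Q Y₀ Y₁ lam t).1 -
        lam • (ivpSol Q Y₀ Y₁ lam t).1) := by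
  have H := forwardMajorant (κ := fun t => 1 + ‖Q t‖ + ‖lam‖)
    (fun x hx => (intervalIntegrable_const.add (hQ x hx).norm).add intervalIntegrable_const)
    (fun t => by positivity) hx
  have h := (isVolterraKernel_systemKernel hQ hx (M := ‖lam‖)).sol_eq H (Y₀, Y₁)
    (mem_closedBall_zero_iff.2 le_rfl) (right_mem_Icc.2 hx)
  simp only [systemKernel_apply] at h
  rw [intervalIntegral.integral_of_le hx]
  exact h

lemma ivpSol_continuousOn (lam : ℂ) : ContinuousOn (ivpSol Q Y₀ Y₁ lam) (Ici 0) := by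
  intro x hx
  have hx0 : (0 : ℝ) ≤ x + 1 := by have : (0 : ℝ) ≤ x := hx; linarith
  have H := forwardMajorant (κ := fun t => 1 + ‖Q t‖ + ‖lam‖)
    (fun x hx => (intervalIntegrable_const.add (hQ x hx).norm).add intervalIntegrable_const)
    (fun t => by positivity) hx0
  have h := (isVolterraKernel_systemKernel hQ hx0 (M := ‖lam‖)).sol_continuousOn H (Y₀, Y₁)
    (mem_closedBall_zero_iff.2 le_rfl) x ⟨hx, by linarith⟩
  refine h.mono_of_mem_nhdsWithin ?_
  rw [← Ici_inter_Iic]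
  exact inter_mem_nhdsWithin _ (Iic_mem_nhds (by linarith))

lemma ivpSol_solvesWith (lam : ℂ) :
    SolvesWith Q lam (fun x => (ivpSol Q Y₀ Y₁ lam x).1) (fun x => (ivpSol Q Y₀ Y₁ lam x).2) := by
  have hc := ivpSol_continuousOn hQ Y₀ Y₁ lam
  have hsub : ∀ x, (0 : ℝ) ≤ x → uIcc 0 x ⊆ Ici 0 := fun x hx => by
    rw [uIcc_of_le hx]; exact fun t ht => ht.1
  have hp : IsPrimitive (ivpSol Q Y₀ Y₁ lam) (fun t => ((ivpSol Q Y₀ Y₁ lam t).2,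
      Q t * (ivpSol Q Y₀ Y₁ lam t).1 - lam • (ivpSol Q Y₀ Y₁ lam t).1)) := by
    refine ⟨fun x hx => ?_, fun x hx => ?_⟩
    · have i1 : IntervalIntegrable (fun t => (ivpSol Q Y₀ Y₁ lam t).2) volume 0 x :=
        (hc.snd.mono (hsub x hx)).intervalIntegrable
      have i2 : IntervalIntegrable (fun t => Q t * (ivpSol Q Y₀ Y₁ lam t).1 -
          lam • (ivpSol Q Y₀ Y₁ lam t).1) volume 0 x :=
        ((hQ x hx).mul_continuousOn (hc.fst.mono (hsub x hx))).sub
          ((hc.fst.mono (hsub x hx)).const_smul lam).intervalIntegrable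
      exact ⟨i1.1.prodMk i2.1, i1.2.prodMk i2.2⟩
    · rw [ivpSol_eq hQ Y₀ Y₁ lam hx, ivpSol_eq hQ Y₀ Y₁ lam le_rfl]
      simp
  exact ⟨hp.clm (ContinuousLinearMap.fst ℝ R R), hp.clm (ContinuousLinearMap.snd ℝ R R)⟩

lemma ivpSol_zero (lam : ℂ) : ivpSol Q Y₀ Y₁ lam 0 = (Y₀, Y₁) := by
  rw [ivpSol_eq hQ Y₀ Y₁ lam le_rfl]
  simp

lemma ivpSol_differentiable {x : ℝ} (hx : 0 ≤ x) :
    Differentiable ℂ fun lam => ivpSol Q Y₀ Y₁ lam x := by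
  intro lam
  -- The radius is increased by one so that lam is an interior point of the disc.
  have H := forwardMajorant (κ := fun t => 1 + ‖Q t‖ + (‖lam‖ + 1))
    (fun x hx => (intervalIntegrable_const.add (hQ x hx).norm).add intervalIntegrable_const)
    (fun t => by positivity) hx
  have h := (isVolterraKernel_systemKernel hQ hx (M := ‖lam‖ + 1)).sol_differentiableOn_param H
    (Y₀, Y₁) Metric.isOpen_ball Metric.ball_subset_closedBall
    (fun y _ t _ => (differentiable_systemKernel Q y t).differentiableOn) (right_mem_Icc.2 hx)
  exact h.differentiableAt (Metric.isOpen_ball.mem_nhds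
    (mem_ball_zero_iff.2 (lt_add_one _)))

lemma exists_bound_ivpSol (M : ℝ) {b : ℝ} (hb : 0 ≤ b) :
    ∃ C, ∀ lam : ℂ, ‖lam‖ ≤ M → ∀ x ∈ Icc 0 b, ‖ivpSol Q Y₀ Y₁ lam x‖ ≤ C := by
  by_cases hM : 0 ≤ M
  · have hκ : ∀ x, 0 ≤ x → IntervalIntegrable (fun t => 1 + ‖Q t‖ + M) volume 0 x :=
      fun x hx => (intervalIntegrable_const.add (hQ x hx).norm).add intervalIntegrable_const
    have H := forwardMajorant hκ (fun t => by positivity) hb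
    obtain ⟨B, hB⟩ := H.bdd
    refine ⟨‖(Y₀, Y₁)‖ * Real.exp B, fun lam hlam x hx => ?_⟩
    refine ((isVolterraKernel_systemKernel hQ hb).norm_sol_le H (Y₀, Y₁)
      (mem_closedBall_zero_iff.2 hlam) hx).trans ?_
    gcongr
    exact hB x hx
  · exact ⟨0, fun lam hlam => absurd ((norm_nonneg _).trans hlam) hM⟩

end

end Equation

end MatrixSchrodinger

namespace MatrixSchrodinger

lemma norm_cexp_mul_ofReal (w : ℂ) (x : ℝ) : ‖Complex.exp (w * x)‖ = Real.exp (w.re * x) := by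
  rw [Complex.norm_exp]
  simp

lemma norm_cexp_I_mul (rho : ℂ) (x : ℝ) :
    ‖Complex.exp (Complex.I * rho * x)‖ = Real.exp (-(rho.im * x)) := by
  rw [norm_cexp_mul_ofReal]
  simp

lemma isPrimitive_cexp (w : ℂ) :
    IsPrimitive (fun x : ℝ => Complex.exp (w * x)) (fun x : ℝ => w * Complex.exp (w * x)) := by
  refine IsPrimitive.of_hasDerivAt (fun x _ => ?_) (by fun_prop)
  have h : HasDerivAt (fun z : ℂ => Complex.exp (w * z)) (Complex.exp (w * x) * (w * 1)) x :=
    ((hasDerivAt_id _).const_mul w).cexp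
  rw [mul_comm w]
  simpa using h.comp_ofReal

/-! ### Growth of solutions for large rho. -/

section Forward

variable {R : Type*} [NormedRing R] [NormedAlgebra ℂ R] [CompleteSpace R]
  {Q : ℝ → R} {Y Y' : ℝ → R}

/-- Factorization of the operator: with lam = -w², the function Y' + wY satisfies the first order
equation V' = wV + QY, for which exp(-wx) is an integrating factor. -/
lemma SolvesWith.isPrimitive_exp_smul {w lam : ℂ} (hw : lam = -w ^ 2)
    (h : SolvesWith Q lam Y Y') :
    IsPrimitive (fun x : ℝ => Complex.exp (-w * x) • (Y' x + w • Y x))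
      (fun t : ℝ => Complex.exp (-w * t) • (Q t * Y t)) := by
  refine ((isPrimitive_cexp (-w)).smul (h.snd.add (h.fst.const_smul w))).congr fun x _ => ?_
  rw [hw]
  module

/-- A priori estimates for a solution in terms of its initial values. -/
lemma SolvesWith.forward_bounds (hQ : ∀ x, 0 ≤ x → IntervalIntegrable Q volume 0 x) {rho : ℂ}
    (hrho : rho ≠ 0) (him : 0 ≤ rho.im) (h : SolvesWith Q (rho ^ 2) Y Y') {x : ℝ} (hx : 0 ≤ x)
    {q m : ℝ} (hq : ∫ t in (0 : ℝ)..x, ‖Q t‖ ≤ q)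
    (hm : ‖Y' 0 + (Complex.I * rho) • Y 0‖ + ‖Y' 0 - (Complex.I * rho) • Y 0‖ ≤ m) :
    ‖Y x‖ ≤ m / (2 * ‖rho‖) * Real.exp (q / ‖rho‖) * Real.exp (rho.im * x) ∧
    ‖Y' x + (Complex.I * rho) • Y x -
        Complex.exp (Complex.I * rho * x) • (Y' 0 + (Complex.I * rho) • Y 0)‖ ≤
      q * (m / (2 * ‖rho‖) * Real.exp (q / ‖rho‖)) * Real.exp (rho.im * x) ∧
    ‖Y' x - (Complex.I * rho) • Y x -
        Complex.exp (-(Complex.I * rho) * x) • (Y' 0 - (Complex.I * rho) • Y 0)‖ ≤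
      q * (m / (2 * ‖rho‖) * Real.exp (q / ‖rho‖)) * Real.exp (rho.im * x) := by
  have hr : 0 < ‖rho‖ := norm_pos_iff.2 hrho
  set w : ℂ := Complex.I * rho with hw
  have hw1 : rho ^ 2 = -w ^ 2 := by rw [hw, mul_pow, Complex.I_sq]; ring
  have hw2 : rho ^ 2 = -(-w) ^ 2 := by rw [hw1]; ring
  have hwre : w.re = -rho.im := by simp [hw]
  have hsub : ∀ y, (0 : ℝ) ≤ y → uIcc 0 y ⊆ Ici 0 := fun y hy => by
    rw [uIcc_of_le hy]; exact fun t ht => ht.1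
  have cY := h.fst.continuousOn
  set u : ℝ → ℝ := fun t => Real.exp (-(rho.im * t)) * ‖Y t‖ with hu
  have cu : ContinuousOn u (Ici 0) := by
    refine ContinuousOn.mul ?_ cY.norm
    fun_prop
  have iQu : ∀ y, 0 ≤ y → IntervalIntegrable (fun t => ‖Q t‖ * u t) volume 0 y := fun y hy =>
    (hQ y hy).norm.mul_continuousOn (cu.mono (hsub y hy))
  -- The equation is solved for Y' + wY and, with -w in place of w, for Y' - wY. Both errors are
  -- measured by the integral of ‖Q‖ u, where u is ‖Y‖ freed from the growth exp(Im rho · x).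
  have est1 : ∀ y, 0 ≤ y → ‖Y' y + w • Y y - Complex.exp (w * y) • (Y' 0 + w • Y 0)‖ ≤
      Real.exp (rho.im * y) * ∫ t in (0 : ℝ)..y, ‖Q t‖ * u t := by
    intro y hy
    have h1 := (h.isPrimitive_exp_smul hw1).eq y hy
    simp only [Complex.ofReal_zero, mul_zero, Complex.exp_zero, one_smul] at h1
    have h2 : Y' y + w • Y y - Complex.exp (w * y) • (Y' 0 + w • Y 0) =
        Complex.exp (w * y) • ∫ t in (0 : ℝ)..y, Complex.exp (-w * t) • (Q t * Y t) := by
      rw [← sub_eq_iff_eq_add'.2 h1, smul_sub, smul_smul, ← Complex.exp_add]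
      simp
    rw [h2, norm_smul, norm_cexp_mul_ofReal, hwre]
    have h3 : ‖∫ t in (0 : ℝ)..y, Complex.exp (-w * t) • (Q t * Y t)‖ ≤
        ∫ t in (0 : ℝ)..y, Real.exp (rho.im * y * 2) * (‖Q t‖ * u t) := by
      refine intervalIntegral.norm_integral_le_of_norm_le hy
        (Filter.Eventually.of_forall fun t ht => ?_) ((iQu y hy).const_mul _)
      rw [norm_smul, norm_cexp_mul_ofReal, Complex.neg_re, hwre, neg_neg]
      -- A deliberate loss, valid because t ≤ y: the error for the decaying combination then has the
      -- same form as that for the growing one.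
      have h4 : Real.exp (rho.im * t) ≤ Real.exp (rho.im * y * 2) * Real.exp (-(rho.im * t)) := by
        rw [← Real.exp_add]
        refine Real.exp_le_exp.2 ?_
        nlinarith [mul_le_mul_of_nonneg_left ht.2 him]
      calc Real.exp (rho.im * t) * ‖Q t * Y t‖ ≤
          (Real.exp (rho.im * y * 2) * Real.exp (-(rho.im * t))) * (‖Q t‖ * ‖Y t‖) :=
            mul_le_mul h4 (norm_mul_le _ _) (norm_nonneg _) (by positivity)
        _ = _ := by simp only [hu]; ring
    rw [intervalIntegral.integral_const_mul] at h3
    calc _ ≤ Real.exp (-rho.im * y) * (Real.exp (rho.im * y * 2) *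
          ∫ t in (0 : ℝ)..y, ‖Q t‖ * u t) := by gcongr
      _ = _ := by
        rw [← mul_assoc, ← Real.exp_add]
        congr 2
        ring
  have est2 : ∀ y, 0 ≤ y → ‖Y' y - w • Y y - Complex.exp (-w * y) • (Y' 0 - w • Y 0)‖ ≤
      Real.exp (rho.im * y) * ∫ t in (0 : ℝ)..y, ‖Q t‖ * u t := by
    intro y hy
    have h1 := (h.isPrimitive_exp_smul hw2).eq y hy
    simp only [neg_neg, neg_smul, ← sub_eq_add_neg, Complex.ofReal_zero, mul_zero,
      Complex.exp_zero, one_smul] at h1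
    have h2 : Y' y - w • Y y - Complex.exp (-w * y) • (Y' 0 - w • Y 0) =
        Complex.exp (-w * y) • ∫ t in (0 : ℝ)..y, Complex.exp (w * t) • (Q t * Y t) := by
      have h3 : Complex.exp (-w * y) * Complex.exp (w * y) = 1 := by
        rw [← Complex.exp_add]; simp
      rw [← sub_eq_iff_eq_add'.2 h1, smul_sub _ (Complex.exp (w * y) • _), smul_smul, h3, one_smul]
    rw [h2, norm_smul, norm_cexp_mul_ofReal, Complex.neg_re, hwre, neg_neg]
    gcongr
    refine intervalIntegral.norm_integral_le_of_norm_le hy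
        (Filter.Eventually.of_forall fun t ht => ?_) (iQu y hy)
    rw [norm_smul, norm_cexp_mul_ofReal, hwre, neg_mul]
    calc Real.exp (-(rho.im * t)) * ‖Q t * Y t‖ ≤
          Real.exp (-(rho.im * t)) * (‖Q t‖ * ‖Y t‖) := by gcongr; exact norm_mul_le _ _
        _ = _ := by simp only [hu]; ring
  have hYle : ∀ y, 0 ≤ y → u y ≤ m / (2 * ‖rho‖) + ∫ t in (0 : ℝ)..y, ‖Q t‖ / ‖rho‖ * u t := by
    intro y hy
    have e1 := est1 y hy
    have e2 := est2 y hy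
    set J := ∫ t in (0 : ℝ)..y, ‖Q t‖ * u t with hJ
    have hJ' : ∫ t in (0 : ℝ)..y, ‖Q t‖ / ‖rho‖ * u t = J / ‖rho‖ := by
      rw [hJ, ← intervalIntegral.integral_div]
      congr 1
      ext t
      ring
    -- Y is recovered from the difference of the two combinations; dividing by 2w gives the factor
    -- 1/‖rho‖ that makes the Grönwall exponent q/‖rho‖.
    have hsplit : (2 * w) • Y y =
        (Y' y + w • Y y - Complex.exp (w * y) • (Y' 0 + w • Y 0)) -
        (Y' y - w • Y y - Complex.exp (-w * y) • (Y' 0 - w • Y 0)) +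
        Complex.exp (w * y) • (Y' 0 + w • Y 0) - Complex.exp (-w * y) • (Y' 0 - w • Y 0) := by
      module
    have hn1 : ‖Complex.exp (w * y) • (Y' 0 + w • Y 0)‖ ≤
        Real.exp (rho.im * y) * ‖Y' 0 + w • Y 0‖ := by
      rw [norm_smul, norm_cexp_mul_ofReal, hwre]
      gcongr
      nlinarith [mul_nonneg him hy]
    have hn2 : ‖Complex.exp (-w * y) • (Y' 0 - w • Y 0)‖ ≤
        Real.exp (rho.im * y) * ‖Y' 0 - w • Y 0‖ := by
      rw [norm_smul, norm_cexp_mul_ofReal, Complex.neg_re, hwre, neg_neg]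
    have hnw : ‖w‖ = ‖rho‖ := by simp [hw]
    have hn : 2 * ‖rho‖ * ‖Y y‖ ≤ Real.exp (rho.im * y) * (2 * J + m) := by
      have : ‖(2 * w) • Y y‖ = 2 * ‖rho‖ * ‖Y y‖ := by rw [norm_smul, norm_mul, hnw]; simp
      rw [← this, hsplit]
      refine (norm_sub_le _ _).trans ((add_le_add ((norm_add_le _ _).trans
        (add_le_add (norm_sub_le _ _) le_rfl)) le_rfl).trans ?_)
      nlinarith [Real.exp_pos (rho.im * y), mul_le_mul_of_nonneg_left hm
        (Real.exp_pos (rho.im * y)).le]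
    rw [hJ', div_add_div _ _ (by positivity) hr.ne', le_div_iff₀ (by positivity)]
    have : Real.exp (-(rho.im * y)) * Real.exp (rho.im * y) = 1 := by
      rw [← Real.exp_add]; simp
    calc u y * (2 * ‖rho‖ * ‖rho‖) = ‖rho‖ * (Real.exp (-(rho.im * y)) *
          (2 * ‖rho‖ * ‖Y y‖)) := by simp only [hu]; ring
      _ ≤ ‖rho‖ * (Real.exp (-(rho.im * y)) * (Real.exp (rho.im * y) * (2 * J + m))) := by gcongr
      _ = ‖rho‖ * (2 * J + m) := by rw [← mul_assoc (Real.exp _), this, one_mul]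
      _ = _ := by ring
  have hm0 : 0 ≤ m := le_trans (by positivity) hm
  have hκ : ∀ y, 0 ≤ y → IntervalIntegrable (fun t => ‖Q t‖ / ‖rho‖) volume 0 y := fun y hy =>
    (hQ y hy).norm.div_const _
  have H := forwardMajorant hκ (fun t => by positivity) hx
  have hu0 : ∀ y, 0 ≤ u y := fun y => by simp only [hu]; positivity
  have hgr : ∀ y ∈ Icc 0 x, u y ≤ m / (2 * ‖rho‖) * Real.exp (q / ‖rho‖) := by
    intro y hy
    have cu' : ContinuousOn u (Icc 0 x) := cu.mono fun t ht => ht.1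
    refine (H.gronwall (C := m / (2 * ‖rho‖)) cu' (fun t _ => hu0 t) ?_ (by positivity) (fun z hz => ?_) hy).trans ?_
    · obtain ⟨B, hB⟩ := (isCompact_Icc.image_of_continuousOn cu').bddAbove
      exact ⟨B, fun t ht => hB (mem_image_of_mem _ ht)⟩
    · rw [← intervalIntegral.integral_of_le hz.1]
      exact hYle z hz.1
    · gcongr
      rw [intervalIntegral.integral_div]
      gcongr
      exact (intervalIntegral.integral_mono_interval le_rfl hy.1 hy.2
        (Filter.Eventually.of_forall fun t => norm_nonneg _) (hQ x hx).norm).trans hq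
  set c := m / (2 * ‖rho‖) * Real.exp (q / ‖rho‖) with hc
  have hc0 : 0 ≤ c := by positivity
  have hInt : ∫ t in (0 : ℝ)..x, ‖Q t‖ * u t ≤ q * c := by
    calc ∫ t in (0 : ℝ)..x, ‖Q t‖ * u t ≤ ∫ t in (0 : ℝ)..x, ‖Q t‖ * c := by
          refine intervalIntegral.integral_mono_on hx (iQu x hx) ((hQ x hx).norm.mul_const _)
            fun t ht => ?_
          exact mul_le_mul_of_nonneg_left (hgr t ht) (norm_nonneg _)
      _ ≤ q * c := by
          rw [intervalIntegral.integral_mul_const]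
          gcongr
  refine ⟨?_, ?_, ?_⟩
  · have := hgr x (right_mem_Icc.2 hx)
    have h1 : Real.exp (-(rho.im * x)) * Real.exp (rho.im * x) = 1 := by
      rw [← Real.exp_add]; simp
    calc ‖Y x‖ = u x * Real.exp (rho.im * x) := by
          simp only [hu]; linear_combination (-‖Y x‖) * h1
      _ ≤ _ := by gcongr
  · refine (est1 x hx).trans ?_
    rw [mul_comm]
    gcongr
  · refine (est2 x hx).trans ?_
    rw [mul_comm]
    gcongr

end Forward

end MatrixSchrodinger

namespace MatrixSchrodinger

/-! ### The Jost solution: construction, estimates, analyticity, uniqueness. -/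

section Jost

variable {R : Type*} [NormedRing R] [NormedAlgebra ℂ R] [CompleteSpace R] {Q : ℝ → R}

/-- The phase `exp (2 i rho (t - x))`. -/
def phase (rho : ℂ) (x t : ℝ) : ℂ := Complex.exp (2 * (Complex.I * rho) * (t - x))

/-- The kernel of the Volterra equation for `exp (-i rho x) e(x, rho)`. -/
def jostKernel (Q : ℝ → R) (rho : ℂ) (x t : ℝ) : R →L[ℂ] R :=
  ((phase rho x t - 1) / (2 * (Complex.I * rho))) • ContinuousLinearMap.mul ℂ R (Q t)

/-- The normalized Jost solution `exp (-i rho x) e(x, rho)`. -/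
def jostU (Q : ℝ → R) (rho : ℂ) (x : ℝ) : R :=
  volterraSol (fun x => Ioi x) (jostKernel Q) 1 rho x

/-- The normalized derivative `exp (-i rho x) e'(x, rho)` of the Jost solution. -/
def jostV (Q : ℝ → R) (rho : ℂ) (x : ℝ) : R :=
  (Complex.I * rho) • (1 : R) - ∫ t in Ioi x, ((phase rho x t + 1) / 2) • (Q t * jostU Q rho t)

/-- The Jost solution. -/
def jostFun (Q : ℝ → R) (rho : ℂ) (x : ℝ) : R := Complex.exp (Complex.I * rho * x) • jostU Q rho x

/-- The derivative of the Jost solution. -/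
def jostDeriv (Q : ℝ → R) (rho : ℂ) (x : ℝ) : R :=
  Complex.exp (Complex.I * rho * x) • jostV Q rho x

lemma norm_phase_le {rho : ℂ} (h : 0 ≤ rho.im) {x t : ℝ} (hxt : x ≤ t) : ‖phase rho x t‖ ≤ 1 := by
  have : (2 * (Complex.I * rho) * (t - x) : ℂ) = Complex.I * rho * ((2 * (t - x) : ℝ) : ℂ) := by
    push_cast; ring
  rw [phase, this, norm_cexp_I_mul]
  refine Real.exp_le_one_iff.2 ?_
  have := mul_nonneg h (sub_nonneg.2 hxt)
  linarith

lemma continuous_phase (rho : ℂ) (x : ℝ) : Continuous (phase rho x) := by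
  unfold phase; fun_prop

lemma differentiable_phase (x t : ℝ) : Differentiable ℂ fun rho => phase rho x t := by
  unfold phase; fun_prop

lemma phase_eq (rho : ℂ) (x t : ℝ) : phase rho x t =
    Complex.exp (-(2 * (Complex.I * rho)) * x) * Complex.exp (2 * (Complex.I * rho) * t) := by
  rw [phase, ← Complex.exp_add]; ring_nf

/-- The part of the closed upper half-plane outside a disc. -/
def upperRegion (δ : ℝ) : Set ℂ := {rho | 0 ≤ rho.im ∧ δ ≤ ‖rho‖}

lemma norm_coeff_le {δ : ℝ} (hδ : 0 < δ) {rho : ℂ} (h : rho ∈ upperRegion δ) {x t : ℝ}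
    (hxt : x ≤ t) : ‖(phase rho x t - 1) / (2 * (Complex.I * rho))‖ ≤ 1 / δ := by
  have h1 : ‖phase rho x t - 1‖ ≤ 2 := (norm_sub_le _ _).trans (by
    have := norm_phase_le h.1 hxt
    rw [norm_one]; linarith)
  rw [norm_div]
  have h2 : ‖2 * (Complex.I * rho)‖ = 2 * ‖rho‖ := by simp
  rw [h2, div_le_div_iff₀ (by linarith [h.2]) hδ]
  nlinarith [h.2]

variable (hQ : IntegrableOn Q (Ioi 0))
include hQ

omit [NormedAlgebra ℂ R] [CompleteSpace R] in
lemma jostMajorant {δ : ℝ} (hδ : 0 < δ) :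
    VolterraMajorant (fun x => Ioi x) (Ici 0) (fun t => ‖Q t‖ / δ)
      (fun x => ∫ t in Ioi x, ‖Q t‖ / δ) :=
  backwardMajorant (hQ.norm.div_const δ) fun t => by positivity

omit [NormedAlgebra ℂ R] [CompleteSpace R] in
lemma integrableOn_mul_of_bounded {g : ℝ → R} (hg : ContinuousOn g (Ici 0)) {C : ℝ}
    (hC : ∀ t ∈ Ici (0 : ℝ), ‖g t‖ ≤ C) : IntegrableOn (fun t => Q t * g t) (Ioi 0) := by
  refine Integrable.mono' (hQ.norm.mul_const C) (hQ.aestronglyMeasurable.mul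
    ((hg.mono Ioi_subset_Ici_self).aestronglyMeasurable measurableSet_Ioi)) ?_
  refine (ae_restrict_iff' measurableSet_Ioi).2 (Filter.Eventually.of_forall fun t ht => ?_)
  refine (norm_mul_le _ _).trans ?_
  gcongr
  exact hC t (Ioi_subset_Ici_self ht)

omit [CompleteSpace R] hQ in
lemma integrableOn_phase_smul {rho : ℂ} (him : 0 ≤ rho.im) {g : ℝ → R} {x : ℝ}
    (hg : IntegrableOn g (Ioi x)) : IntegrableOn (fun t => phase rho x t • g t) (Ioi x) := by
  refine Integrable.mono hg ((continuous_phase rho x).aestronglyMeasurable.smul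
    hg.aestronglyMeasurable) ?_
  refine (ae_restrict_iff' measurableSet_Ioi).2 (Filter.Eventually.of_forall fun t ht => ?_)
  rw [norm_smul]
  exact mul_le_of_le_one_left (norm_nonneg _) (norm_phase_le him (le_of_lt ht))

omit [CompleteSpace R] hQ in
lemma integrableOn_exp_smul {rho : ℂ} (him : 0 ≤ rho.im) {g : ℝ → R}
    (hg : IntegrableOn g (Ioi 0)) :
    IntegrableOn (fun t : ℝ => Complex.exp (2 * (Complex.I * rho) * t) • g t) (Ioi 0) := by
  simpa [phase] using integrableOn_phase_smul him hg

omit [CompleteSpace R] hQ in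
-- The phase splits into a factor in x and a factor in t. The dependence on x is then that of an
-- exponential times a tail integral, which is continuous and can be differentiated.
lemma integral_phase_smul (rho : ℂ) (g : ℝ → R) (x : ℝ) :
    ∫ t in Ioi x, phase rho x t • g t = Complex.exp (-(2 * (Complex.I * rho)) * x) •
      ∫ t in Ioi x, Complex.exp (2 * (Complex.I * rho) * t) • g t := by
  rw [← integral_smul]
  simp only [phase_eq, smul_smul]

omit [CompleteSpace R] in
lemma isVolterraKernel_jostKernel {δ : ℝ} (hδ : 0 < δ) :
    IsVolterraKernel (fun x => Ioi x) (Ici 0) (fun t => ‖Q t‖ / δ) (upperRegion δ)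
      (jostKernel Q) := by
  refine ⟨fun p hp x hx t ht => ?_, fun p hp x hx => ?_, fun p hp g hg ⟨C, hC⟩ => ?_,
    fun x hx t ht => ?_⟩
  · rw [jostKernel, norm_smul]
    calc _ ≤ 1 / δ * ‖Q t‖ := mul_le_mul (norm_coeff_le hδ hp (le_of_lt ht))
          (ContinuousLinearMap.opNorm_mul_apply_le ℂ R (Q t)) (norm_nonneg _) (by positivity)
      _ = _ := by ring
  · have h1 : AEStronglyMeasurable (fun t => (phase p x t - 1) / (2 * (Complex.I * p)))
        (volume.restrict (Ioi x)) :=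
      (((continuous_phase p x).sub continuous_const).div_const _).aestronglyMeasurable
    have h2 : AEStronglyMeasurable (fun t => ContinuousLinearMap.mul ℂ R (Q t))
        (volume.restrict (Ioi x)) :=
      (ContinuousLinearMap.mul ℂ R).continuous.comp_aestronglyMeasurable
        (hQ.mono_set (Ioi_subset_Ioi hx)).aestronglyMeasurable
    exact h1.smul h2
  · have hi := integrableOn_mul_of_bounded hQ hg hC
    have h1 := (isPrimitive_tail (integrableOn_exp_smul hp.1 hi)).continuousOn
    have h2 := (isPrimitive_tail hi).continuousOn
    have h3 : ContinuousOn (fun x : ℝ => (2 * (Complex.I * p))⁻¹ •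
        (Complex.exp (-(2 * (Complex.I * p)) * x) •
        (∫ t in Ioi x, Complex.exp (2 * (Complex.I * p) * t) • (Q t * g t)) -
        ∫ t in Ioi x, Q t * g t)) (Ici 0) := by
      refine ((ContinuousOn.smul ?_ h1).sub h2).const_smul _
      fun_prop
    refine h3.congr fun x hx => ?_
    have hx' := hi.mono_set (Ioi_subset_Ioi hx)
    simp only
    rw [← integral_phase_smul, ← integral_sub (integrableOn_phase_smul hp.1 hx') hx',
      ← integral_smul]
    congr 1
    ext t
    simp only [jostKernel, smul_apply, ContinuousLinearMap.mul_apply']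
    rw [div_eq_inv_mul, mul_smul, sub_smul, one_smul]
  · have h1 : ContinuousOn (fun p => (phase p x t - 1) / (2 * (Complex.I * p)))
        (upperRegion δ) := ?_
    · exact h1.smul continuousOn_const
    refine ((differentiable_phase x t).continuous.continuousOn.sub continuousOn_const).div
      (by fun_prop) fun p hp => ?_
    have : p ≠ 0 := norm_pos_iff.1 (hδ.trans_le hp.2)
    simp [this]

section Estimates

variable {rho : ℂ} (hrho : rho ∈ Omega)
include hrho

omit [CompleteSpace R] hQ in
lemma mem_upperRegion_norm : rho ∈ upperRegion ‖rho‖ := ⟨hrho.1, le_rfl⟩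

omit [CompleteSpace R] hQ in
lemma norm_pos_of_mem_Omega : 0 < ‖rho‖ := norm_pos_iff.2 hrho.2

omit [CompleteSpace R] in
lemma norm_jostU_le_of_le {δ : ℝ} (hδ : 0 < δ) (hδr : δ ≤ ‖rho‖) {x : ℝ} (hx : 0 ≤ x) :
    ‖jostU Q rho x‖ ≤ ‖(1 : R)‖ * Real.exp ((∫ t in Ioi 0, ‖Q t‖) / δ) := by
  refine ((isVolterraKernel_jostKernel hQ hδ).norm_sol_le
    (jostMajorant hQ hδ) 1 ⟨hrho.1, hδr⟩ hx).trans ?_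
  gcongr
  rw [integral_div]
  gcongr
  · exact Filter.Eventually.of_forall fun t => norm_nonneg _
  · exact hQ.norm

omit [CompleteSpace R] in
lemma norm_jostU_le {x : ℝ} (hx : 0 ≤ x) :
    ‖jostU Q rho x‖ ≤ ‖(1 : R)‖ * Real.exp ((∫ t in Ioi 0, ‖Q t‖) / ‖rho‖) :=
  norm_jostU_le_of_le hQ hrho (norm_pos_of_mem_Omega hrho) le_rfl hx

lemma jostU_continuousOn : ContinuousOn (jostU Q rho) (Ici 0) :=
  (isVolterraKernel_jostKernel hQ (norm_pos_of_mem_Omega hrho)).sol_continuousOn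
    (jostMajorant hQ (norm_pos_of_mem_Omega hrho)) 1 (mem_upperRegion_norm hrho)

lemma integrableOn_mul_jostU : IntegrableOn (fun t => Q t * jostU Q rho t) (Ioi 0) :=
  integrableOn_mul_of_bounded hQ (jostU_continuousOn hQ hrho) fun _ ht => norm_jostU_le hQ hrho ht

lemma jostU_eq {x : ℝ} (hx : 0 ≤ x) :
    jostU Q rho x = 1 + ∫ t in Ioi x, ((phase rho x t - 1) / (2 * (Complex.I * rho))) •
      (Q t * jostU Q rho t) :=
  (isVolterraKernel_jostKernel hQ (norm_pos_of_mem_Omega hrho)).sol_eq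
    (jostMajorant hQ (norm_pos_of_mem_Omega hrho)) 1 (mem_upperRegion_norm hrho) hx

omit [CompleteSpace R] in
lemma norm_integral_smul_jostU_le {x : ℝ} (hx : 0 ≤ x) {c : ℝ → ℂ} {b : ℝ}
    (hc : ∀ t, x ≤ t → ‖c t‖ ≤ b) :
    ‖∫ t in Ioi x, c t • (Q t * jostU Q rho t)‖ ≤
      b * (‖(1 : R)‖ * Real.exp ((∫ t in Ioi 0, ‖Q t‖) / ‖rho‖)) * ∫ t in Ioi x, ‖Q t‖ := by
  rw [← integral_const_mul]
  refine norm_integral_le_of_norm_le ((hQ.mono_set (Ioi_subset_Ioi hx)).norm.const_mul _)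
    ((ae_restrict_iff' measurableSet_Ioi).2 (Filter.Eventually.of_forall fun t ht => ?_))
  rw [norm_smul]
  have h1 := hc t (le_of_lt ht)
  have h2 := norm_jostU_le hQ hrho (hx.trans (le_of_lt ht))
  have h3 := norm_mul_le (Q t) (jostU Q rho t)
  have hb : 0 ≤ b := (norm_nonneg _).trans h1
  calc _ ≤ b * (‖Q t‖ * (‖(1 : R)‖ * Real.exp ((∫ t in Ioi 0, ‖Q t‖) / ‖rho‖))) := by gcongr; exact h3.trans (by gcongr)
    _ = _ := by ring

lemma norm_jostU_sub_one_le {x : ℝ} (hx : 0 ≤ x) :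
    ‖jostU Q rho x - 1‖ ≤ 1 / ‖rho‖ * (‖(1 : R)‖ *
      Real.exp ((∫ t in Ioi 0, ‖Q t‖) / ‖rho‖)) * ∫ t in Ioi x, ‖Q t‖ := by
  rw [jostU_eq hQ hrho hx, add_sub_cancel_left]
  exact norm_integral_smul_jostU_le hQ hrho hx fun t ht =>
    norm_coeff_le (norm_pos_of_mem_Omega hrho) (mem_upperRegion_norm hrho) ht

omit [CompleteSpace R] hQ in
lemma norm_phase_add_one_div_two_le {x t : ℝ} (h : x ≤ t) : ‖(phase rho x t + 1) / 2‖ ≤ 1 := by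
  have := norm_phase_le hrho.1 h
  have h2 := norm_add_le (phase rho x t) 1
  rw [norm_one] at h2
  rw [norm_div, Complex.norm_ofNat, div_le_one two_pos]
  linarith

omit [CompleteSpace R] in
lemma norm_jostV_sub_le {x : ℝ} (hx : 0 ≤ x) :
    ‖jostV Q rho x - (Complex.I * rho) • (1 : R)‖ ≤ ‖(1 : R)‖ *
      Real.exp ((∫ t in Ioi 0, ‖Q t‖) / ‖rho‖) * ∫ t in Ioi x, ‖Q t‖ := by
  rw [jostV, sub_sub_cancel_left, norm_neg]
  have := norm_integral_smul_jostU_le hQ hrho hx fun t ht => norm_phase_add_one_div_two_le hrho ht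
  rwa [one_mul] at this

omit [NormedAlgebra ℂ R] hrho [CompleteSpace R] in
lemma tendsto_tail_norm : Filter.Tendsto (fun x => ∫ t in Ioi x, ‖Q t‖) Filter.atTop (nhds 0) := by
  have h := (intervalIntegral_tendsto_integral_Ioi 0 hQ.norm Filter.tendsto_id).const_sub
    (∫ t in Ioi 0, ‖Q t‖)
  rw [sub_self] at h
  refine h.congr' ?_
  filter_upwards [Filter.eventually_ge_atTop 0] with x hx
  rw [id, intervalIntegral.integral_of_le hx, sub_eq_iff_eq_add, add_comm,
    ← Ioc_union_Ioi_eq_Ioi hx, setIntegral_union (Ioc_disjoint_Ioi le_rfl)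
    measurableSet_Ioi (hQ.mono_set Ioc_subset_Ioi_self).norm
    (hQ.mono_set (Ioi_subset_Ioi hx)).norm]

lemma tendsto_jostU : Filter.Tendsto (jostU Q rho) Filter.atTop (nhds 1) := by
  rw [tendsto_iff_norm_sub_tendsto_zero]
  refine squeeze_zero' (Filter.Eventually.of_forall fun _ => norm_nonneg _)
    ((Filter.eventually_ge_atTop 0).mono fun x hx => norm_jostU_sub_one_le hQ hrho hx) ?_
  simpa using (tendsto_tail_norm hQ).const_mul _

omit [CompleteSpace R] in
lemma tendsto_jostV :
    Filter.Tendsto (jostV Q rho) Filter.atTop (nhds ((Complex.I * rho) • (1 : R))) := by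
  rw [tendsto_iff_norm_sub_tendsto_zero]
  refine squeeze_zero' (Filter.Eventually.of_forall fun _ => norm_nonneg _)
    ((Filter.eventually_ge_atTop 0).mono fun x hx => norm_jostV_sub_le hQ hrho hx) ?_
  simpa using (tendsto_tail_norm hQ).const_mul _

/-- The Jost solution solves the differential equation. -/
lemma jostFun_solvesWith : SolvesWith Q (rho ^ 2) (jostFun Q rho) (jostDeriv Q rho) := by
  set w : ℂ := Complex.I * rho with hw
  have hw0 : w ≠ 0 := mul_ne_zero Complex.I_ne_zero hrho.2
  have hw2 : rho ^ 2 = -w ^ 2 := by rw [hw, mul_pow, Complex.I_sq]; ring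
  have hi := integrableOn_mul_jostU hQ hrho
  set g : ℝ → R := fun t => Q t * jostU Q rho t with hg
  have p1 := isPrimitive_tail (integrableOn_exp_smul hrho.1 hi)
  have p2 := isPrimitive_tail hi
  have e1 : ∀ x, 0 ≤ x → jostFun Q rho x = Complex.exp (w * x) • (1 : R) + (2 * w)⁻¹ •
      (Complex.exp (-w * x) • (∫ t in Ioi x, Complex.exp (2 * w * t) • g t) -
        Complex.exp (w * x) • ∫ t in Ioi x, g t) := by
    intro x hx
    have hx' := hi.mono_set (Ioi_subset_Ioi hx)
    have hU : jostU Q rho x = 1 + (2 * w)⁻¹ • (Complex.exp (-(2 * w) * x) •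
        (∫ t in Ioi x, Complex.exp (2 * w * t) • g t) - ∫ t in Ioi x, g t) := by
      rw [jostU_eq hQ hrho hx, ← integral_phase_smul,
        ← integral_sub (integrableOn_phase_smul hrho.1 hx') hx', ← integral_smul]
      congr 2
      ext t
      rw [div_eq_inv_mul, mul_smul, sub_smul, one_smul]
    have hE : Complex.exp (w * x) * Complex.exp (-(2 * w) * x) = Complex.exp (-w * x) := by
      rw [← Complex.exp_add]; ring_nf
    rw [jostFun, hU, ← hE]
    module
  have e2 : ∀ x, 0 ≤ x → jostDeriv Q rho x = Complex.exp (w * x) • (w • (1 : R)) - (2 : ℂ)⁻¹ •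
      (Complex.exp (-w * x) • (∫ t in Ioi x, Complex.exp (2 * w * t) • g t) +
        Complex.exp (w * x) • ∫ t in Ioi x, g t) := by
    intro x hx
    have hx' := hi.mono_set (Ioi_subset_Ioi hx)
    have hV : jostV Q rho x = w • (1 : R) - (2 : ℂ)⁻¹ • (Complex.exp (-(2 * w) * x) •
        (∫ t in Ioi x, Complex.exp (2 * w * t) • g t) + ∫ t in Ioi x, g t) := by
      rw [jostV, ← integral_phase_smul,
        ← integral_add (integrableOn_phase_smul hrho.1 hx') hx', ← integral_smul]
      congr 2
      ext t
      rw [div_eq_inv_mul, mul_smul, add_smul, one_smul]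
    have hE : Complex.exp (w * x) * Complex.exp (-(2 * w) * x) = Complex.exp (-w * x) := by
      rw [← Complex.exp_add]; ring_nf
    rw [jostDeriv, hV, ← hE]
    module
  have hEE : ∀ x : ℝ, Complex.exp (2 * w * x) = Complex.exp (w * x) * Complex.exp (w * x) :=
    fun x => by rw [← Complex.exp_add]; ring_nf
  have hEm : ∀ x : ℝ, Complex.exp (-w * x) * Complex.exp (w * x) = 1 := fun x => by
    rw [← Complex.exp_add]; simp
  -- The boundary terms from differentiating the two tail integrals have the same exponential. They
  -- cancel in e', because the sine vanishes at t = x, and add up to Q e in e''.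
  have hcancel : ∀ x : ℝ, Complex.exp (-w * x) • (Complex.exp (2 * w * x) • g x) =
      Complex.exp (w * x) • g x := fun x => by
    rw [hEE, smul_smul, ← mul_assoc, hEm, one_mul]
  have q1 := (isPrimitive_cexp (-w)).smul p1
  have q2 := (isPrimitive_cexp w).smul p2
  refine ⟨?_, ?_⟩
  · refine ((((isPrimitive_cexp w).smul (IsPrimitive.const (1 : R))).add
      ((q1.sub q2).const_smul (2 * w)⁻¹)).congr_left fun x hx => (e1 x hx).symm).congr
      fun x hx => ?_
    rw [e2 x hx.le]
    simp only [smul_neg, ← hw, hcancel, smul_zero]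
    match_scalars <;> (field_simp <;> ring)
  · refine ((((isPrimitive_cexp w).smul (IsPrimitive.const (w • (1 : R)))).sub
      ((q1.add q2).const_smul (2 : ℂ)⁻¹)).congr_left fun x hx => (e2 x hx).symm).congr
      fun x hx => ?_
    have hge : Q x * jostFun Q rho x = Complex.exp (w * x) • g x := by
      rw [jostFun, mul_smul_comm]
    rw [hge, e1 x hx.le, hw2]
    simp only [smul_neg, ← hw, hcancel, smul_zero]
    match_scalars <;> (field_simp <;> ring)

end Estimates

section Parameter

lemma jostU_continuousOn_param {x : ℝ} (hx : 0 ≤ x) :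
    ContinuousOn (fun rho => jostU Q rho x) Omega := by
  intro rho hrho
  have h0 := norm_pos_of_mem_Omega hrho
  -- The majorant needs a lower bound for the modulus of the parameter; half of ‖rho‖ leaves room
  -- for a neighbourhood of rho.
  have h := (isVolterraKernel_jostKernel hQ (half_pos h0)).sol_continuousOn_param
    (jostMajorant hQ (half_pos h0)) 1 (mem_Ici.2 hx) rho ⟨hrho.1, by linarith⟩
  refine h.mono_of_mem_nhdsWithin ?_
  have : {z : ℂ | ‖rho‖ / 2 < ‖z‖} ∈ nhds rho :=
    (isOpen_lt continuous_const continuous_norm).mem_nhds (show ‖rho‖ / 2 < ‖rho‖ by linarith)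
  filter_upwards [self_mem_nhdsWithin, mem_nhdsWithin_of_mem_nhds this] with z hz hz2
  exact ⟨hz.1, hz2.le⟩

lemma jostU_differentiableOn_param {x : ℝ} (hx : 0 ≤ x) :
    DifferentiableOn ℂ (fun rho => jostU Q rho x) {rho | 0 < rho.im} := by
  intro rho hrho
  have hne : rho ≠ 0 := by rintro rfl; simp at hrho
  have h0 : 0 < ‖rho‖ := norm_pos_iff.2 hne
  have hopen : IsOpen {z : ℂ | 0 < z.im ∧ ‖rho‖ / 2 < ‖z‖} :=
    (isOpen_lt continuous_const Complex.continuous_im).inter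
      (isOpen_lt continuous_const continuous_norm)
  have h := (isVolterraKernel_jostKernel hQ (half_pos h0)).sol_differentiableOn_param
    (jostMajorant hQ (half_pos h0)) 1 hopen (fun z hz => ⟨hz.1.le, hz.2.le⟩)
    (fun y _ t _ => ?_) (mem_Ici.2 hx)
  · exact (h.differentiableAt (hopen.mem_nhds ⟨hrho, by linarith⟩)).differentiableWithinAt
  · refine DifferentiableOn.smul_const ?_ _
    refine ((differentiable_phase y t).differentiableOn.sub (differentiableOn_const _)).div
      (by fun_prop) fun z hz => ?_
    have : z ≠ 0 := by
      rintro rfl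
      simp at hz
    simp [this]

omit hQ in
lemma upper_half_subset_Omega : {rho : ℂ | 0 < rho.im} ⊆ Omega := fun rho h =>
  ⟨le_of_lt h, by rintro rfl; simp at h⟩

omit [CompleteSpace R] in
-- Points within ‖rho‖/2 of rho have modulus at least ‖rho‖/2, so one integrable bound serves all of
-- them, and the derivative of the Jost solution inherits continuity and holomorphy in rho.
lemma jostV_local_bound {rho : ℂ} (hrho : rho ∈ Omega) {x : ℝ} (hx : 0 ≤ x) :
    ∃ r > 0, ∃ g : ℝ → ℝ, Integrable g (volume.restrict (Ioi x)) ∧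
      ∀ᵐ t ∂(volume.restrict (Ioi x)), ∀ z ∈ Metric.ball rho r ∩ Omega,
        ‖((phase z x t + 1) / 2) • (Q t * jostU Q z t)‖ ≤ g t := by
  have h0 := norm_pos_of_mem_Omega hrho
  refine ⟨‖rho‖ / 2, by positivity, fun t => ‖Q t‖ * (‖(1 : R)‖ *
    Real.exp ((∫ t in Ioi 0, ‖Q t‖) / (‖rho‖ / 2))),
    (hQ.mono_set (Ioi_subset_Ioi hx)).norm.mul_const _,
    (ae_restrict_iff' measurableSet_Ioi).2 (Filter.Eventually.of_forall fun t ht z hz => ?_)⟩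
  have hz1 : ‖rho‖ / 2 ≤ ‖z‖ := by
    have h1 := Metric.mem_ball.1 hz.1
    rw [dist_comm, dist_eq_norm] at h1
    linarith [norm_sub_norm_le rho z]
  rw [norm_smul]
  refine (mul_le_of_le_one_left (norm_nonneg _)
    (norm_phase_add_one_div_two_le hz.2 (le_of_lt ht))).trans ((norm_mul_le _ _).trans ?_)
  refine mul_le_mul_of_nonneg_left ?_ (norm_nonneg _)
  exact norm_jostU_le_of_le hQ hz.2 (half_pos h0) hz1 (hx.trans (le_of_lt ht))

lemma jostV_aestronglyMeasurable {rho : ℂ} (hrho : rho ∈ Omega) {x : ℝ} (hx : 0 ≤ x) :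
    AEStronglyMeasurable (fun t => ((phase rho x t + 1) / 2) • (Q t * jostU Q rho t))
      (volume.restrict (Ioi x)) :=
  (((continuous_phase rho x).add continuous_const).div_const _).aestronglyMeasurable.smul
    ((integrableOn_mul_jostU hQ hrho).mono_set (Ioi_subset_Ioi hx)).aestronglyMeasurable

lemma jostV_continuousOn_param {x : ℝ} (hx : 0 ≤ x) :
    ContinuousOn (fun rho => jostV Q rho x) Omega := by
  refine ContinuousOn.sub (by fun_prop) (continuousOn_integral_of_local_bound
    (fun z hz => jostV_aestronglyMeasurable hQ hz hx) ?_ fun z hz => jostV_local_bound hQ hz hx)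
  refine (ae_restrict_iff' measurableSet_Ioi).2 (Filter.Eventually.of_forall fun t ht => ?_)
  exact (((differentiable_phase x t).continuous.add continuous_const).div_const _).continuousOn.smul
    (continuousOn_const.mul (jostU_continuousOn_param hQ (hx.trans (le_of_lt ht))))

lemma jostV_differentiableOn_param {x : ℝ} (hx : 0 ≤ x) :
    DifferentiableOn ℂ (fun rho => jostV Q rho x) {rho | 0 < rho.im} := by
  refine DifferentiableOn.sub (by fun_prop) (differentiableOn_integral
    (isOpen_lt continuous_const Complex.continuous_im)
    (fun z hz => jostV_aestronglyMeasurable hQ (upper_half_subset_Omega hz) hx) ?_ fun z hz => ?_)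
  · refine (ae_restrict_iff' measurableSet_Ioi).2 (Filter.Eventually.of_forall fun t ht => ?_)
    exact (((differentiable_phase x t).add_const _).div_const _).differentiableOn.smul
      ((jostU_differentiableOn_param hQ (hx.trans (le_of_lt ht))).const_mul _)
  · obtain ⟨r, hr, g, hg, hb⟩ := jostV_local_bound hQ (upper_half_subset_Omega hz) hx
    exact ⟨r, hr, g, hg, hb.mono fun t ht w hw => ht w ⟨hw.1, upper_half_subset_Omega hw.2⟩⟩

end Parameter

section Uniqueness

omit [CompleteSpace R] hQ in
-- Euler's formula for the sine. It turns the Jost equation for e into the Volterra equation for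
-- exp(-i rho x) e, whose kernel is bounded in the upper half-plane.
lemma exp_smul_sin_smul {rho : ℂ} (hrho : rho ≠ 0) (x t : ℝ) (q e : R) :
    Complex.exp (-(Complex.I * rho) * x) • (Complex.sin (rho * ((t : ℂ) - x)) / rho) • (q * e) =
      ((phase rho x t - 1) / (2 * (Complex.I * rho))) •
        (q * (Complex.exp (-(Complex.I * rho) * t) • e)) := by
  rw [mul_smul_comm, smul_smul, smul_smul]
  congr 1
  have h1 : Complex.exp (-(Complex.I * rho) * t) * phase rho x t =
      Complex.exp (-(Complex.I * rho) * x) * Complex.exp (rho * ((t : ℂ) - x) * Complex.I) := by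
    rw [phase, ← Complex.exp_add, ← Complex.exp_add]; ring_nf
  have h2 : Complex.exp (-(Complex.I * rho) * t) =
      Complex.exp (-(Complex.I * rho) * x) * Complex.exp (-(rho * ((t : ℂ) - x)) * Complex.I) := by
    rw [← Complex.exp_add]; ring_nf
  have h3 : (phase rho x t - 1) / (2 * (Complex.I * rho)) * Complex.exp (-(Complex.I * rho) * t) =
      (Complex.exp (-(Complex.I * rho) * t) * phase rho x t -
        Complex.exp (-(Complex.I * rho) * t)) / (2 * (Complex.I * rho)) := by ring
  rw [h3, h1, h2, Complex.sin]
  have hI := Complex.I_ne_zero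
  field_simp
  rw [Complex.I_sq]
  ring

lemma jostFun_equation {rho : ℂ} (hrho : rho ∈ Omega) {x : ℝ} (hx : 0 ≤ x) :
    jostFun Q rho x = Complex.exp (Complex.I * rho * x) • (1 : R) +
      ∫ t in Ioi x, (Complex.sin (rho * ((t : ℂ) - x)) / rho) • (Q t * jostFun Q rho t) := by
  have hE : ∀ t : ℝ, Complex.exp (-(Complex.I * rho) * t) * Complex.exp (Complex.I * rho * t) = 1 :=
    fun t => by rw [← Complex.exp_add]; simp
  have hU : ∀ t, jostU Q rho t = Complex.exp (-(Complex.I * rho) * t) • jostFun Q rho t :=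
    fun t => by rw [jostFun, smul_smul, hE, one_smul]
  have h := jostU_eq hQ hrho hx
  rw [jostFun, h, smul_add, ← integral_smul]
  congr 2
  ext t
  rw [hU t, ← exp_smul_sin_smul hrho.2, smul_smul, mul_comm, hE, one_smul]

/-- The normalized difference of two solutions is bounded and satisfies the homogeneous Volterra
inequality, so Grönwall with constant zero kills it. The growth bound on e is what makes the
normalized function bounded. -/
lemma jostFun_unique {rho : ℂ} (hrho : rho ∈ Omega) {e : ℝ → R} (hc : ContinuousOn e (Ici 0))
    (hb : ∃ C : ℝ, ∀ x, 0 ≤ x → ‖e x‖ ≤ C * Real.exp (-(rho.im * x)))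
    (heq : ∀ x : ℝ, 0 ≤ x → e x = Complex.exp (Complex.I * rho * x) • (1 : R) +
      ∫ t in Ioi x, (Complex.sin (rho * ((t : ℂ) - x)) / rho) • (Q t * e t)) {x : ℝ} (hx : 0 ≤ x) :
    e x = jostFun Q rho x := by
  obtain ⟨C, hC⟩ := hb
  have hr := norm_pos_of_mem_Omega hrho
  have hE : ∀ t : ℝ, Complex.exp (-(Complex.I * rho) * t) * Complex.exp (Complex.I * rho * t) = 1 :=
    fun t => by rw [← Complex.exp_add]; simp
  set u : ℝ → R := fun t => Complex.exp (-(Complex.I * rho) * t) • e t with hu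
  have hEn : ∀ t : ℝ, ‖Complex.exp (-(Complex.I * rho) * t)‖ = Real.exp (rho.im * t) := fun t => by
    rw [norm_cexp_mul_ofReal]; simp
  have hueq : ∀ y, 0 ≤ y → u y = 1 + ∫ t in Ioi y,
      ((phase rho y t - 1) / (2 * (Complex.I * rho))) • (Q t * u t) := by
    intro y hy
    simp only [hu]
    rw [heq y hy, smul_add, smul_smul, hE, one_smul, ← integral_smul]
    simp only [exp_smul_sin_smul hrho.2]
  have hub : ∀ y ∈ Ici (0 : ℝ), ‖u y‖ ≤ C := fun y hy => by
    simp only [hu]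
    rw [norm_smul, hEn]
    refine (mul_le_mul_of_nonneg_left (hC y hy) (Real.exp_pos _).le).trans_eq ?_
    rw [mul_left_comm, ← Real.exp_add]
    simp
  have huc : ContinuousOn u (Ici 0) := ContinuousOn.smul (by fun_prop) hc
  have hUc := jostU_continuousOn hQ hrho
  have hQu := integrableOn_mul_of_bounded hQ huc hub
  have hQU := integrableOn_mul_jostU hQ hrho
  have H := jostMajorant hQ hr
  have hci : ∀ {g : ℝ → R}, IntegrableOn g (Ioi 0) → ∀ y, 0 ≤ y → IntegrableOn
      (fun t => ((phase rho y t - 1) / (2 * (Complex.I * rho))) • g t) (Ioi y) := by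
    intro g hg y hy
    have h1 := hg.mono_set (Ioi_subset_Ioi hy)
    refine (((integrableOn_phase_smul hrho.1 h1).sub h1).smul (2 * (Complex.I * rho))⁻¹).congr
      (Filter.Eventually.of_forall fun t => ?_)
    simp only [Pi.smul_apply, Pi.sub_apply]
    rw [div_eq_inv_mul, mul_smul, sub_smul, one_smul]
  have hzero := H.gronwall (u := fun y => ‖u y - jostU Q rho y‖) (C := 0) (huc.sub hUc).norm
    (fun _ _ => norm_nonneg _)
    ⟨C + ‖(1 : R)‖ * Real.exp ((∫ t in Ioi 0, ‖Q t‖) / ‖rho‖), fun y hy =>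
      (norm_sub_le _ _).trans (add_le_add (hub y hy) (norm_jostU_le hQ hrho hy))⟩ le_rfl
    (fun y hy => ?_) (mem_Ici.2 hx)
  · rw [zero_mul] at hzero
    have h1 : u x = jostU Q rho x := sub_eq_zero.1 (norm_le_zero_iff.1 hzero)
    rw [jostFun, ← h1, hu, smul_smul, mul_comm, hE, one_smul]
  · rw [zero_add, hueq y hy, jostU_eq hQ hrho hy, add_sub_add_left_eq_sub,
      ← integral_sub (hci hQu y hy) (hci hQU y hy)]
    refine norm_integral_le_of_norm_le (H.integrableOn_mul (huc.sub hUc).norm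
      (C := C + ‖(1 : R)‖ * Real.exp ((∫ t in Ioi 0, ‖Q t‖) / ‖rho‖)) (fun z hz => ?_)
      |>.mono_set (H.sub y hy)) ((ae_restrict_iff' measurableSet_Ioi).2
        (Filter.Eventually.of_forall fun t ht => ?_))
    · rw [norm_norm]
      exact (norm_sub_le _ _).trans (add_le_add (hub z hz) (norm_jostU_le hQ hrho hz))
    · rw [← smul_sub, ← mul_sub, norm_smul]
      calc _ ≤ 1 / ‖rho‖ * (‖Q t‖ * ‖u t - jostU Q rho t‖) :=
            mul_le_mul (norm_coeff_le hr (mem_upperRegion_norm hrho) (le_of_lt ht))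
              (norm_mul_le _ _) (norm_nonneg _) (by positivity)
        _ = _ := by ring

end Uniqueness

end Jost

end MatrixSchrodinger

namespace MatrixSchrodinger

/-! ### The objects of the problem expressed by the constructed solutions; transposition. -/

variable {n : ℕ} {Q : ℝ → Mat n} {A h : Mat n}

/-- Transposition as a continuous linear map. -/
def transposeCLM (n : ℕ) : Mat n →L[ℂ] Mat n :=
  LinearMap.toContinuousLinearMap (Matrix.transposeLinearEquiv (Fin n) (Fin n) ℂ ℂ).toLinearMap

lemma continuous_transpose_mat : Continuous fun B : Mat n => Bᵀ := (transposeCLM n).continuous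

lemma intervalIntegrable_of_integrableOn (hQ : IntegrableOn Q (Ioi 0)) (x : ℝ) (hx : 0 ≤ x) :
    IntervalIntegrable Q volume 0 x :=
  (intervalIntegrable_iff_integrableOn_Ioc_of_le hx).2 (hQ.mono_set Ioc_subset_Ioi_self)

lemma integrableOn_transpose (hQ : IntegrableOn Q (Ioi 0)) :
    IntegrableOn (fun t => (Q t)ᵀ) (Ioi 0) := (transposeCLM n).integrable_comp hQ

lemma D_congr {Y Z : ℝ → Mat n} (hYZ : ∀ x, 0 ≤ x → Y x = Z x) {x : ℝ} (hx : 0 ≤ x) :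
    D Y x = D Z x := derivWithin_congr (fun y hy => hYZ y hy) (hYZ x hx)

lemma IsPrimitive.D_eq {Y Y' Y'' : ℝ → Mat n} (h : IsPrimitive Y Y') (h' : IsPrimitive Y' Y'')
    {x : ℝ} (hx : 0 ≤ x) : D Y x = Y' x := h.derivWithin_eq h'.continuousOn hx

lemma isPrimitive_D {Y f : ℝ → Mat n} (hY : DifferentiableOn ℝ Y (Ici 0))
    (hf : ∀ x, 0 ≤ x → IntervalIntegrable f volume 0 x)
    (hD : ∀ x, 0 ≤ x → D Y x = D Y 0 + ∫ t in (0 : ℝ)..x, f t) :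
    IsPrimitive Y (D Y) ∧ IsPrimitive (D Y) f := by
  have h2 : IsPrimitive (D Y) f := ⟨hf, hD⟩
  exact ⟨IsPrimitive.of_hasDerivWithinAt (fun x hx => (hY x hx).hasDerivWithinAt) h2.continuousOn,
    h2⟩

lemma IsSolution.solvesWith (hQ : IntegrableOn Q (Ioi 0)) {lam : ℂ} {Y : ℝ → Mat n}
    (hY : IsSolution Q lam Y) : SolvesWith Q lam Y (D Y) := by
  have hc := hY.differentiable.continuousOn
  have hsub : ∀ x, (0 : ℝ) ≤ x → uIcc 0 x ⊆ Ici 0 := fun x hx => by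
    rw [uIcc_of_le hx]; exact fun t ht => ht.1
  have := isPrimitive_D hY.differentiable (fun x hx =>
    ((intervalIntegrable_of_integrableOn hQ x hx).mul_continuousOn (hc.mono (hsub x hx))).sub
      ((hc.mono (hsub x hx)).const_smul lam).intervalIntegrable) hY.equation
  exact ⟨this.1, this.2⟩

lemma IsAdjSolution.adjSolvesWith (hQ : IntegrableOn Q (Ioi 0)) {lam : ℂ} {Z : ℝ → Mat n}
    (hZ : IsAdjSolution Q lam Z) : AdjSolvesWith Q lam Z (D Z) := by
  have hc := hZ.differentiable.continuousOn
  have hsub : ∀ x, (0 : ℝ) ≤ x → uIcc 0 x ⊆ Ici 0 := fun x hx => by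
    rw [uIcc_of_le hx]; exact fun t ht => ht.1
  have := isPrimitive_D hZ.differentiable (fun x hx =>
    ((intervalIntegrable_of_integrableOn hQ x hx).continuousOn_mul (hc.mono (hsub x hx))).sub
      ((hc.mono (hsub x hx)).const_smul lam).intervalIntegrable) hZ.equation
  exact ⟨this.1, this.2⟩

lemma SolvesWith.isSolution {lam : ℂ} {Y Y' : ℝ → Mat n} (h : SolvesWith Q lam Y Y') :
    IsSolution Q lam Y :=
  ⟨fun x hx => (h.fst.hasDerivWithinAt h.snd.continuousOn hx).differentiableWithinAt,
    fun x hx => by rw [h.fst.D_eq h.snd hx, h.fst.D_eq h.snd le_rfl, h.snd.eq x hx]⟩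

lemma AdjSolvesWith.isAdjSolution {lam : ℂ} {Z Z' : ℝ → Mat n} (h : AdjSolvesWith Q lam Z Z') :
    IsAdjSolution Q lam Z :=
  ⟨fun x hx => (h.fst.hasDerivWithinAt h.snd.continuousOn hx).differentiableWithinAt,
    fun x hx => by rw [h.fst.D_eq h.snd hx, h.fst.D_eq h.snd le_rfl, h.snd.eq x hx]⟩

lemma IsPrimitive.transpose {F f : ℝ → Mat n} (h : IsPrimitive F f) :
    IsPrimitive (fun x => (F x)ᵀ) (fun x => (f x)ᵀ) :=
  h.clm ((transposeCLM n).restrictScalars ℝ)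

/-- Transposition exchanges the equation and its adjoint, with Qᵀ as the potential. Facts about
adjoint solutions are obtained in this way from those about ordinary ones. -/
lemma SolvesWith.transpose {lam : ℂ} {Y Y' : ℝ → Mat n}
    (h : SolvesWith (fun t => (Q t)ᵀ) lam Y Y') :
    AdjSolvesWith Q lam (fun x => (Y x)ᵀ) (fun x => (Y' x)ᵀ) :=
  ⟨h.fst.transpose, h.snd.transpose.congr fun x _ => by simp⟩

lemma AdjSolvesWith.transpose {lam : ℂ} {Z Z' : ℝ → Mat n} (h : AdjSolvesWith Q lam Z Z') :
    SolvesWith (fun t => (Q t)ᵀ) lam (fun x => (Z x)ᵀ) (fun x => (Z' x)ᵀ) :=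
  ⟨h.fst.transpose, h.snd.transpose.congr fun x _ => by simp⟩

/-- The solution, with its derivative, of the initial value problem for `-Z'' + Z Q = lam Z`. -/
def adjIvpSol (Q : ℝ → Mat n) (Z₀ Z₁ : Mat n) (lam : ℂ) (x : ℝ) : Mat n × Mat n :=
  ((ivpSol (fun t => (Q t)ᵀ) Z₀ᵀ Z₁ᵀ lam x).1ᵀ, (ivpSol (fun t => (Q t)ᵀ) Z₀ᵀ Z₁ᵀ lam x).2ᵀ)

section

variable (hQ : IntegrableOn Q (Ioi 0))
include hQ

lemma adjIvpSol_solvesWith (Z₀ Z₁ : Mat n) (lam : ℂ) :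
    AdjSolvesWith Q lam (fun x => (adjIvpSol Q Z₀ Z₁ lam x).1)
      (fun x => (adjIvpSol Q Z₀ Z₁ lam x).2) :=
  (ivpSol_solvesWith (intervalIntegrable_of_integrableOn (integrableOn_transpose hQ))
    Z₀ᵀ Z₁ᵀ lam).transpose

lemma adjIvpSol_zero (Z₀ Z₁ : Mat n) (lam : ℂ) : adjIvpSol Q Z₀ Z₁ lam 0 = (Z₀, Z₁) := by
  simp [adjIvpSol, ivpSol_zero (intervalIntegrable_of_integrableOn (integrableOn_transpose hQ))]

lemma phi_spec (A h : Mat n) (lam : ℂ) :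
    IsSolution Q lam (phi Q A h lam) ∧ phi Q A h lam 0 = A ∧ D (phi Q A h lam) 0 = perp A + h := by
  refine Classical.epsilon_spec
    (p := fun Y => IsSolution Q lam Y ∧ Y 0 = A ∧ D Y 0 = perp A + h) ?_
  have hq := intervalIntegrable_of_integrableOn hQ
  have hs := ivpSol_solvesWith hq A (perp A + h) lam
  refine ⟨_, hs.isSolution, ?_, ?_⟩
  · simp [ivpSol_zero hq]
  · rw [hs.fst.D_eq hs.snd le_rfl]
    simp [ivpSol_zero hq]

/-- `phi` is picked by choice separately for each lam. Uniqueness identifies it on [0, ∞) with the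
Picard solution, for which analyticity in lam is known. -/
lemma phi_eq (A h : Mat n) (lam : ℂ) {x : ℝ} (hx : 0 ≤ x) :
    phi Q A h lam x = (ivpSol Q A (perp A + h) lam x).1 ∧
      D (phi Q A h lam) x = (ivpSol Q A (perp A + h) lam x).2 := by
  have hq := intervalIntegrable_of_integrableOn hQ
  obtain ⟨h1, h2, h3⟩ := phi_spec hQ A h lam
  exact (h1.solvesWith hQ).unique hq (ivpSol_solvesWith hq A (perp A + h) lam)
    (by simp [h2, ivpSol_zero hq]) (by simp [h3, ivpSol_zero hq]) hx

lemma phiStar_spec (A h : Mat n) (lam : ℂ) :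
    IsAdjSolution Q lam (phiStar Q A h lam) ∧ phiStar Q A h lam 0 = A ∧
      D (phiStar Q A h lam) 0 = perp A + h := by
  refine Classical.epsilon_spec
    (p := fun Z => IsAdjSolution Q lam Z ∧ Z 0 = A ∧ D Z 0 = perp A + h) ?_
  have hs := adjIvpSol_solvesWith hQ A (perp A + h) lam
  refine ⟨_, hs.isAdjSolution, ?_, ?_⟩
  · simp [adjIvpSol_zero hQ]
  · rw [hs.fst.D_eq hs.snd le_rfl]
    simp [adjIvpSol_zero hQ]

lemma phiStar_eq (A h : Mat n) (lam : ℂ) {x : ℝ} (hx : 0 ≤ x) :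
    phiStar Q A h lam x = (adjIvpSol Q A (perp A + h) lam x).1 ∧
      D (phiStar Q A h lam) x = (adjIvpSol Q A (perp A + h) lam x).2 := by
  have hqt := intervalIntegrable_of_integrableOn (integrableOn_transpose hQ)
  obtain ⟨h1, h2, h3⟩ := phiStar_spec hQ A h lam
  have := (h1.adjSolvesWith hQ).transpose.unique hqt
    (ivpSol_solvesWith hqt Aᵀ (perp A + h)ᵀ lam) (by simp [h2, ivpSol_zero hqt])
    (by simp [h3, ivpSol_zero hqt]) hx
  exact ⟨by rw [adjIvpSol, ← this.1, Matrix.transpose_transpose],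
    by rw [adjIvpSol, ← this.2, Matrix.transpose_transpose]⟩

lemma jost_eq {rho : ℂ} (hrho : rho ∈ Omega) {x : ℝ} (hx : 0 ≤ x) :
    jost Q rho x = jostFun Q rho x := by
  have hspec : IsJost Q rho (jost Q rho) := by
    refine Classical.epsilon_spec (p := fun e => IsJost Q rho e) ⟨jostFun Q rho, ?_, ?_, ?_⟩
    · exact (jostFun_solvesWith hQ hrho).fst.continuousOn
    · refine ⟨‖(1 : Mat n)‖ * Real.exp ((∫ t in Ioi 0, ‖Q t‖) / ‖rho‖), fun y hy => ?_⟩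
      rw [jostFun, norm_smul, norm_cexp_I_mul, mul_comm]
      gcongr
      exact norm_jostU_le hQ hrho hy
    · exact fun y hy => jostFun_equation hQ hrho hy
  exact jostFun_unique hQ hrho hspec.continuous hspec.bound hspec.equation hx

/-- The chosen Jost solution is controlled only on [0, ∞); a derivative taken within that half-line
sees nothing else, also at 0. -/
lemma D_jost_eq {rho : ℂ} (hrho : rho ∈ Omega) {x : ℝ} (hx : 0 ≤ x) :
    D (jost Q rho) x = jostDeriv Q rho x := by
  have h := jostFun_solvesWith hQ hrho
  rw [D_congr (fun y hy => jost_eq hQ hrho hy) hx, h.fst.D_eq h.snd hx]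

omit hQ in
lemma jostFun_zero (rho : ℂ) : jostFun Q rho 0 = jostU Q rho 0 := by simp [jostFun]

omit hQ in
lemma jostDeriv_zero (rho : ℂ) : jostDeriv Q rho 0 = jostV Q rho 0 := by simp [jostDeriv]

lemma jostMatrix_eq {rho : ℂ} (hrho : rho ∈ Omega) (A h : Mat n) : jostMatrix Q A h rho =
    A * (jostV Q rho 0 - h * jostU Q rho 0) - perp A * jostU Q rho 0 := by
  rw [jostMatrix, T, D_jost_eq hQ hrho le_rfl, jost_eq hQ hrho le_rfl, jostFun_zero, jostDeriv_zero]

/-- The numerator `A e(0) + A^⊥ e'(0)` of the Weyl matrix. -/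
def weylNumerator (Q : ℝ → Mat n) (A : Mat n) (rho : ℂ) : Mat n :=
  A * jostU Q rho 0 + perp A * jostV Q rho 0

lemma weylMatrix_eq {rho : ℂ} (hrho : rho ∈ Omega) (A h : Mat n) :
    weylMatrix Q A h rho = weylNumerator Q A rho * (jostMatrix Q A h rho)⁻¹ := by
  have hs := (jostFun_solvesWith hQ hrho).mul_const (jostMatrix Q A h rho)⁻¹
  have h1 : D (weylSolution Q A h rho) 0 = jostDeriv Q rho 0 * (jostMatrix Q A h rho)⁻¹ := by
    rw [D_congr (fun y hy => show weylSolution Q A h rho y =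
      jostFun Q rho y * (jostMatrix Q A h rho)⁻¹ by rw [weylSolution, jost_eq hQ hrho hy]) le_rfl,
      hs.fst.D_eq hs.snd le_rfl]
  rw [weylMatrix, h1, weylSolution, jost_eq hQ hrho le_rfl, jostFun_zero, jostDeriv_zero,
    weylNumerator]
  noncomm_ring

end

section Algebra

lemma IsBoundaryData.mul_perp (H : IsBoundaryData A h) : A * perp A = 0 := by
  rw [perp, mul_sub, mul_one, H.idem, sub_self]

lemma IsBoundaryData.perp_mul (H : IsBoundaryData A h) : perp A * A = 0 := by
  rw [perp, sub_mul, one_mul, H.idem, sub_self]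

lemma IsBoundaryData.perp_mul_perp (H : IsBoundaryData A h) : perp A * perp A = perp A := by
  nth_rewrite 1 [perp]
  rw [sub_mul, one_mul, H.mul_perp, sub_zero]

lemma IsBoundaryData.perp_mul_h (H : IsBoundaryData A h) : perp A * h = 0 := by
  rw [perp, sub_mul, one_mul, ← H.left, sub_self]

lemma IsBoundaryData.h_mul_perp (H : IsBoundaryData A h) : h * perp A = 0 := by
  rw [perp, mul_sub, mul_one, ← H.right, sub_self]

lemma add_perp (A : Mat n) : A + perp A = 1 := by rw [perp]; abel

lemma transpose_perp (A : Mat n) : (perp A)ᵀ = perp Aᵀ := by simp [perp]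

lemma IsBoundaryData.transpose (H : IsBoundaryData A h) : IsBoundaryData Aᵀ hᵀ := by
  refine ⟨?_, ?_, ?_, ?_, ?_⟩
  · rw [Matrix.conjTranspose_transpose_eq_transpose_conjTranspose, H.adjoint]
  · rw [← Matrix.transpose_mul, H.idem]
  · rw [← Matrix.transpose_mul, ← Matrix.transpose_mul, ← mul_assoc, ← H.left_right]
  · rw [← Matrix.transpose_mul, ← H.right]
  · rw [← Matrix.transpose_mul, ← H.left]

end Algebra

end MatrixSchrodinger

namespace MatrixSchrodinger

open Filter Asymptotics

variable {n : ℕ} {Q : ℝ → Mat n} {A h : Mat n}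

/-! ### The Weyl solution, its adjoint, and the symmetry of the Weyl matrix. -/

section Decomposition

variable (hQ : IntegrableOn Q (Ioi 0)) (H : IsBoundaryData A h)
include hQ H

/-- The Jost solution in terms of the solutions with initial values `(-A^⊥, A)` and
`(A, A^⊥ + h)`. -/
lemma jostFun_eq {rho : ℂ} (hrho : rho ∈ Omega) {x : ℝ} (hx : 0 ≤ x) :
    jostFun Q rho x = (ivpSol Q (-perp A) A (rho ^ 2) x).1 * jostMatrix Q A h rho +
        (ivpSol Q A (perp A + h) (rho ^ 2) x).1 * weylNumerator Q A rho ∧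
    jostDeriv Q rho x = (ivpSol Q (-perp A) A (rho ^ 2) x).2 * jostMatrix Q A h rho +
        (ivpSol Q A (perp A + h) (rho ^ 2) x).2 * weylNumerator Q A rho := by
  have hq := intervalIntegrable_of_integrableOn hQ
  -- The forms T(Y) and A Y(0) + A^⊥ Y'(0) take the values I, 0 on S and 0, I on φ. They are the
  -- coordinates of a solution in this basis, and on the Jost solution they are the Jost matrix and
  -- the Weyl numerator.
  refine (jostFun_solvesWith hQ hrho).unique hq
    (((ivpSol_solvesWith hq (-perp A) A (rho ^ 2)).mul_const (jostMatrix Q A h rho)).add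
    ((ivpSol_solvesWith hq A (perp A + h) (rho ^ 2)).mul_const (weylNumerator Q A rho))) ?_ ?_ hx
  · simp only [ivpSol_zero hq, jostFun_zero, jostMatrix_eq hQ hrho, weylNumerator]
    have e1 : -perp A * (A * (jostV Q rho 0 - h * jostU Q rho 0) - perp A * jostU Q rho 0) =
        perp A * jostU Q rho 0 := by
      rw [neg_mul, mul_sub, ← mul_assoc, ← mul_assoc, H.perp_mul, H.perp_mul_perp]; simp
    have e2 : A * (A * jostU Q rho 0 + perp A * jostV Q rho 0) = A * jostU Q rho 0 := by
      rw [mul_add, ← mul_assoc, ← mul_assoc, H.idem, H.mul_perp]; simp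
    rw [e1, e2, ← add_mul, add_comm (perp A), add_perp, one_mul]
  · simp only [ivpSol_zero hq, jostDeriv_zero, jostMatrix_eq hQ hrho, weylNumerator]
    have e1 : A * (A * (jostV Q rho 0 - h * jostU Q rho 0) - perp A * jostU Q rho 0) =
        A * jostV Q rho 0 - h * jostU Q rho 0 := by
      rw [mul_sub, ← mul_assoc, ← mul_assoc, H.idem, H.mul_perp, mul_sub, ← mul_assoc, ← H.left]
      simp
    have e2 : (perp A + h) * (A * jostU Q rho 0 + perp A * jostV Q rho 0) =
        perp A * jostV Q rho 0 + h * jostU Q rho 0 := by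
      rw [mul_add, ← mul_assoc, ← mul_assoc, add_mul, add_mul _ _ (perp A), H.perp_mul,
        H.perp_mul_perp, ← H.right, H.h_mul_perp, zero_add, add_zero, add_comm]
    rw [e1, e2]
    have : jostV Q rho 0 = (A + perp A) * jostV Q rho 0 := by rw [add_perp, one_mul]
    nth_rewrite 1 [this]
    rw [add_mul]
    abel

/-- The transposed version of `jostFun_eq`. -/
lemma jostFun_transpose_eq {rho : ℂ} (hrho : rho ∈ Omega) {x : ℝ} (hx : 0 ≤ x) :
    (jostFun (fun t => (Q t)ᵀ) rho x)ᵀ =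
      (jostMatrix (fun t => (Q t)ᵀ) Aᵀ hᵀ rho)ᵀ * (adjIvpSol Q (-perp A) A (rho ^ 2) x).1 +
      (weylNumerator (fun t => (Q t)ᵀ) Aᵀ rho)ᵀ * (adjIvpSol Q A (perp A + h) (rho ^ 2) x).1 ∧
    (jostDeriv (fun t => (Q t)ᵀ) rho x)ᵀ =
      (jostMatrix (fun t => (Q t)ᵀ) Aᵀ hᵀ rho)ᵀ * (adjIvpSol Q (-perp A) A (rho ^ 2) x).2 +
      (weylNumerator (fun t => (Q t)ᵀ) Aᵀ rho)ᵀ * (adjIvpSol Q A (perp A + h) (rho ^ 2) x).2 := by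
  have := jostFun_eq (integrableOn_transpose hQ) H.transpose hrho hx
  constructor
  · rw [this.1]
    simp [adjIvpSol, transpose_perp, Matrix.transpose_add]
  · rw [this.2]
    simp [adjIvpSol, transpose_perp, Matrix.transpose_add]

omit H in
/-- The Wronskian of the Jost solution and the transposed Jost solution vanishes. -/
lemma jost_wronskian_eq_zero {rho : ℂ} (hrho : rho ∈ Omega) :
    (jostV (fun t => (Q t)ᵀ) rho 0)ᵀ * jostU Q rho 0 -
      (jostU (fun t => (Q t)ᵀ) rho 0)ᵀ * jostV Q rho 0 = 0 := by
  have hQt := integrableOn_transpose hQ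
  have hw := (jostFun_solvesWith hQ hrho).wronskian (jostFun_solvesWith hQt hrho).transpose
  have hconst : ∀ x : ℝ, 0 ≤ x → _ := fun x hx => hw.eq_zero (fun y _ => by simp) hx
  simp only [jostFun_zero, jostDeriv_zero] at hconst
  have hform : ∀ x : ℝ, (jostDeriv (fun t => (Q t)ᵀ) rho x)ᵀ * jostFun Q rho x -
      (jostFun (fun t => (Q t)ᵀ) rho x)ᵀ * jostDeriv Q rho x =
      (Complex.exp (Complex.I * rho * x) * Complex.exp (Complex.I * rho * x)) •
        ((jostV (fun t => (Q t)ᵀ) rho x)ᵀ * jostU Q rho x -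
          (jostU (fun t => (Q t)ᵀ) rho x)ᵀ * jostV Q rho x) := by
    intro x
    simp only [jostFun, jostDeriv, Matrix.transpose_smul, smul_mul_smul_comm, smul_sub]
  -- The normalized Wronskian tends to i rho I - i rho I = 0. The exponential factor is merely
  -- bounded when rho is real, so this cancellation is what gives the result on the boundary.
  have hlim : Tendsto (fun x => (jostV (fun t => (Q t)ᵀ) rho x)ᵀ * jostU Q rho x -
          (jostU (fun t => (Q t)ᵀ) rho x)ᵀ * jostV Q rho x) atTop (nhds 0) := by
    have h1 := ((continuous_transpose_mat.tendsto _).comp (tendsto_jostV hQt hrho)).mul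
      (tendsto_jostU hQ hrho)
    have h2 := ((continuous_transpose_mat.tendsto _).comp (tendsto_jostU hQt hrho)).mul
      (tendsto_jostV hQ hrho)
    have h3 := h1.sub h2
    simpa using h3
  have hlim2 : Tendsto (fun x : ℝ => (Complex.exp (Complex.I * rho * x) *
      Complex.exp (Complex.I * rho * x)) • ((jostV (fun t => (Q t)ᵀ) rho x)ᵀ * jostU Q rho x -
          (jostU (fun t => (Q t)ᵀ) rho x)ᵀ * jostV Q rho x)) atTop (nhds 0) := by
    rw [tendsto_zero_iff_norm_tendsto_zero] at hlim ⊢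
    refine squeeze_zero' (Eventually.of_forall fun _ => norm_nonneg _)
      ((eventually_ge_atTop 0).mono fun x hx => ?_) hlim
    rw [norm_smul, norm_mul, norm_cexp_I_mul]
    refine mul_le_of_le_one_left (norm_nonneg _) ?_
    have : Real.exp (-(rho.im * x)) ≤ 1 := Real.exp_le_one_iff.2 (by nlinarith [hrho.1])
    have h0 := Real.exp_pos (-(rho.im * x))
    nlinarith
  refine tendsto_nhds_unique (tendsto_const_nhds.congr' ?_) hlim2
  filter_upwards [eventually_ge_atTop 0] with x hx
  rw [← hform, hconst x hx]

/-- The Weyl matrices of the problem and of the transposed problem coincide. -/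
lemma weyl_adjoint_identity {rho : ℂ} (hrho : rho ∈ Omega) :
    (jostMatrix (fun t => (Q t)ᵀ) Aᵀ hᵀ rho)ᵀ * weylNumerator Q A rho =
      (weylNumerator (fun t => (Q t)ᵀ) Aᵀ rho)ᵀ * jostMatrix Q A h rho := by
  have hw := jost_wronskian_eq_zero hQ hrho
  have hJ : (jostMatrix (fun t => (Q t)ᵀ) Aᵀ hᵀ rho)ᵀ =
      ((jostV (fun t => (Q t)ᵀ) rho 0)ᵀ - (jostU (fun t => (Q t)ᵀ) rho 0)ᵀ * h) * A -
        (jostU (fun t => (Q t)ᵀ) rho 0)ᵀ * perp A := by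
    rw [jostMatrix_eq (integrableOn_transpose hQ) hrho]
    simp [← transpose_perp, Matrix.transpose_sub]
  have hm : (weylNumerator (fun t => (Q t)ᵀ) Aᵀ rho)ᵀ =
      (jostU (fun t => (Q t)ᵀ) rho 0)ᵀ * A + (jostV (fun t => (Q t)ᵀ) rho 0)ᵀ * perp A := by
    rw [weylNumerator]
    simp [← transpose_perp, Matrix.transpose_add]
  rw [hJ, hm, jostMatrix_eq hQ hrho, weylNumerator]
  set u' := (jostU (fun t => (Q t)ᵀ) rho 0)ᵀ
  set v' := (jostV (fun t => (Q t)ᵀ) rho 0)ᵀ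
  set u := jostU Q rho 0
  set v := jostV Q rho 0
  have e1 : ((v' - u' * h) * A - u' * perp A) * (A * u + perp A * v) =
      v' * (A * u) - u' * (h * u) - u' * (perp A * v) := by
    have : ((v' - u' * h) * A - u' * perp A) * (A * u + perp A * v) =
        v' * ((A * A) * u) - u' * ((h * (A * A)) * u) - u' * ((perp A * A) * u) +
        (v' * ((A * perp A) * v) - u' * (h * (A * perp A) * v) -
          u' * ((perp A * perp A) * v)) := by noncomm_ring
    rw [this, H.idem, ← H.right, H.perp_mul, H.mul_perp, H.perp_mul_perp]
    simp only [zero_mul, mul_zero, sub_zero, zero_sub, ← sub_eq_add_neg]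
  have e2 : (u' * A + v' * perp A) * (A * (v - h * u) - perp A * u) =
      u' * (A * v) - u' * (h * u) - v' * (perp A * u) := by
    have : (u' * A + v' * perp A) * (A * (v - h * u) - perp A * u) =
        u' * ((A * A) * v) - u' * ((A * A) * h * u) - u' * ((A * perp A) * u) +
        (v' * ((perp A * A) * v) - v' * ((perp A * A) * h * u) -
          v' * ((perp A * perp A) * u)) := by noncomm_ring
    rw [this, H.idem, ← H.left, H.perp_mul, H.mul_perp, H.perp_mul_perp]
    simp only [zero_mul, mul_zero, sub_zero, zero_sub, ← sub_eq_add_neg]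
  -- The term u' h u is common to both sides; inserting I = A + A^⊥ shows that their difference is
  -- the Wronskian v' u - u' v.
  have hu : v' * u = v' * (A * u) + v' * (perp A * u) := by
    rw [← mul_add, ← add_mul, add_perp, one_mul]
  have hv : u' * v = u' * (A * v) + u' * (perp A * v) := by
    rw [← mul_add, ← add_mul, add_perp, one_mul]
  rw [e1, e2, ← sub_eq_zero]
  rw [hu, hv] at hw
  rw [← hw]
  abel

/-- The Weyl solution `e J⁻¹` equals `S + φ M`. -/
lemma weyl_decomposition {rho : ℂ} (hrho : rho ∈ Omega) (hJ : (jostMatrix Q A h rho).det ≠ 0)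
    {x : ℝ} (hx : 0 ≤ x) :
    jostFun Q rho x * (jostMatrix Q A h rho)⁻¹ = (ivpSol Q (-perp A) A (rho ^ 2) x).1 +
      (ivpSol Q A (perp A + h) (rho ^ 2) x).1 * weylMatrix Q A h rho := by
  rw [(jostFun_eq hQ H hrho hx).1, weylMatrix_eq hQ hrho, add_mul, mul_assoc, mul_assoc,
    Matrix.mul_nonsing_inv _ (isUnit_iff_ne_zero.2 hJ), mul_one]

/-- The adjoint Weyl solution, multiplied by the adjoint Jost matrix. -/
lemma adj_weyl_decomposition {rho : ℂ} (hrho : rho ∈ Omega)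
    (hJ : (jostMatrix Q A h rho).det ≠ 0) {x : ℝ} (hx : 0 ≤ x) :
    (jostMatrix (fun t => (Q t)ᵀ) Aᵀ hᵀ rho)ᵀ * ((adjIvpSol Q (-perp A) A (rho ^ 2) x).1 +
      weylMatrix Q A h rho * (adjIvpSol Q A (perp A + h) (rho ^ 2) x).1) =
        (jostFun (fun t => (Q t)ᵀ) rho x)ᵀ ∧
    (jostMatrix (fun t => (Q t)ᵀ) Aᵀ hᵀ rho)ᵀ * ((adjIvpSol Q (-perp A) A (rho ^ 2) x).2 +
      weylMatrix Q A h rho * (adjIvpSol Q A (perp A + h) (rho ^ 2) x).2) =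
        (jostDeriv (fun t => (Q t)ᵀ) rho x)ᵀ := by
  have key : (jostMatrix (fun t => (Q t)ᵀ) Aᵀ hᵀ rho)ᵀ * weylMatrix Q A h rho =
      (weylNumerator (fun t => (Q t)ᵀ) Aᵀ rho)ᵀ := by
    rw [weylMatrix_eq hQ hrho, ← mul_assoc, weyl_adjoint_identity hQ H hrho, mul_assoc,
      Matrix.mul_nonsing_inv _ (isUnit_iff_ne_zero.2 hJ), mul_one]
  have := jostFun_transpose_eq hQ H hrho hx
  constructor
  · rw [this.1, mul_add, ← mul_assoc, key]
  · rw [this.2, mul_add, ← mul_assoc, key]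

end Decomposition

/-! ### Asymptotics of the Jost and Weyl matrices. -/

section Asymptotics

/-- The filter of `rho → ∞` in the closed upper half-plane. -/
def farFilter : Filter ℂ := comap norm atTop ⊓ 𝓟 Omega

lemma eventually_mem_Omega : ∀ᶠ rho in farFilter, rho ∈ Omega :=
  mem_inf_of_right (mem_principal_self _)

lemma eventually_le_norm (r : ℝ) : ∀ᶠ rho in farFilter, r ≤ ‖rho‖ :=
  mem_inf_of_left ((eventually_ge_atTop r).comap norm)

lemma isBigO_inv_one : (fun rho : ℂ => rho⁻¹) =O[farFilter] (fun _ => (1 : ℂ)) := by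
  refine IsBigO.of_bound 1 ?_
  filter_upwards [eventually_le_norm 1] with rho h
  rw [norm_inv, norm_one, mul_one]
  exact inv_le_one_of_one_le₀ h

lemma tendsto_inv_farFilter : Tendsto (fun rho : ℂ => rho⁻¹) farFilter (nhds 0) := by
  rw [tendsto_zero_iff_norm_tendsto_zero]
  simp only [norm_inv]
  exact tendsto_inv_atTop_zero.comp (tendsto_comap.mono_left inf_le_left)

/-- The matrix `A / (i rho) - A^⊥`. -/
def weightMat (A : Mat n) (rho : ℂ) : Mat n := (Complex.I * rho)⁻¹ • A - perp A

/-- The matrix `i rho A - A^⊥`, inverse to `weightMat`. -/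
def weightInv (A : Mat n) (rho : ℂ) : Mat n := (Complex.I * rho) • A - perp A

lemma weightMat_mul_weightInv (H : IsBoundaryData A h) {rho : ℂ} (hrho : rho ≠ 0) :
    weightMat A rho * weightInv A rho = 1 := by
  have hw : Complex.I * rho ≠ 0 := mul_ne_zero Complex.I_ne_zero hrho
  rw [weightMat, weightInv, sub_mul, mul_sub, mul_sub, smul_mul_smul_comm, H.idem,
    smul_mul_assoc, H.mul_perp, mul_smul_comm, H.perp_mul, H.perp_mul_perp, inv_mul_cancel₀ hw]
  simp [add_perp]

lemma weightInv_mul_weightMat (H : IsBoundaryData A h) {rho : ℂ} (hrho : rho ≠ 0) :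
    weightInv A rho * weightMat A rho = 1 := by
  have hw : Complex.I * rho ≠ 0 := mul_ne_zero Complex.I_ne_zero hrho
  rw [weightMat, weightInv, sub_mul, mul_sub, mul_sub, smul_mul_smul_comm, H.idem,
    smul_mul_assoc, H.mul_perp, mul_smul_comm, H.perp_mul, H.perp_mul_perp, mul_inv_cancel₀ hw]
  simp [add_perp]

lemma weightMat_transpose (A : Mat n) (rho : ℂ) : (weightMat A rho)ᵀ = weightMat Aᵀ rho := by
  simp [weightMat, transpose_perp]

lemma weightMat_mul_left (H : IsBoundaryData A h) (rho : ℂ) :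
    A * weightMat A rho = (Complex.I * rho)⁻¹ • A := by
  simp [weightMat, mul_sub, H.idem, H.mul_perp]

section

variable (hQ : IntegrableOn Q (Ioi 0))
include hQ

omit hQ in
lemma exp_div_norm_le {rho : ℂ} (h : 1 ≤ ‖rho‖) :
    Real.exp ((∫ t in Ioi 0, ‖Q t‖) / ‖rho‖) ≤ Real.exp (∫ t in Ioi 0, ‖Q t‖) :=
  Real.exp_le_exp.2 (div_le_self (integral_nonneg fun _ => norm_nonneg _) h)

lemma isBigO_jostU_sub_one {x : ℝ} (hx : 0 ≤ x) :
    (fun rho => jostU Q rho x - 1) =O[farFilter] fun rho => rho⁻¹ := by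
  refine IsBigO.of_bound (‖(1 : Mat n)‖ * Real.exp (∫ t in Ioi 0, ‖Q t‖) *
    ∫ t in Ioi x, ‖Q t‖) ?_
  filter_upwards [eventually_mem_Omega, eventually_le_norm 1] with rho h1 h2
  refine (norm_jostU_sub_one_le hQ h1 hx).trans ?_
  rw [norm_inv, one_div, mul_assoc, mul_comm]
  refine mul_le_mul_of_nonneg_right ?_ (by positivity)
  have h0 : 0 ≤ ∫ t in Ioi x, ‖Q t‖ := integral_nonneg fun _ => norm_nonneg _
  have := exp_div_norm_le (Q := Q) h2
  refine mul_le_mul_of_nonneg_right (mul_le_mul_of_nonneg_left this (norm_nonneg _)) h0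

lemma isBigO_jostV_sub {x : ℝ} (hx : 0 ≤ x) :
    (fun rho => jostV Q rho x - (Complex.I * rho) • (1 : Mat n)) =O[farFilter]
      fun _ => (1 : ℂ) := by
  refine IsBigO.of_bound (‖(1 : Mat n)‖ * Real.exp (∫ t in Ioi 0, ‖Q t‖) *
    ∫ t in Ioi x, ‖Q t‖) ?_
  filter_upwards [eventually_mem_Omega, eventually_le_norm 1] with rho h1 h2
  refine (norm_jostV_sub_le hQ h1 hx).trans ?_
  rw [norm_one (α := ℂ), mul_one]
  have h0 : 0 ≤ ∫ t in Ioi x, ‖Q t‖ := integral_nonneg fun _ => norm_nonneg _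
  have := exp_div_norm_le (Q := Q) h2
  refine mul_le_mul_of_nonneg_right (mul_le_mul_of_nonneg_left this (norm_nonneg _)) h0

end

lemma isBigO_const_one {E : Type*} [NormedAddCommGroup E] (c : E) :
    (fun _ : ℂ => c) =O[farFilter] fun _ => (1 : ℂ) := isBigO_const_const c one_ne_zero _

lemma isBigO_mul_one_left {f g : ℂ → Mat n} {k : ℂ → ℂ} (hf : f =O[farFilter] fun _ => (1 : ℂ))
    (hg : g =O[farFilter] k) : (fun rho => f rho * g rho) =O[farFilter] k := by
  simpa using hf.mul hg

lemma isBigO_mul_one_right {f g : ℂ → Mat n} {k : ℂ → ℂ} (hf : f =O[farFilter] k)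
    (hg : g =O[farFilter] fun _ => (1 : ℂ)) : (fun rho => f rho * g rho) =O[farFilter] k := by
  simpa using hf.mul hg

lemma isBigO_smul_inv {g : ℂ → Mat n} (hg : g =O[farFilter] fun rho : ℂ => rho⁻¹) :
    (fun rho => (Complex.I * rho) • g rho) =O[farFilter] fun _ => (1 : ℂ) := by
  have h1 : (fun rho : ℂ => Complex.I * rho) =O[farFilter] fun rho : ℂ => rho :=
    (isBigO_refl (fun rho : ℂ => rho) _).const_mul_left _
  refine (h1.smul hg).trans (IsBigO.of_bound 1 (Eventually.of_forall fun rho => ?_))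
  simp only [smul_eq_mul, norm_mul, norm_inv, norm_one, mul_one]
  exact mul_inv_le_one

lemma isBigO_inv_smul {g : ℂ → Mat n} (hg : g =O[farFilter] fun _ => (1 : ℂ)) :
    (fun rho : ℂ => (Complex.I * rho)⁻¹ • g rho) =O[farFilter] fun rho => rho⁻¹ := by
  have h1 : (fun rho : ℂ => (Complex.I * rho)⁻¹) =O[farFilter] fun rho : ℂ => rho⁻¹ := by
    simp only [mul_inv]
    exact (isBigO_refl (fun rho : ℂ => rho⁻¹) _).const_mul_left _
  simpa using h1.smul hg

/-- The remainder `B` in `J(rho)⁻¹ = (1 + B) (A / (i rho) - A^⊥)`. -/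
def jostRemainder (Q : ℝ → Mat n) (A h : Mat n) (rho : ℂ) : Mat n :=
  (jostMatrix Q A h rho)⁻¹ * weightInv A rho - 1

variable (hQ : IntegrableOn Q (Ioi 0)) (H : IsBoundaryData A h)
include hQ H

/-- J is `weightInv` times I + E with E = O(1/rho), so a Neumann series makes it invertible far out.
The remainder B satisfies B = -E - B E, which gives ‖B‖ ≤ 2‖E‖ once ‖E‖ ≤ 1/2. -/
lemma jost_asymptotics :
    (∀ᶠ rho in farFilter, (jostMatrix Q A h rho).det ≠ 0) ∧
      jostRemainder Q A h =O[farFilter] fun rho => rho⁻¹ := by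
  set E : ℂ → Mat n := fun rho =>
    (Complex.I * rho)⁻¹ • (A * ((jostV Q rho 0 - (Complex.I * rho) • (1 : Mat n)) -
      h * jostU Q rho 0)) + perp A * (jostU Q rho 0 - 1) with hE
  have hU1 := isBigO_jostU_sub_one hQ le_rfl
  have hU : (fun rho => jostU Q rho 0) =O[farFilter] fun _ => (1 : ℂ) := by
    simpa using (hU1.trans isBigO_inv_one).add (isBigO_const_one (1 : Mat n))
  have hEO : E =O[farFilter] fun rho => rho⁻¹ := by
    refine IsBigO.add (isBigO_inv_smul (isBigO_mul_one_left (isBigO_const_one A)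
      ((isBigO_jostV_sub hQ le_rfl).sub (isBigO_mul_one_left (isBigO_const_one h) hU))))
      (isBigO_mul_one_left (isBigO_const_one (perp A)) hU1)
  have hE0 : Tendsto (fun rho => ‖E rho‖) farFilter (nhds 0) :=
    tendsto_zero_iff_norm_tendsto_zero.1 (hEO.trans_tendsto tendsto_inv_farFilter)
  have hJ : ∀ rho ∈ Omega, jostMatrix Q A h rho = weightInv A rho * (1 + E rho) := by
    intro rho hrho
    have hw : Complex.I * rho ≠ 0 := mul_ne_zero Complex.I_ne_zero hrho.2
    rw [jostMatrix_eq hQ hrho]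
    set u := jostU Q rho 0
    set v := jostV Q rho 0
    have e1 : weightInv A rho * (Complex.I * rho)⁻¹ • (A * ((v - (Complex.I * rho) • (1 : Mat n)) -
      h * u)) = A * ((v - (Complex.I * rho) • (1 : Mat n)) - h * u) := by
      rw [mul_smul_comm, ← mul_assoc, weightInv, sub_mul, smul_mul_assoc, H.idem, H.perp_mul,
        sub_zero, smul_mul_assoc, smul_smul, inv_mul_cancel₀ hw, one_smul]
    have e2 : weightInv A rho * (perp A * (u - 1)) = -(perp A * (u - 1)) := by
      rw [← mul_assoc, weightInv, sub_mul, smul_mul_assoc, H.mul_perp, H.perp_mul_perp,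
        smul_zero, zero_sub, neg_mul]
    have e3 : weightInv A rho * (1 + E rho) = weightInv A rho +
        weightInv A rho * (Complex.I * rho)⁻¹ • (A * ((v - (Complex.I * rho) • (1 : Mat n)) -
          h * u)) + weightInv A rho * (perp A * (u - 1)) := by
      simp only [hE, mul_add, mul_one]
      abel
    rw [e3, e1, e2, weightInv]
    simp only [mul_sub, mul_one, mul_smul_comm]
    abel
  have hunit : ∀ᶠ rho in farFilter, rho ∈ Omega ∧ ‖E rho‖ ≤ 1 / 2 ∧
      IsUnit (jostMatrix Q A h rho) := by
    filter_upwards [eventually_mem_Omega, hE0.eventually (gt_mem_nhds (half_pos one_pos))]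
      with rho h1 h2
    refine ⟨h1, h2.le, ?_⟩
    rw [hJ rho h1]
    refine IsUnit.mul ?_ ?_
    · exact ⟨⟨_, _, weightInv_mul_weightMat H h1.2, weightMat_mul_weightInv H h1.2⟩, rfl⟩
    · have := isUnit_one_sub_of_norm_lt_one (x := -E rho) (by rw [norm_neg]; linarith)
      rwa [sub_neg_eq_add] at this
  refine ⟨hunit.mono fun rho hr => ((Matrix.isUnit_iff_isUnit_det _).1 hr.2.2).ne_zero, ?_⟩
  refine IsBigO.trans (IsBigO.of_bound 2 ?_) hEO
  filter_upwards [hunit] with rho ⟨h1, h2, h3⟩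
  have e1 : (jostRemainder Q A h rho + 1) * (1 + E rho) = 1 := by
    rw [jostRemainder, sub_add_cancel, mul_assoc, ← hJ rho h1,
      Matrix.nonsing_inv_mul _ ((Matrix.isUnit_iff_isUnit_det _).1 h3)]
  have e2 : jostRemainder Q A h rho = -E rho - jostRemainder Q A h rho * E rho := by
    have : (jostRemainder Q A h rho + 1) * (1 + E rho) = jostRemainder Q A h rho + 1 + E rho +
      jostRemainder Q A h rho * E rho := by noncomm_ring
    rw [this] at e1
    have h4 : jostRemainder Q A h rho = (jostRemainder Q A h rho + 1 + E rho +
      jostRemainder Q A h rho * E rho) - 1 - E rho - jostRemainder Q A h rho * E rho := by abel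
    rw [e1] at h4
    rw [sub_self, zero_sub] at h4
    exact h4
  have h5 : ‖jostRemainder Q A h rho‖ ≤ ‖E rho‖ + ‖jostRemainder Q A h rho‖ * (1 / 2) := by
    conv_lhs => rw [e2]
    refine (norm_sub_le _ _).trans ?_
    rw [norm_neg]
    gcongr
    exact (norm_mul_le _ _).trans (by gcongr)
  linarith

omit hQ in
lemma jostMatrix_inv_eq {rho : ℂ} (hrho : rho ∈ Omega) :
    (jostMatrix Q A h rho)⁻¹ = (1 + jostRemainder Q A h rho) * weightMat A rho := by
  rw [jostRemainder, add_sub_cancel, mul_assoc, weightInv_mul_weightMat H hrho.2, mul_one]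

/-- The remainder `B` in `M = M₀ + U B U`, where `U` is `weightMat` and `M₀` is the Weyl matrix of
the zero potential. -/
lemma exists_weylMatrix_asymptotics :
    ∃ B : ℂ → Mat n, B =O[farFilter] (fun _ => (1 : ℂ)) ∧ ∀ᶠ rho in farFilter,
      weylMatrix Q A h rho = (A + (Complex.I * rho) • perp A) * weightMat A rho +
        weightMat A rho * B rho * weightMat A rho := by
  have hB := (jost_asymptotics hQ H).2
  have hU1 := isBigO_jostU_sub_one hQ le_rfl
  -- Found by solving for the factor to the right of U, using U A = A/(i rho) and U A^⊥ = -A^⊥. The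
  -- factors i rho this creates are absorbed by remainders of order 1/rho.
  refine ⟨fun rho => (A - perp A) * ((Complex.I * rho) • jostRemainder Q A h rho) +
    (A * ((Complex.I * rho) • (jostU Q rho 0 - 1)) -
      perp A * (jostV Q rho 0 - (Complex.I * rho) • (1 : Mat n))) *
      (1 + jostRemainder Q A h rho), ?_, ?_⟩
  · refine (isBigO_mul_one_left (isBigO_const_one _) (isBigO_smul_inv hB)).add
      (isBigO_mul_one_left ?_ ((isBigO_const_one _).add (hB.trans isBigO_inv_one)))
    exact (isBigO_mul_one_left (isBigO_const_one _) (isBigO_smul_inv hU1)).sub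
      (isBigO_mul_one_left (isBigO_const_one _) (isBigO_jostV_sub hQ le_rfl))
  · filter_upwards [eventually_mem_Omega] with rho hrho
    have hw : Complex.I * rho ≠ 0 := mul_ne_zero Complex.I_ne_zero hrho.2
    rw [weylMatrix_eq hQ hrho, jostMatrix_inv_eq H hrho, weylNumerator]
    set B := jostRemainder Q A h rho
    set u := jostU Q rho 0
    set v := jostV Q rho 0
    set w := Complex.I * rho
    have hUA : weightMat A rho * A = w⁻¹ • A := by
      simp [weightMat, sub_mul, H.idem, H.perp_mul, w]
    have hUP : weightMat A rho * perp A = -perp A := by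
      simp [weightMat, sub_mul, H.mul_perp, H.perp_mul_perp]
    have e1 : weightMat A rho * ((A - perp A) * (w • B)) = (A + w • perp A) * B := by
      rw [← mul_assoc, mul_sub, hUA, hUP, mul_smul_comm, ← smul_mul_assoc, smul_sub, smul_smul,
        mul_inv_cancel₀ hw, one_smul, smul_neg, sub_neg_eq_add]
    have e2 : weightMat A rho * ((A * (w • (u - 1)) - perp A * (v - w • (1 : Mat n))) * (1 + B)) =
        (A * (u - 1) + perp A * (v - w • (1 : Mat n))) * (1 + B) := by
      rw [← mul_assoc, mul_sub, ← mul_assoc, ← mul_assoc, hUA, hUP, smul_mul_smul_comm,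
        inv_mul_cancel₀ hw, one_smul, neg_mul, sub_neg_eq_add]
    rw [mul_add (weightMat A rho), e1, e2, ← mul_assoc, ← add_mul]
    congr 1
    have e3 : A * u + perp A * v = (A + w • perp A) + (A * (u - 1) +
        perp A * (v - w • (1 : Mat n))) := by
      simp only [mul_sub, mul_one, mul_smul_comm]
      abel
    rw [e3]
    noncomm_ring

end Asymptotics

end MatrixSchrodinger

namespace MatrixSchrodinger

open Filter Asymptotics

variable {n : ℕ} {Q Qt : ℝ → Mat n} {A h ht : Mat n}

/-! ### Asymptotics of φ and φ*. -/

section PhiAsymptotics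

variable (hQ : IntegrableOn Q (Ioi 0)) (H : IsBoundaryData A h) {x : ℝ} (hx : 0 ≤ x)
include hQ H hx

omit hQ H in
lemma norm_exp_far {rho : ℂ} (hrho : rho ∈ Omega) :
    ‖Complex.exp (Complex.I * rho * x)‖ ≤ 1 := by
  rw [norm_cexp_I_mul]
  exact Real.exp_le_one_iff.2 (by nlinarith [hrho.1])

omit hQ H in
lemma isBigO_exp_smul {g : ℂ → Mat n} {k : ℂ → ℂ} (hg : g =O[farFilter] k) :
    (fun rho : ℂ => Complex.exp (Complex.I * rho * x) • g rho) =O[farFilter] k := by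
  have h1 : (fun rho : ℂ => Complex.exp (Complex.I * rho * x)) =O[farFilter]
      fun _ => (1 : ℂ) := by
    refine IsBigO.of_bound 1 ?_
    filter_upwards [eventually_mem_Omega] with rho h1
    simpa using norm_exp_far hx h1
  simpa using h1.smul hg

/-- The initial values of φ live on different scales on the ranges of A and A^⊥. Multiplied by U,
they give the combinations A - A^⊥ + h/(i rho) and h/(i rho) - I at 0, bounded in rho, and
`SolvesWith.forward_bounds` then leaves an error O(1/rho) after normalization by exp(i rho x). -/
lemma phi_weight_asymptotics_aux :
    (fun rho : ℂ => Complex.exp (Complex.I * rho * x) •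
        ((ivpSol Q A (perp A + h) (rho ^ 2) x).2 * weightMat A rho + (Complex.I * rho) •
          ((ivpSol Q A (perp A + h) (rho ^ 2) x).1 * weightMat A rho)) -
        Complex.exp (Complex.I * rho * x) • Complex.exp (Complex.I * rho * x) • (A - perp A))
      =O[farFilter] (fun rho => rho⁻¹) ∧
    (fun rho : ℂ => Complex.exp (Complex.I * rho * x) •
        ((ivpSol Q A (perp A + h) (rho ^ 2) x).2 * weightMat A rho - (Complex.I * rho) •
          ((ivpSol Q A (perp A + h) (rho ^ 2) x).1 * weightMat A rho)) + 1)
      =O[farFilter] (fun rho => rho⁻¹) := by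
  have hq := intervalIntegrable_of_integrableOn hQ
  set q := ∫ t in (0 : ℝ)..x, ‖Q t‖ with hqdef
  have hq0 : 0 ≤ q := intervalIntegral.integral_nonneg hx fun t _ => norm_nonneg _
  set m := (‖A - perp A‖ + ‖h‖) + (‖(1 : Mat n)‖ + ‖h‖) with hm
  have hsmall : (fun rho : ℂ => (Complex.I * rho)⁻¹ • h) =O[farFilter] fun rho => rho⁻¹ :=
    isBigO_inv_smul (isBigO_const_one h)
  have hbounds : ∀ᶠ rho in farFilter,
      ‖Complex.exp (Complex.I * rho * x) •
        ((ivpSol Q A (perp A + h) (rho ^ 2) x).2 * weightMat A rho + (Complex.I * rho) •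
          ((ivpSol Q A (perp A + h) (rho ^ 2) x).1 * weightMat A rho) -
          Complex.exp (Complex.I * rho * x) • (A - perp A + (Complex.I * rho)⁻¹ • h))‖ ≤
        q * (m / 2 * Real.exp q) * ‖rho⁻¹‖ ∧
      ‖Complex.exp (Complex.I * rho * x) •
        ((ivpSol Q A (perp A + h) (rho ^ 2) x).2 * weightMat A rho - (Complex.I * rho) •
          ((ivpSol Q A (perp A + h) (rho ^ 2) x).1 * weightMat A rho) -
          Complex.exp (-(Complex.I * rho) * x) • ((Complex.I * rho)⁻¹ • h - 1))‖ ≤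
        q * (m / 2 * Real.exp q) * ‖rho⁻¹‖ := by
    filter_upwards [eventually_mem_Omega, eventually_le_norm 1] with rho hrho h1
    have hw : Complex.I * rho ≠ 0 := mul_ne_zero Complex.I_ne_zero hrho.2
    have hhU : (perp A + h) * weightMat A rho = (Complex.I * rho)⁻¹ • h - perp A := by
      rw [weightMat, add_mul, mul_sub, mul_sub, mul_smul_comm, mul_smul_comm, H.perp_mul,
        H.perp_mul_perp, ← H.right, H.h_mul_perp]
      simp only [smul_zero, zero_sub, sub_zero]
      abel
    have hAU : (Complex.I * rho) • (A * weightMat A rho) = A := by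
      rw [weightMat_mul_left H, smul_smul, mul_inv_cancel₀ hw, one_smul]
    have hs := (ivpSol_solvesWith hq A (perp A + h) (rho ^ 2)).mul_const (weightMat A rho)
    have hnh : ‖(Complex.I * rho)⁻¹ • h‖ ≤ ‖h‖ := by
      rw [norm_smul, norm_inv, norm_mul, Complex.norm_I, one_mul]
      exact mul_le_of_le_one_left (norm_nonneg _) (inv_le_one_of_one_le₀ h1)
    have hP : (ivpSol Q A (perp A + h) (rho ^ 2) 0).2 * weightMat A rho +
        (Complex.I * rho) • ((ivpSol Q A (perp A + h) (rho ^ 2) 0).1 * weightMat A rho) =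
        A - perp A + (Complex.I * rho)⁻¹ • h := by
      rw [ivpSol_zero hq, hhU, hAU]; abel
    have hN : (ivpSol Q A (perp A + h) (rho ^ 2) 0).2 * weightMat A rho -
        (Complex.I * rho) • ((ivpSol Q A (perp A + h) (rho ^ 2) 0).1 * weightMat A rho) =
        (Complex.I * rho)⁻¹ • h - 1 := by
      rw [ivpSol_zero hq, hhU, hAU, ← add_perp A]; abel
    have hmle : ‖A - perp A + (Complex.I * rho)⁻¹ • h‖ + ‖(Complex.I * rho)⁻¹ • h - 1‖ ≤ m := by
      refine add_le_add ((norm_add_le _ _).trans (by gcongr)) ((norm_sub_le _ _).trans ?_)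
      rw [add_comm]
      gcongr
    have hb := hs.forward_bounds hq hrho.2 hrho.1 hx (q := q) le_rfl (m := m)
      (by rw [hP, hN]; exact hmle)
    rw [hP, hN] at hb
    have hm0 : 0 ≤ m := by positivity
    have hfin : ∀ V : Mat n, ‖V‖ ≤ q * (m / (2 * ‖rho‖) * Real.exp (q / ‖rho‖)) *
        Real.exp (rho.im * x) → ‖Complex.exp (Complex.I * rho * x) • V‖ ≤
          q * (m / 2 * Real.exp q) * ‖rho⁻¹‖ := by
      intro V hV
      rw [norm_smul, norm_cexp_I_mul]
      have hee : Real.exp (-(rho.im * x)) * Real.exp (rho.im * x) = 1 := by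
        rw [← Real.exp_add]; simp
      calc _ ≤ Real.exp (-(rho.im * x)) * (q * (m / (2 * ‖rho‖) * Real.exp (q / ‖rho‖)) *
            Real.exp (rho.im * x)) := by gcongr
        _ = q * (m / (2 * ‖rho‖) * Real.exp (q / ‖rho‖)) := by
            linear_combination (q * (m / (2 * ‖rho‖) * Real.exp (q / ‖rho‖))) * hee
        _ ≤ q * (m / (2 * ‖rho‖) * Real.exp q) := by
            have : Real.exp (q / ‖rho‖) ≤ Real.exp q := Real.exp_le_exp.2 (div_le_self hq0 h1)
            gcongr
        _ = _ := by rw [norm_inv]; field_simp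
    exact ⟨hfin _ hb.2.1, hfin _ hb.2.2⟩
  constructor
  · have h1 : (fun rho : ℂ => Complex.exp (Complex.I * rho * x) •
        ((ivpSol Q A (perp A + h) (rho ^ 2) x).2 * weightMat A rho + (Complex.I * rho) •
          ((ivpSol Q A (perp A + h) (rho ^ 2) x).1 * weightMat A rho) -
          Complex.exp (Complex.I * rho * x) • (A - perp A + (Complex.I * rho)⁻¹ • h)))
        =O[farFilter] fun rho => rho⁻¹ :=
      IsBigO.of_bound _ (hbounds.mono fun rho hr => hr.1)
    refine (h1.add (isBigO_exp_smul hx (isBigO_exp_smul hx hsmall))).congr_left fun rho => ?_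
    module
  · have h1 : (fun rho : ℂ => Complex.exp (Complex.I * rho * x) •
        ((ivpSol Q A (perp A + h) (rho ^ 2) x).2 * weightMat A rho - (Complex.I * rho) •
          ((ivpSol Q A (perp A + h) (rho ^ 2) x).1 * weightMat A rho) -
          Complex.exp (-(Complex.I * rho) * x) • ((Complex.I * rho)⁻¹ • h - 1)))
        =O[farFilter] fun rho => rho⁻¹ :=
      IsBigO.of_bound _ (hbounds.mono fun rho hr => hr.2)
    refine (h1.add hsmall).congr_left fun rho => ?_
    have hE : Complex.exp (Complex.I * rho * x) * Complex.exp (-(Complex.I * rho) * x) = 1 := by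
      rw [← Complex.exp_add]; simp
    rw [smul_sub _ _ (Complex.exp (-(Complex.I * rho) * x) • _), smul_smul, hE, one_smul]
    abel

/-- Asymptotics of `φ(x, rho²) U(rho)` and its derivative. -/
lemma phi_weight_asymptotics :
    (fun rho : ℂ => Complex.exp (Complex.I * rho * x) •
        ((ivpSol Q A (perp A + h) (rho ^ 2) x).2 * weightMat A rho) - (2 : ℂ)⁻¹ •
        (Complex.exp (Complex.I * rho * x) • Complex.exp (Complex.I * rho * x) • (A - perp A) - 1))
      =O[farFilter] (fun rho => rho⁻¹) ∧
    (fun rho : ℂ => (Complex.I * rho) • (Complex.exp (Complex.I * rho * x) •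
        ((ivpSol Q A (perp A + h) (rho ^ 2) x).1 * weightMat A rho)) - (2 : ℂ)⁻¹ •
        (Complex.exp (Complex.I * rho * x) • Complex.exp (Complex.I * rho * x) • (A - perp A) + 1))
      =O[farFilter] (fun rho => rho⁻¹) := by
  obtain ⟨h1, h2⟩ := phi_weight_asymptotics_aux hQ H hx
  constructor
  · refine ((h1.add h2).const_smul_left (2 : ℂ)⁻¹).congr_left fun rho => ?_
    simp only [Pi.smul_apply]
    module
  · refine ((h1.sub h2).const_smul_left (2 : ℂ)⁻¹).congr_left fun rho => ?_
    simp only [Pi.smul_apply]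
    module

omit hx H hQ in
lemma isBigO_transpose {f : ℂ → Mat n} {k : ℂ → ℂ} (hf : f =O[farFilter] k) :
    (fun rho => (f rho)ᵀ) =O[farFilter] k :=
  ((transposeCLM n).isBigO_comp f farFilter).trans hf

/-- Asymptotics of `U(rho) φ*(x, rho²)` and its derivative. -/
lemma phiStar_weight_asymptotics :
    (fun rho : ℂ => Complex.exp (Complex.I * rho * x) •
        (weightMat A rho * (adjIvpSol Q A (perp A + h) (rho ^ 2) x).2) - (2 : ℂ)⁻¹ •
        (Complex.exp (Complex.I * rho * x) • Complex.exp (Complex.I * rho * x) • (A - perp A) - 1))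
      =O[farFilter] (fun rho => rho⁻¹) ∧
    (fun rho : ℂ => (Complex.I * rho) • (Complex.exp (Complex.I * rho * x) •
        (weightMat A rho * (adjIvpSol Q A (perp A + h) (rho ^ 2) x).1)) - (2 : ℂ)⁻¹ •
        (Complex.exp (Complex.I * rho * x) • Complex.exp (Complex.I * rho * x) • (A - perp A) + 1))
      =O[farFilter] (fun rho => rho⁻¹) := by
  obtain ⟨h1, h2⟩ := phi_weight_asymptotics (integrableOn_transpose hQ) H.transpose hx
  constructor
  · refine (isBigO_transpose h1).congr_left fun rho => ?_
    simp [adjIvpSol, transpose_perp, Matrix.transpose_add, Matrix.transpose_sub,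
      weightMat_transpose]
  · refine (isBigO_transpose h2).congr_left fun rho => ?_
    simp [adjIvpSol, transpose_perp, Matrix.transpose_add, Matrix.transpose_sub,
      weightMat_transpose]

end PhiAsymptotics

/-! ### The Weyl solutions far out. -/

section Weyl

/-- The Weyl solution `S + φ M`. -/
def weylFun (Q : ℝ → Mat n) (A h : Mat n) (x : ℝ) (rho : ℂ) : Mat n :=
  (ivpSol Q (-perp A) A (rho ^ 2) x).1 +
    (ivpSol Q A (perp A + h) (rho ^ 2) x).1 * weylMatrix Q A h rho

/-- The adjoint Weyl solution `S* + M φ*` with its derivative. -/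
def adjWeylFun (Q : ℝ → Mat n) (A h : Mat n) (x : ℝ) (rho : ℂ) : Mat n × Mat n :=
  ((adjIvpSol Q (-perp A) A (rho ^ 2) x).1 +
    weylMatrix Q A h rho * (adjIvpSol Q A (perp A + h) (rho ^ 2) x).1,
   (adjIvpSol Q (-perp A) A (rho ^ 2) x).2 +
    weylMatrix Q A h rho * (adjIvpSol Q A (perp A + h) (rho ^ 2) x).2)

variable (hQ : IntegrableOn Q (Ioi 0)) (H : IsBoundaryData A h) {x : ℝ} (hx : 0 ≤ x)
include hQ H hx

lemma weylFun_eventually : ∀ᶠ rho in farFilter, weylFun Q A h x rho =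
    Complex.exp (Complex.I * rho * x) •
      (jostU Q rho x * (1 + jostRemainder Q A h rho) * weightMat A rho) := by
  filter_upwards [eventually_mem_Omega, (jost_asymptotics hQ H).1] with rho hrho hJ
  rw [weylFun, ← weyl_decomposition hQ H hrho hJ hx, jostMatrix_inv_eq H hrho, jostFun,
    smul_mul_assoc, mul_assoc (jostU Q rho x)]

/-- The transposed data again form a boundary problem, so its Jost matrix is invertible for large
rho. Solving `adj_weyl_decomposition` for the adjoint Weyl solution exhibits the factor exp(i rho x)
that offsets the growth of φ. -/
lemma adjWeylFun_eventually : ∀ᶠ rho in farFilter, adjWeylFun Q A h x rho =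
    (Complex.exp (Complex.I * rho * x) • (weightMat A rho *
      ((1 + (jostRemainder (fun t => (Q t)ᵀ) Aᵀ hᵀ rho)ᵀ) *
        (jostU (fun t => (Q t)ᵀ) rho x)ᵀ)),
    Complex.exp (Complex.I * rho * x) • (weightMat A rho *
      ((1 + (jostRemainder (fun t => (Q t)ᵀ) Aᵀ hᵀ rho)ᵀ) *
        (jostV (fun t => (Q t)ᵀ) rho x)ᵀ))) := by
  have hQt := integrableOn_transpose hQ
  filter_upwards [eventually_mem_Omega, (jost_asymptotics hQ H).1,
    (jost_asymptotics hQt H.transpose).1] with rho hrho hJ hJ'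
  have h1 := adj_weyl_decomposition hQ H hrho hJ hx
  set K := (jostMatrix (fun t => (Q t)ᵀ) Aᵀ hᵀ rho)ᵀ with hK
  have hKdet : IsUnit K.det := by
    rw [hK, Matrix.det_transpose]
    exact isUnit_iff_ne_zero.2 hJ'
  have hKinv : K⁻¹ = weightMat A rho * (1 + (jostRemainder (fun t => (Q t)ᵀ) Aᵀ hᵀ rho)ᵀ) := by
    rw [hK, ← Matrix.transpose_nonsing_inv, jostMatrix_inv_eq H.transpose hrho,
      Matrix.transpose_mul, weightMat_transpose, Matrix.transpose_transpose, Matrix.transpose_add,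
      Matrix.transpose_one]
  have hsolve : ∀ X Z : Mat n, K * X = Z → X = K⁻¹ * Z := by
    intro X Z hXZ
    rw [← hXZ, ← mul_assoc, Matrix.nonsing_inv_mul _ hKdet, one_mul]
  refine Prod.ext ?_ ?_
  · rw [adjWeylFun, hsolve _ _ h1.1, hKinv, jostFun, Matrix.transpose_smul, mul_smul_comm,
      mul_assoc (weightMat A rho)]
  · rw [adjWeylFun, hsolve _ _ h1.2, hKinv, jostDeriv, Matrix.transpose_smul, mul_smul_comm,
      mul_assoc (weightMat A rho)]

end Weyl

/-! ### Asymptotic comparison of the two problems. -/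

section Comparison

lemma isBigO_of_sub_inv {f g : ℂ → Mat n} (hfg : (fun rho => f rho - g rho) =O[farFilter]
    fun rho : ℂ => rho⁻¹) (hg : g =O[farFilter] fun _ => (1 : ℂ)) :
    f =O[farFilter] fun _ => (1 : ℂ) :=
  ((hfg.trans isBigO_inv_one).add hg).congr_left fun rho => by abel

lemma isBigO_exp_sq {x : ℝ} (hx : 0 ≤ x) (B C : Mat n) :
    (fun rho : ℂ => (2 : ℂ)⁻¹ • (Complex.exp (Complex.I * rho * x) •
      Complex.exp (Complex.I * rho * x) • B + C)) =O[farFilter] fun _ => (1 : ℂ) :=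
  (((isBigO_exp_smul hx (isBigO_exp_smul hx (isBigO_const_one B))).add
    (isBigO_const_one C)).const_smul_left (2 : ℂ)⁻¹).congr_left fun _ => rfl

variable (hQ : IntegrableOn Q (Ioi 0)) (hQt : IntegrableOn Qt (Ioi 0)) (H : IsBoundaryData A h)
  (Ht : IsBoundaryData A ht) {x : ℝ} (hx : 0 ≤ x)
include hQ hQt H Ht hx

/-- The comparison matrix `Φ φ̃*' - φ Φ̃*'` tends to `-1`. -/
lemma comparison_asymptotics_fst :
    (fun rho => weylFun Q A h x rho * (adjIvpSol Qt A (perp A + ht) (rho ^ 2) x).2 -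
      (ivpSol Q A (perp A + h) (rho ^ 2) x).1 * (adjWeylFun Qt A ht x rho).2 + 1)
      =O[farFilter] fun rho => rho⁻¹ := by
  have hQtt := integrableOn_transpose hQt
  set f : ℂ → Mat n := fun rho => jostU Q rho x * (1 + jostRemainder Q A h rho) with hf
  set g : ℂ → Mat n := fun rho => (1 + (jostRemainder (fun t => (Qt t)ᵀ) Aᵀ htᵀ rho)ᵀ) *
    ((Complex.I * rho)⁻¹ • (jostV (fun t => (Qt t)ᵀ) rho x)ᵀ) with hg
  set P : ℂ → Mat n := fun rho => Complex.exp (Complex.I * rho * x) •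
        (weightMat A rho * (adjIvpSol Qt A (perp A + ht) (rho ^ 2) x).2) with hP
  set N : ℂ → Mat n := fun rho => (Complex.I * rho) • (Complex.exp (Complex.I * rho * x) •
        ((ivpSol Q A (perp A + h) (rho ^ 2) x).1 * weightMat A rho)) with hN
  have hB := (jost_asymptotics hQ H).2
  have hBt := isBigO_transpose (jost_asymptotics hQtt Ht.transpose).2
  have hf1 : (fun rho => f rho - 1) =O[farFilter] fun rho => rho⁻¹ := by
    have h1 := (isBigO_jostU_sub_one hQ hx).add (isBigO_mul_one_left
      (isBigO_of_sub_inv (isBigO_jostU_sub_one hQ hx) (isBigO_const_one (1 : Mat n))) hB)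
    refine h1.congr_left fun rho => ?_
    simp only [hf]
    noncomm_ring
  have hv : (fun rho => (Complex.I * rho)⁻¹ • (jostV (fun t => (Qt t)ᵀ) rho x)ᵀ - 1)
      =O[farFilter] fun rho => rho⁻¹ := by
    refine (isBigO_inv_smul (isBigO_transpose (isBigO_jostV_sub hQtt hx))).congr' ?_
      EventuallyEq.rfl
    filter_upwards [eventually_mem_Omega] with rho hrho
    have hw : Complex.I * rho ≠ 0 := mul_ne_zero Complex.I_ne_zero hrho.2
    rw [Matrix.transpose_sub, smul_sub, Matrix.transpose_smul, smul_smul, inv_mul_cancel₀ hw,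
      one_smul, Matrix.transpose_one]
  have hg1 : (fun rho => g rho - 1) =O[farFilter] fun rho => rho⁻¹ := by
    have h1 := hv.add (isBigO_mul_one_right hBt
      (isBigO_of_sub_inv hv (isBigO_const_one (1 : Mat n))))
    refine h1.congr_left fun rho => ?_
    simp only [hg, add_mul, one_mul]
    abel
  have hP1 := (phiStar_weight_asymptotics hQt Ht hx).1
  have hN1 := (phi_weight_asymptotics hQ H hx).2
  have hPO : P =O[farFilter] fun _ => (1 : ℂ) :=
    isBigO_of_sub_inv hP1 (by
      simpa only [sub_eq_add_neg] using isBigO_exp_sq hx (A - perp A) (-1))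
  have hNO : N =O[farFilter] fun _ => (1 : ℂ) :=
    isBigO_of_sub_inv hN1 (isBigO_exp_sq hx (A - perp A) 1)
  -- With s the term carrying exp(2 i rho x): f P - N g + I = (f - I) P - N (g - I) + (P - (s -
  -- I)/2) - (N - (s + I)/2). The oscillating s, which need not be small near the real axis, drops
  -- out.
  have main := (((isBigO_mul_one_right hf1 hPO).sub (isBigO_mul_one_left hNO hg1)).add
    hP1).sub hN1
  refine main.congr' ?_ EventuallyEq.rfl
  filter_upwards [eventually_mem_Omega, weylFun_eventually hQ H hx,
    adjWeylFun_eventually hQt Ht hx] with rho hrho e1 e2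
  have hw : Complex.I * rho ≠ 0 := mul_ne_zero Complex.I_ne_zero hrho.2
  have k1 : weylFun Q A h x rho * (adjIvpSol Qt A (perp A + ht) (rho ^ 2) x).2 =
      f rho * P rho := by
    rw [e1]
    simp only [hf, hP, smul_mul_assoc, mul_smul_comm, mul_assoc]
  have k2 : (ivpSol Q A (perp A + h) (rho ^ 2) x).1 * (adjWeylFun Qt A ht x rho).2 =
      N rho * g rho := by
    rw [e2]
    simp only [hN, hg]
    rw [mul_smul_comm _ (1 + _), smul_mul_smul_comm, mul_inv_cancel₀ hw, one_smul, smul_mul_assoc,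
      mul_smul_comm, mul_assoc _ (weightMat A rho)]
  rw [k1, k2]
  simp only [hP, hN]
  generalize Complex.exp (Complex.I * rho * x) • (weightMat A rho *
    (adjIvpSol Qt A (perp A + ht) (rho ^ 2) x).2) = p
  generalize (Complex.I * rho) • Complex.exp (Complex.I * rho * x) •
    ((ivpSol Q A (perp A + h) (rho ^ 2) x).1 * weightMat A rho) = m
  generalize Complex.exp (Complex.I * rho * x) • Complex.exp (Complex.I * rho * x) •
    (A - perp A) = s
  rw [sub_mul, mul_sub, one_mul, mul_one]
  have : (2 : ℂ)⁻¹ • (s + 1) - (2 : ℂ)⁻¹ • (s - 1) = 1 := by module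
  calc _ = f rho * p - m * g rho + ((2 : ℂ)⁻¹ • (s + 1) - (2 : ℂ)⁻¹ • (s - 1)) := by abel
    _ = _ := by rw [this]

/-- The comparison matrix `Φ φ̃* - φ Φ̃*` tends to `0`. -/
lemma comparison_asymptotics_snd :
    (fun rho => weylFun Q A h x rho * (adjIvpSol Qt A (perp A + ht) (rho ^ 2) x).1 -
      (ivpSol Q A (perp A + h) (rho ^ 2) x).1 * (adjWeylFun Qt A ht x rho).1)
      =O[farFilter] fun rho => rho⁻¹ := by
  have hQtt := integrableOn_transpose hQt
  have hB := ((jost_asymptotics hQ H).2.trans isBigO_inv_one)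
  have hBt := ((isBigO_transpose (jost_asymptotics hQtt Ht.transpose).2).trans isBigO_inv_one)
  have hU := isBigO_of_sub_inv (isBigO_jostU_sub_one hQ hx) (isBigO_const_one (1 : Mat n))
  have hUt := isBigO_transpose
    (isBigO_of_sub_inv (isBigO_jostU_sub_one hQtt hx) (isBigO_const_one (1 : Mat n)))
  have hP := isBigO_inv_smul (isBigO_of_sub_inv (phiStar_weight_asymptotics hQt Ht hx).2
    (isBigO_exp_sq hx (A - perp A) 1))
  have hN := isBigO_inv_smul (isBigO_of_sub_inv (phi_weight_asymptotics hQ H hx).2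
    (isBigO_exp_sq hx (A - perp A) 1))
  have main := (isBigO_mul_one_left (isBigO_mul_one_left hU ((isBigO_const_one (1 : Mat n)).add hB))
    hP).sub (isBigO_mul_one_right hN
      (isBigO_mul_one_left ((isBigO_const_one (1 : Mat n)).add hBt) hUt))
  refine main.congr' ?_ EventuallyEq.rfl
  filter_upwards [eventually_mem_Omega, weylFun_eventually hQ H hx,
    adjWeylFun_eventually hQt Ht hx] with rho hrho e1 e2
  have hw : Complex.I * rho ≠ 0 := mul_ne_zero Complex.I_ne_zero hrho.2
  rw [e1, e2]
  simp only [smul_smul (Complex.I * rho)⁻¹ (Complex.I * rho), inv_mul_cancel₀ hw, one_smul,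
    smul_mul_assoc, mul_smul_comm, mul_assoc]

/-- Decay of `φ (M - M̃) φ̃*` and of `φ (M - M̃) φ̃*'`. -/
lemma weyl_difference_asymptotics :
    (fun rho : ℂ => Complex.exp (Complex.I * rho * x) • Complex.exp (Complex.I * rho * x) •
      ((ivpSol Q A (perp A + h) (rho ^ 2) x).1 *
        (weylMatrix Q A h rho - weylMatrix Qt A ht rho) *
        (adjIvpSol Qt A (perp A + ht) (rho ^ 2) x).1)) =O[farFilter] (fun rho => rho⁻¹) ∧
    (fun rho : ℂ => Complex.exp (Complex.I * rho * x) • Complex.exp (Complex.I * rho * x) •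
      ((ivpSol Q A (perp A + h) (rho ^ 2) x).1 *
        (weylMatrix Q A h rho - weylMatrix Qt A ht rho) *
        (adjIvpSol Qt A (perp A + ht) (rho ^ 2) x).2)) =O[farFilter] (fun rho => rho⁻¹) := by
  obtain ⟨B, hB, hBeq⟩ := exists_weylMatrix_asymptotics hQ H
  obtain ⟨Bt, hBt, hBteq⟩ := exists_weylMatrix_asymptotics hQt Ht
  have hN := isBigO_inv_smul (isBigO_of_sub_inv (phi_weight_asymptotics hQ H hx).2
    (isBigO_exp_sq hx (A - perp A) 1))
  have hP1 := (isBigO_inv_smul (isBigO_of_sub_inv (phiStar_weight_asymptotics hQt Ht hx).2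
    (isBigO_exp_sq hx (A - perp A) 1))).trans isBigO_inv_one
  have hP2 := isBigO_of_sub_inv (phiStar_weight_asymptotics hQt Ht hx).1 (by
      simpa only [sub_eq_add_neg] using isBigO_exp_sq hx (A - perp A) (-1))
  have hNB := isBigO_mul_one_right hN (hB.sub hBt)
  constructor
  · refine (isBigO_mul_one_right hNB hP1).congr' ?_ EventuallyEq.rfl
    filter_upwards [eventually_mem_Omega, hBeq, hBteq] with rho hrho e1 e2
    have hw : Complex.I * rho ≠ 0 := mul_ne_zero Complex.I_ne_zero hrho.2
    -- The leading term of the Weyl matrix depends on A alone and cancels in the difference, leaving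
    -- U (B - B̃) U; each U is absorbed by its neighbouring solution.
    rw [e1, e2, add_sub_add_left_eq_sub, ← sub_mul, ← mul_sub]
    simp only [smul_smul (Complex.I * rho)⁻¹ (Complex.I * rho), inv_mul_cancel₀ hw, one_smul,
      smul_mul_assoc, mul_smul_comm, mul_assoc]
  · refine (isBigO_mul_one_right hNB hP2).congr' ?_ EventuallyEq.rfl
    filter_upwards [eventually_mem_Omega, hBeq, hBteq] with rho hrho e1 e2
    have hw : Complex.I * rho ≠ 0 := mul_ne_zero Complex.I_ne_zero hrho.2
    rw [e1, e2, add_sub_add_left_eq_sub, ← sub_mul, ← mul_sub]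
    simp only [smul_smul (Complex.I * rho)⁻¹ (Complex.I * rho), inv_mul_cancel₀ hw, one_smul,
      smul_mul_assoc, mul_smul_comm, mul_assoc]

end Comparison

end MatrixSchrodinger

namespace MatrixSchrodinger

/-! ### Contours in the plane and the global Cauchy theorem. -/

open Filter

/-- An absolutely continuous path in the plane, with a multiplicity. -/
structure ContourPiece where
  path : ℝ → ℂ
  velocity : ℝ → ℂ
  left : ℝ
  right : ℝ
  mult : ℂ
  left_le : left ≤ right
  continuousOn : ContinuousOn path (Icc left right)
  hasDerivAt : ∃ P : Set ℝ, P.Countable ∧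
    ∀ s ∈ Ioo left right \ P, HasDerivAt path (velocity s) s
  integrable : IntervalIntegrable velocity volume left right

variable {E : Type*} [NormedAddCommGroup E] [NormedSpace ℂ E]

namespace ContourPiece

variable (γ : ContourPiece)

/-- The set of points of the path. -/
def image : Set ℂ := γ.path '' Icc γ.left γ.right

/-- The integral along the path, counted with multiplicity. -/
def integral (f : ℂ → E) : E :=
  γ.mult • ∫ s in γ.left..γ.right, γ.velocity s • f (γ.path s)

lemma isCompact_image : IsCompact γ.image := isCompact_Icc.image_of_continuousOn γ.continuousOn

lemma path_mem_image {s : ℝ} (hs : s ∈ Icc γ.left γ.right) : γ.path s ∈ γ.image :=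
  mem_image_of_mem _ hs

omit [NormedSpace ℂ E] in
lemma continuousOn_comp {f : ℂ → E} (hf : ContinuousOn f γ.image) :
    ContinuousOn (fun s => f (γ.path s)) (Icc γ.left γ.right) :=
  hf.comp γ.continuousOn fun _ hs => γ.path_mem_image hs

lemma intervalIntegrable {f : ℂ → E} (hf : ContinuousOn f γ.image) :
    IntervalIntegrable (fun s => γ.velocity s • f (γ.path s)) volume γ.left γ.right :=
  γ.integrable.smul_continuousOn (by rw [uIcc_of_le γ.left_le]; exact γ.continuousOn_comp hf)

lemma integral_sub {f g : ℂ → E} (hf : ContinuousOn f γ.image) (hg : ContinuousOn g γ.image) :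
    γ.integral (fun w => f w - g w) = γ.integral f - γ.integral g := by
  rw [integral, integral, integral, ← smul_sub, ← intervalIntegral.integral_sub
    (γ.intervalIntegrable hf) (γ.intervalIntegrable hg)]
  simp only [smul_sub]

lemma integral_congr {f g : ℂ → E} (h : EqOn f g γ.image) : γ.integral f = γ.integral g := by
  rw [integral, integral]
  congr 1
  refine intervalIntegral.integral_congr fun s hs => ?_
  rw [uIcc_of_le γ.left_le] at hs
  simp only [h (γ.path_mem_image hs)]

lemma integral_smul_const [CompleteSpace E] (f : ℂ → ℂ) (v : E) :
    γ.integral (fun w => f w • v) = γ.integral f • v := by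
  rw [integral, integral, smul_assoc, ← intervalIntegral.integral_smul_const]
  simp only [smul_assoc]

lemma integral_eq_sub {f F : ℂ → ℂ} (hF : ∀ w ∈ γ.image, HasDerivAt F (f w) w)
    (hf : ContinuousOn f γ.image) :
    γ.integral f = γ.mult * (F (γ.path γ.right) - F (γ.path γ.left)) := by
  obtain ⟨P, hP, hd⟩ := γ.hasDerivAt
  rw [integral, smul_eq_mul]
  congr 1
  refine MeasureTheory.integral_eq_of_hasDerivAt_off_countable_of_le
    (fun s => F (γ.path s)) _ γ.left_le hP ?_ ?_ (γ.intervalIntegrable hf)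
  · exact γ.continuousOn_comp fun w hw => (hF w hw).continuousAt.continuousWithinAt
  · intro s hs
    have h1 := (hF _ (γ.path_mem_image (Ioo_subset_Icc_self hs.1))).comp s (hd s hs)
    rw [smul_eq_mul, mul_comm]
    exact h1

lemma integral_differentiableOn {U : Set ℂ} (hU : IsOpen U) {F : ℂ → ℂ → E} [CompleteSpace E]
    (hc : ∀ z ∈ U, ContinuousOn (F z) γ.image)
    (hd : ∀ w ∈ γ.image, DifferentiableOn ℂ (fun z => F z w) U)
    (hb : ∀ z₀ ∈ U, ∃ r > 0, ∃ C, ∀ w ∈ γ.image, ∀ z ∈ Metric.ball z₀ r ∩ U, ‖F z w‖ ≤ C) :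
    DifferentiableOn ℂ (fun z => γ.integral (F z)) U := by
  refine DifferentiableOn.const_smul ?_ _
  simp only [intervalIntegral.integral_of_le γ.left_le]
  have hmem : ∀ᵐ s ∂volume.restrict (Ioc γ.left γ.right), s ∈ Icc γ.left γ.right :=
    (ae_restrict_iff' measurableSet_Ioc).2 (ae_of_all _ fun s hs => Ioc_subset_Icc_self hs)
  refine differentiableOn_integral hU (fun z hz => ?_) ?_ fun z₀ hz₀ => ?_
  · exact (γ.intervalIntegrable (hc z hz)).1.aestronglyMeasurable
  · filter_upwards [hmem] with s hs
    exact (hd _ (γ.path_mem_image hs)).const_smul (γ.velocity s)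
  · obtain ⟨r, hr, C, hC⟩ := hb z₀ hz₀
    refine ⟨r, hr, fun s => ‖γ.velocity s‖ * C, γ.integrable.1.norm.mul_const C, ?_⟩
    filter_upwards [hmem] with s hs z hz
    rw [norm_smul]
    exact mul_le_mul_of_nonneg_left (hC _ (γ.path_mem_image hs) z hz) (norm_nonneg _)

lemma norm_integral_le {f : ℂ → E} {C : ℝ} (hC : ∀ w ∈ γ.image, ‖f w‖ ≤ C) :
    ‖γ.integral f‖ ≤ ‖γ.mult‖ * (∫ s in γ.left..γ.right, ‖γ.velocity s‖) * C := by
  rw [integral, norm_smul, mul_assoc]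
  refine mul_le_mul_of_nonneg_left ?_ (norm_nonneg _)
  rw [← intervalIntegral.integral_mul_const]
  refine intervalIntegral.norm_integral_le_of_norm_le γ.left_le (ae_of_all _ fun s hs => ?_)
    (γ.integrable.norm.mul_const C)
  rw [norm_smul]
  exact mul_le_mul_of_nonneg_left (hC _ (γ.path_mem_image (Ioc_subset_Icc_self hs)))
    (norm_nonneg _)

end ContourPiece

section Contour

variable {ι : Type*} [Fintype ι] (Γ : ι → ContourPiece)

/-- The union of the paths of a contour. -/
def contourImage : Set ℂ := ⋃ i, (Γ i).image

/-- The integral over a contour. -/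
def contourIntegral (f : ℂ → E) : E := ∑ i, (Γ i).integral f

/-- The boundary of the contour vanishes. -/
def IsCycle : Prop := ∀ F : ℂ → ℂ,
  ∑ i, (Γ i).mult * (F ((Γ i).path (Γ i).right) - F ((Γ i).path (Γ i).left)) = 0

omit [Fintype ι] in
lemma image_subset_contourImage (i : ι) : (Γ i).image ⊆ contourImage Γ :=
  subset_iUnion (fun i => (Γ i).image) i

lemma isCompact_contourImage : IsCompact (contourImage Γ) :=
  isCompact_iUnion fun i => (Γ i).isCompact_image

variable {Γ}

lemma contourIntegral_sub {f g : ℂ → E} (hf : ContinuousOn f (contourImage Γ))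
    (hg : ContinuousOn g (contourImage Γ)) :
    contourIntegral Γ (fun w => f w - g w) = contourIntegral Γ f - contourIntegral Γ g := by
  simp only [contourIntegral, ← Finset.sum_sub_distrib]
  exact Finset.sum_congr rfl fun i _ => (Γ i).integral_sub
    (hf.mono (image_subset_contourImage Γ i)) (hg.mono (image_subset_contourImage Γ i))

lemma contourIntegral_congr {f g : ℂ → E} (h : EqOn f g (contourImage Γ)) :
    contourIntegral Γ f = contourIntegral Γ g :=
  Finset.sum_congr rfl fun i _ => (Γ i).integral_congr (h.mono (image_subset_contourImage Γ i))

lemma contourIntegral_smul_const [CompleteSpace E] (f : ℂ → ℂ) (v : E) :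
    contourIntegral Γ (fun w => f w • v) = contourIntegral Γ f • v := by
  simp only [contourIntegral, ContourPiece.integral_smul_const, Finset.sum_smul]

/-- Each piece contributes the difference of F at its endpoints. Index computations reduce to this
by exhibiting a branch of the logarithm along the contour. -/
lemma IsCycle.contourIntegral_eq_zero (hΓ : IsCycle Γ) {f F : ℂ → ℂ}
    (hF : ∀ w ∈ contourImage Γ, HasDerivAt F (f w) w) (hf : ContinuousOn f (contourImage Γ)) :
    contourIntegral Γ f = 0 := by
  rw [← hΓ F]
  exact Finset.sum_congr rfl fun i _ => (Γ i).integral_eq_sub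
    (fun w hw => hF w (image_subset_contourImage Γ i hw))
    (hf.mono (image_subset_contourImage Γ i))

lemma continuousOn_inv_sub {S : Set ℂ} {z : ℂ} (hz : z ∉ S) :
    ContinuousOn (fun w => (w - z)⁻¹) S :=
  (continuousOn_id.sub continuousOn_const).inv₀ fun w hw h => hz (by
    rwa [← sub_eq_zero.1 (show w - z = 0 from h)])

/-- The index of a cycle is locally constant. -/
lemma IsCycle.index_eq (hΓ : IsCycle Γ) {z z₀ : ℂ}
    (h : ∀ w ∈ contourImage Γ, ‖z - z₀‖ < ‖w - z₀‖) :
    contourIntegral Γ (fun w => (w - z)⁻¹) = contourIntegral Γ fun w => (w - z₀)⁻¹ := by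
  have hz₀ : z₀ ∉ contourImage Γ := fun hz => by
    have := h _ hz; rw [sub_self, norm_zero] at this; exact absurd this (norm_nonneg _).not_gt
  have hz : z ∉ contourImage Γ := fun hz => (h _ hz).ne rfl
  rw [← sub_eq_zero, ← contourIntegral_sub (continuousOn_inv_sub hz) (continuousOn_inv_sub hz₀)]
  -- On the contour the quotient stays in the disc of radius 1 about 1, hence off the branch cut.
  refine hΓ.contourIntegral_eq_zero (F := fun w => Complex.log ((w - z) / (w - z₀))) ?_
    ((continuousOn_inv_sub hz).sub (continuousOn_inv_sub hz₀))
  intro w hw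
  have h0 : w - z₀ ≠ 0 := fun h => hz₀ (by rwa [← sub_eq_zero.1 h])
  have h1 : w - z ≠ 0 := fun h => hz (by rwa [← sub_eq_zero.1 h])
  have hs : (w - z) / (w - z₀) ∈ Complex.slitPlane := by
    have : (w - z) / (w - z₀) = 1 + -((z - z₀) / (w - z₀)) := by field_simp; ring
    rw [this]
    refine Complex.mem_slitPlane_of_norm_lt_one ?_
    rw [norm_neg, norm_div, div_lt_one (norm_pos_iff.2 h0)]
    exact h w hw
  have hd : HasDerivAt (fun w => (w - z) / (w - z₀))
      ((1 * (w - z₀) - (w - z) * 1) / (w - z₀) ^ 2) w :=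
    ((hasDerivAt_id w).sub_const z).div ((hasDerivAt_id w).sub_const z₀) h0
  refine (hd.clog hs).congr_deriv ?_
  field_simp

/-- The index of a cycle vanishes far away. -/
lemma IsCycle.index_eq_zero_of_large (hΓ : IsCycle Γ) {z : ℂ}
    (h : ∀ w ∈ contourImage Γ, ‖w‖ < ‖z‖) : contourIntegral Γ (fun w => (w - z)⁻¹) = 0 := by
  have hz : z ∉ contourImage Γ := fun hz => (h _ hz).ne rfl
  -- Since |w| < |z| on the contour, 1 - w/z stays in the unit disc about 1, and the principal
  -- logarithm is holomorphic there.
  refine hΓ.contourIntegral_eq_zero (F := fun w => Complex.log (1 + -(w / z))) ?_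
    (continuousOn_inv_sub hz)
  intro w hw
  have hz0 : z ≠ 0 := norm_pos_iff.1 ((norm_nonneg w).trans_lt (h w hw))
  have h1 : w - z ≠ 0 := fun h => hz (by rwa [← sub_eq_zero.1 h])
  have hs : 1 + -(w / z) ∈ Complex.slitPlane := by
    refine Complex.mem_slitPlane_of_norm_lt_one ?_
    rw [norm_neg, norm_div, div_lt_one (norm_pos_iff.2 hz0)]
    exact h w hw
  have hd : HasDerivAt (fun w => 1 + -(w / z)) (-(1 / z)) w :=
    (((hasDerivAt_id w).div_const z).neg).const_add 1
  refine (hd.clog hs).congr_deriv ?_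
  have h2 : 1 + -(w / z) = -((w - z) / z) := by field_simp; ring
  rw [h2]
  field_simp

lemma dslope_symm (f : ℂ → E) (a b : ℂ) : dslope f a b = dslope f b a := by
  rcases eq_or_ne a b with rfl | hab
  · rfl
  · rw [dslope_of_ne _ hab.symm, dslope_of_ne _ hab, slope_comm]

/-- For w within 2r of z₀ the mean value inequality bounds the quotient by a bound for g'. Otherwise
w is at distance at least r from every z within r of z₀, and bounds for g suffice. -/
lemma exists_bound_dslope [CompleteSpace E] {g : ℂ → E} {U K : Set ℂ} (hU : IsOpen U)
    (hg : DifferentiableOn ℂ g U) (hK : IsCompact K) (hKU : K ⊆ U) {z₀ : ℂ} (hz₀ : z₀ ∈ U) :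
    ∃ r > 0, ∃ C, ∀ w ∈ K, ∀ z ∈ Metric.ball z₀ r ∩ U, ‖dslope g z w‖ ≤ C := by
  obtain ⟨R, hR, hRU⟩ := Metric.isOpen_iff.1 hU z₀ hz₀
  set r := R / 4 with hr
  have hr0 : 0 < r := by positivity
  have hsub : Metric.closedBall z₀ (2 * r) ⊆ U :=
    (Metric.closedBall_subset_ball (by rw [hr]; linarith)).trans hRU
  have hcb := isCompact_closedBall z₀ (2 * r)
  obtain ⟨C₁, hC₁⟩ := hK.exists_bound_of_continuousOn (hg.continuousOn.mono hKU)
  obtain ⟨C₂, hC₂⟩ := hcb.exists_bound_of_continuousOn (hg.continuousOn.mono hsub)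
  obtain ⟨C₃, hC₃⟩ := hcb.exists_bound_of_continuousOn ((hg.deriv hU).continuousOn.mono hsub)
  refine ⟨r, hr0, max ((C₁ + C₂) / r) C₃, fun w hw z hz => ?_⟩
  have hzb : z ∈ Metric.closedBall z₀ (2 * r) :=
    Metric.ball_subset_closedBall (Metric.ball_subset_ball (by linarith) hz.1)
  rcases eq_or_ne w z with rfl | hne
  · rw [dslope_same]
    exact (hC₃ w hzb).trans (le_max_right _ _)
  rw [dslope_of_ne _ hne, slope_def_module, norm_smul, norm_inv]
  have hpos : 0 < ‖w - z‖ := norm_pos_iff.2 (sub_ne_zero.2 hne)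
  rw [inv_mul_le_iff₀ hpos]
  by_cases hwb : w ∈ Metric.closedBall z₀ (2 * r)
  · have := Convex.norm_image_sub_le_of_norm_deriv_le
      (fun y hy => (hg y (hsub hy)).differentiableAt (hU.mem_nhds (hsub hy))) hC₃
      (convex_closedBall z₀ (2 * r)) hzb hwb
    calc _ ≤ C₃ * ‖w - z‖ := this
      _ ≤ ‖w - z‖ * max ((C₁ + C₂) / r) C₃ := by
          rw [mul_comm]; gcongr; exact le_max_right _ _
  · have hdist : r ≤ ‖w - z‖ := by
      have h1 : 2 * r < dist w z₀ := by simpa using hwb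
      have h2 := Metric.mem_ball.1 hz.1
      have h3 := dist_triangle w z z₀
      rw [← dist_eq_norm]
      linarith
    have hC : 0 ≤ C₁ + C₂ := add_nonneg ((norm_nonneg _).trans (hC₁ w hw))
      ((norm_nonneg _).trans (hC₂ z hzb))
    calc ‖g w - g z‖ ≤ C₁ + C₂ := (norm_sub_le _ _).trans (add_le_add (hC₁ w hw) (hC₂ z hzb))
      _ = r * ((C₁ + C₂) / r) := by field_simp
      _ ≤ ‖w - z‖ * max ((C₁ + C₂) / r) C₃ := by gcongr; exact le_max_left _ _

/-- The integral of the difference quotient vanishes: the global Cauchy theorem in Dixon's form. -/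
lemma IsCycle.contourIntegral_dslope_eq_zero [CompleteSpace E] (hΓ : IsCycle Γ) {U : Set ℂ}
    (hU : IsOpen U) (hΓU : contourImage Γ ⊆ U) {g : ℂ → E} (hg : DifferentiableOn ℂ g U)
    (hind : ∀ z ∉ U, contourIntegral Γ (fun w => (w - z)⁻¹) = 0) {z : ℂ} (hz : z ∈ U) :
    contourIntegral Γ (dslope g z) = 0 := by
  classical
  set V : Set ℂ := {z | z ∉ contourImage Γ ∧ contourIntegral Γ (fun w => (w - z)⁻¹) = 0} with hV
  set k : ℂ → E := fun z => contourIntegral Γ fun w => (w - z)⁻¹ • g w with hk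
  -- The two formulas agree where both apply, since the index vanishes on V. The glued function is
  -- entire and tends to 0 at infinity, so Liouville's theorem makes it zero.
  set H : ℂ → E := fun z => if z ∈ U then contourIntegral Γ (dslope g z) else k z with hH
  have hgc := hg.continuousOn.mono hΓU
  have hnear : ∀ z₀ ∉ contourImage Γ, ∃ r > 0, ∀ z ∈ Metric.ball z₀ r, ∀ w ∈ contourImage Γ,
      r ≤ ‖w - z‖ ∧ ‖z - z₀‖ < ‖w - z₀‖ := by
    intro z₀ hz₀
    obtain ⟨R, hR, hRU⟩ := Metric.isOpen_iff.1
      (isCompact_contourImage Γ).isClosed.isOpen_compl z₀ hz₀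
    refine ⟨R / 2, by positivity, fun z hz w hw => ?_⟩
    have h1 : R ≤ dist w z₀ := by
      by_contra hcon
      exact hRU (Metric.mem_ball.2 (not_le.1 hcon)) hw
    have h2 := Metric.mem_ball.1 hz
    have h3 := dist_triangle w z z₀
    rw [← dist_eq_norm, ← dist_eq_norm, ← dist_eq_norm]
    constructor <;> linarith
  have hVU : ∀ z ∈ V, H z = k z := by
    intro z hzV
    by_cases hzU : z ∈ U
    · have h1 : contourIntegral Γ (dslope g z) =
          contourIntegral Γ fun w => (w - z)⁻¹ • g w - (w - z)⁻¹ • g z := by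
        refine contourIntegral_congr fun w hw => ?_
        have hne : w ≠ z := fun h => hzV.1 (h ▸ hw)
        rw [dslope_of_ne _ hne, slope_def_module, smul_sub]
      have hci := continuousOn_inv_sub hzV.1
      rw [contourIntegral_sub (hci.fun_smul hgc) (hci.fun_smul continuousOn_const),
        contourIntegral_smul_const, hzV.2, zero_smul, sub_zero] at h1
      simp only [hH, hzU, if_true, h1, hk]
    · simp only [hH, hzU, if_false]
  have hVopen : IsOpen V := by
    refine Metric.isOpen_iff.2 fun z₀ hz₀ => ?_
    obtain ⟨r, hr, hr'⟩ := hnear z₀ hz₀.1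
    refine ⟨r, hr, fun z hz => ⟨fun hzi => ?_, ?_⟩⟩
    · have := (hr' z hz z hzi).1
      rw [sub_self, norm_zero] at this
      exact absurd this hr.not_ge
    · rw [hΓ.index_eq fun w hw => (hr' z hz w hw).2, hz₀.2]
  have hkd : DifferentiableOn ℂ k V := by
    refine DifferentiableOn.fun_sum fun i _ => (Γ i).integral_differentiableOn hVopen
      (fun z hz => ?_) (fun w hw => ?_) fun z₀ hz₀ => ?_
    · exact ((continuousOn_inv_sub hz.1).smul hgc).mono (image_subset_contourImage Γ i)
    · refine DifferentiableOn.smul_const (DifferentiableOn.inv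
        ((differentiableOn_const w).sub differentiableOn_id) fun z hz h => ?_) _
      exact hz.1 (by rw [← sub_eq_zero.1 (show w - z = 0 from h)]; exact image_subset_contourImage Γ i hw)
    · obtain ⟨r, hr, hr'⟩ := hnear z₀ hz₀.1
      obtain ⟨C, hC⟩ := (isCompact_contourImage Γ).exists_bound_of_continuousOn hgc
      refine ⟨r, hr, r⁻¹ * C, fun w hw z hz => ?_⟩
      have hw' := image_subset_contourImage Γ i hw
      rw [norm_smul, norm_inv]
      exact mul_le_mul (inv_anti₀ hr (hr' z hz.1 w hw').1) (hC w hw') (norm_nonneg _)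
        (inv_nonneg.2 hr.le)
  have hdd : DifferentiableOn ℂ (fun z => contourIntegral Γ (dslope g z)) U := by
    refine DifferentiableOn.fun_sum fun i _ => (Γ i).integral_differentiableOn hU
      (fun z hz => ?_) (fun w hw => ?_) fun z₀ hz₀ => ?_
    · exact ((continuousOn_dslope (hU.mem_nhds hz)).2 ⟨hg.continuousOn,
        (hg z hz).differentiableAt (hU.mem_nhds hz)⟩).mono
        ((image_subset_contourImage Γ i).trans hΓU)
    · simp only [dslope_symm g _ w]
      exact (Complex.differentiableOn_dslope
        (hU.mem_nhds (hΓU (image_subset_contourImage Γ i hw)))).2 hg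
    · obtain ⟨r, hr, C, hC⟩ := exists_bound_dslope hU hg (isCompact_contourImage Γ) hΓU hz₀
      exact ⟨r, hr, C, fun w hw => hC w (image_subset_contourImage Γ i hw)⟩
  have hUV : ∀ z, z ∈ U ∨ z ∈ V := fun z => by
    by_cases hzU : z ∈ U
    · exact Or.inl hzU
    · exact Or.inr ⟨fun h => hzU (hΓU h), hind z hzU⟩
  have hHd : Differentiable ℂ H := by
    intro z
    rcases hUV z with hz | hz
    · refine ((hdd z hz).differentiableAt (hU.mem_nhds hz)).congr_of_eventuallyEq ?_
      filter_upwards [hU.mem_nhds hz] with y hy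
      simp only [hH, hy, if_true]
    · refine ((hkd z hz).differentiableAt (hVopen.mem_nhds hz)).congr_of_eventuallyEq ?_
      filter_upwards [hVopen.mem_nhds hz] with y hy using hVU y hy
  have hlim : Tendsto H (cocompact ℂ) (nhds 0) := by
    obtain ⟨R, hR⟩ := (isCompact_contourImage Γ).isBounded.exists_norm_le
    obtain ⟨C, hC⟩ := (isCompact_contourImage Γ).exists_bound_of_continuousOn hgc
    have hfar : ∀ᶠ z in cocompact ℂ, max R 0 + 1 < ‖z‖ :=
      (tendsto_norm_cocompact_atTop (E := ℂ)).eventually_gt_atTop _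
    set L := ∑ i, ‖(Γ i).mult‖ * (∫ s in (Γ i).left..(Γ i).right, ‖(Γ i).velocity s‖) with hL
    have hinv : Tendsto (fun z : ℂ => (‖z‖ - R)⁻¹) (cocompact ℂ) (nhds 0) :=
      tendsto_inv_atTop_zero.comp
        (tendsto_atTop_add_const_right _ (-R) tendsto_norm_cocompact_atTop)
    refine squeeze_zero_norm' (a := fun z => L * ((‖z‖ - R)⁻¹ * C)) ?_ ?_
    · filter_upwards [hfar] with z hz
      have hlarge : ∀ w ∈ contourImage Γ, ‖w‖ < ‖z‖ := fun w hw =>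
        (hR w hw).trans_lt (by linarith [le_max_left R 0])
      have hzV : z ∈ V := ⟨fun h => (hlarge z h).ne rfl, hΓ.index_eq_zero_of_large hlarge⟩
      rw [hVU z hzV, hk, hL, Finset.sum_mul]
      refine (norm_sum_le _ _).trans (Finset.sum_le_sum fun i _ => ?_)
      refine (Γ i).norm_integral_le fun w hw => ?_
      have hw' := image_subset_contourImage Γ i hw
      have hzR : 0 < ‖z‖ - R := by linarith [le_max_left R 0]
      rw [norm_smul, norm_inv]
      refine mul_le_mul (inv_anti₀ hzR ?_) (hC w hw') (norm_nonneg _) (inv_nonneg.2 hzR.le)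
      have h1 := norm_sub_norm_le z w
      rw [norm_sub_rev] at h1
      linarith [hR w hw']
    · simpa using (hinv.mul_const C).const_mul L
  have := hHd.apply_eq_of_tendsto_cocompact z hlim
  simpa only [hH, hz, if_true] using this

/-- The global Cauchy theorem. -/
theorem IsCycle.cauchy [CompleteSpace E] (hΓ : IsCycle Γ) {U : Set ℂ}
    (hU : IsOpen U) (hΓU : contourImage Γ ⊆ U) {g : ℂ → E} (hg : DifferentiableOn ℂ g U)
    (hind : ∀ z ∉ U, contourIntegral Γ (fun w => (w - z)⁻¹) = 0) :
    contourIntegral Γ g = 0 := by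
  rcases (contourImage Γ).eq_empty_or_nonempty with h0 | ⟨z₀, hz₀⟩
  · rw [contourIntegral_congr (g := fun _ => (0 : E)) (by rw [h0]; exact eqOn_empty _ _)]
    simp [contourIntegral, ContourPiece.integral]
  · have hz₀U := hΓU hz₀
    have hda := (hg z₀ hz₀U).differentiableAt (hU.mem_nhds hz₀U)
    -- The difference quotient of (w - z₀) g(w) at z₀ is g itself. As `dslope` has no pole, z₀ may
    -- be taken on the contour.
    have hd : DifferentiableOn ℂ (fun w => (w - z₀) • g w) U :=
      (differentiableOn_id.sub_const z₀).smul hg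
    rw [← hΓ.contourIntegral_dslope_eq_zero hU hΓU hd hind hz₀U]
    refine contourIntegral_congr fun w _ => ?_
    rcases eq_or_ne w z₀ with rfl | hne
    · have h1 := (((hasDerivAt_id w).sub_const w).fun_smul hda.hasDerivAt).deriv
      rw [dslope_same]
      simpa using h1.symm
    · rw [dslope_of_ne _ hne, slope_def_module, sub_self, zero_smul, sub_zero, smul_smul,
        inv_mul_cancel₀ (sub_ne_zero.2 hne), one_smul]

end Contour

end MatrixSchrodinger

namespace MatrixSchrodinger

open Filter

variable {E : Type*} [NormedAddCommGroup E] [NormedSpace ℂ E]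

lemma upperSqrt_sq {w : ℂ} (hw : 0 < w.im) : upperSqrt (w ^ 2) = w := by
  have h1 : -w ^ 2 = (-(Complex.I * w)) ^ 2 := by
    linear_combination -(w ^ 2) * Complex.I_sq
  rw [upperSqrt, h1, one_div, Complex.sq_cpow_two_inv (by simpa using hw)]
  linear_combination -w * Complex.I_sq

/-! ### Cauchy's theorem up to the boundary of the upper half-plane. -/

section UpperHalfPlane

variable {ι : Type*} [Fintype ι] {Γ : ι → ContourPiece}

/-- A cycle in the closed upper half-plane has index zero about the points below it. -/
lemma IsCycle.index_eq_zero_of_im_neg (hΓ : IsCycle Γ)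
    (him : ∀ w ∈ contourImage Γ, 0 ≤ w.im) {z : ℂ} (hz : z.im < 0) :
    contourIntegral Γ (fun w => (w - z)⁻¹) = 0 := by
  have hz' : z ∉ contourImage Γ := fun h => (him z h).not_gt hz
  -- The real part of -i(w - z) is Im w - Im z, which is positive on the contour.
  refine hΓ.contourIntegral_eq_zero (F := fun w => Complex.log (-Complex.I * (w - z))) ?_
    (continuousOn_inv_sub hz')
  intro w hw
  have h1 : w - z ≠ 0 := fun h => hz' (by rwa [← sub_eq_zero.1 h])
  have hs : -Complex.I * (w - z) ∈ Complex.slitPlane := by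
    left
    have := him w hw
    simp
    linarith
  have hd : HasDerivAt (fun w => -Complex.I * (w - z)) (-Complex.I * 1) w :=
    ((hasDerivAt_id w).sub_const z).const_mul _
  refine (hd.clog hs).congr_deriv ?_
  have := Complex.I_ne_zero
  field_simp

lemma exists_dist_le_of_disjoint {K L : Set ℂ} (hK : IsCompact K) (hL : IsClosed L)
    (hd : Disjoint K L) : ∃ δ > 0, ∀ w ∈ K, ∀ k ∈ L, δ ≤ ‖w - k‖ := by
  obtain ⟨δ, hδ, h⟩ := hd.exists_thickenings hK hL
  refine ⟨δ, hδ, fun w hw k hk => ?_⟩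
  by_contra hcon
  rw [not_le, ← dist_eq_norm] at hcon
  exact (disjoint_left.1 h) (Metric.self_subset_thickening hδ K hw)
    (Metric.mem_thickening_iff.2 ⟨k, hk, hcon⟩)

/-- A real point off the contour can be pushed slightly below the axis without crossing the contour,
and the index does not change. -/
lemma IsCycle.index_eq_zero_of_im_nonpos (hΓ : IsCycle Γ)
    (him : ∀ w ∈ contourImage Γ, 0 ≤ w.im) {z : ℂ} (hz : z.im ≤ 0) (hz' : z ∉ contourImage Γ) :
    contourIntegral Γ (fun w => (w - z)⁻¹) = 0 := by
  obtain ⟨δ, hδ, h⟩ := exists_dist_le_of_disjoint (isCompact_contourImage Γ)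
    (isClosed_singleton (x := z)) (disjoint_singleton_right.2 hz')
  have h1 : (z - (δ / 2 : ℝ) * Complex.I).im < 0 := by
    simp; linarith
  rw [← hΓ.index_eq_zero_of_im_neg him h1]
  refine (hΓ.index_eq fun w hw => ?_).symm
  have h2 : ‖z - (δ / 2 : ℝ) * Complex.I - z‖ = δ / 2 := by
    simp [abs_of_pos hδ]
  rw [h2]
  linarith [h w hw z rfl]

/-- The origin is added because f is known to be continuous only away from it: zeros may accumulate
there. -/
lemma isClosed_insert_zero_zeros {f : ℂ → ℂ} (hf : ContinuousOn f Omega) :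
    IsClosed ({0} ∪ {z | z ∈ Omega ∧ f z = 0}) := by
  rw [← isOpen_compl_iff, isOpen_iff_eventually]
  intro z hz
  have hz0 : z ≠ 0 := fun h => hz (Or.inl h)
  by_cases him : 0 ≤ z.im
  · have hzΩ : z ∈ Omega := ⟨him, hz0⟩
    have hfz : f z ≠ 0 := fun h => hz (Or.inr ⟨hzΩ, h⟩)
    have h1 := (hf z hzΩ).eventually_ne hfz
    rw [eventually_nhdsWithin_iff] at h1
    filter_upwards [h1, isOpen_ne.mem_nhds hz0] with y hy hy0
    rintro (h | h)
    · exact hy0 h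
    · exact hy h.1 h.2
  · have h2 : ∀ᶠ y in nhds z, y.im < 0 :=
      (Complex.continuous_im.tendsto z).eventually_lt_const (not_le.1 him)
    filter_upwards [h2, isOpen_ne.mem_nhds hz0] with y hy hy0
    rintro (h | h)
    · exact hy0 h
    · exact h.1.1.not_gt hy

/-- Cauchy's theorem for functions holomorphic in the open upper half-plane outside the zeros of
`f` and continuous up to the boundary. -/
theorem IsCycle.cauchy_upper [CompleteSpace E] (hΓ : IsCycle Γ) {f : ℂ → ℂ} {g : ℂ → E}
    (hf : ContinuousOn f Omega) (hΓΩ : contourImage Γ ⊆ {z | z ∈ Omega ∧ f z ≠ 0})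
    (hg : ContinuousOn g {z | z ∈ Omega ∧ f z ≠ 0})
    (hgd : DifferentiableOn ℂ g {z | 0 < z.im ∧ f z ≠ 0})
    (hind : ∀ z : ℂ, 0 < z.im → f z = 0 → contourIntegral Γ (fun w => (w - z)⁻¹) = 0) :
    contourIntegral Γ g = 0 := by
  set K : Set ℂ := {0} ∪ {z | z ∈ Omega ∧ f z = 0} with hK
  have hKc : IsClosed K := isClosed_insert_zero_zeros hf
  have him : ∀ w ∈ contourImage Γ, 0 ≤ w.im := fun w hw => (hΓΩ hw).1.1
  have hdisj : Disjoint (contourImage Γ) K := by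
    refine disjoint_left.2 fun w hw hwK => ?_
    rcases hwK with h | h
    · exact (hΓΩ hw).1.2 h
    · exact (hΓΩ hw).2 h.2
  have hKind : ∀ k ∈ K, contourIntegral Γ (fun w => (w - k)⁻¹) = 0 := by
    intro k hk
    by_cases hk0 : 0 < k.im
    · rcases hk with h | h
      · rw [show k = 0 from h] at hk0; simp at hk0
      · exact hind k hk0 h.2
    · exact hΓ.index_eq_zero_of_im_nonpos him (not_lt.1 hk0) fun h => disjoint_left.1 hdisj h hk
  obtain ⟨δ, hδ, hdist⟩ := exists_dist_le_of_disjoint (isCompact_contourImage Γ) hKc hdisj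
  have hN : ∀ z : ℂ, 0 ≤ z.im → z ∉ K → z ∈ {z | z ∈ Omega ∧ f z ≠ 0} := fun z hz hzK =>
    ⟨⟨hz, fun h => hzK (Or.inl h)⟩, fun h => hzK (Or.inr ⟨⟨hz, fun h => hzK (Or.inl h)⟩, h⟩)⟩
  have hshift : ∀ w ∈ contourImage Γ, ∀ ε ∈ Icc 0 (δ / 2),
      w + (ε : ℝ) * Complex.I ∈ {z | z ∈ Omega ∧ f z ≠ 0} := by
    intro w hw ε hε
    refine hN _ ?_ fun hk => ?_
    · have := him w hw
      simp; linarith [hε.1]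
    · have h1 := hdist w hw _ hk
      have h2 : ‖w - (w + (ε : ℝ) * Complex.I)‖ = ε := by simp [abs_of_nonneg hε.1]
      rw [h2] at h1
      linarith [hε.2]
  have hzero : ∀ ε ∈ Ioc 0 (δ / 2),
      contourIntegral Γ (fun w => g (w + (ε : ℝ) * Complex.I)) = 0 := by
    intro ε hε
    -- The function w ↦ g(w + iε) is holomorphic on this open neighbourhood of the contour, real
    -- points included. Points outside V are below the contour or are shifts of points of K by less
    -- than their distance to the contour, so their index is zero.
    set V : Set ℂ := {z | -ε < z.im} ∩ (fun z : ℂ => z + (ε : ℝ) * Complex.I) ⁻¹' Kᶜ with hV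
    have hVo : IsOpen V := (isOpen_lt continuous_const Complex.continuous_im).inter
      (hKc.isOpen_compl.preimage (by fun_prop))
    have hΓV : contourImage Γ ⊆ V := by
      intro w hw
      refine ⟨lt_of_lt_of_le (by linarith [hε.1]) (him w hw), fun hk => ?_⟩
      have h := hshift w hw ε ⟨hε.1.le, hε.2⟩
      rcases hk with h' | h'
      · exact h.1.2 h'
      · exact h.2 h'.2
    refine hΓ.cauchy hVo hΓV ?_ fun z hz => ?_
    · refine hgd.comp (differentiableOn_id.add_const _) fun z hz => ?_
      have h1 : 0 < (z + (ε : ℝ) * Complex.I).im := by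
        have := hz.1; simp at this ⊢; linarith
      exact ⟨h1, (hN _ h1.le hz.2).2⟩
    · by_cases h1 : -ε < z.im
      · have hk : z + (ε : ℝ) * Complex.I ∈ K := by
          by_contra hcon
          exact hz ⟨h1, hcon⟩
        rw [hΓ.index_eq (z₀ := z + (ε : ℝ) * Complex.I), hKind _ hk]
        intro w hw
        have h2 : ‖z - (z + (ε : ℝ) * Complex.I)‖ = ε := by simp [abs_of_pos hε.1]
        rw [h2]
        linarith [hdist w hw _ hk, hε.2]
      · exact hΓ.index_eq_zero_of_im_neg him (by linarith [hε.1, not_lt.1 h1])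
  have hcomp : IsCompact ((fun p : ℂ × ℝ => p.1 + (p.2 : ℂ) * Complex.I) ''
      (contourImage Γ ×ˢ Icc 0 (δ / 2))) :=
    ((isCompact_contourImage Γ).prod isCompact_Icc).image (by fun_prop)
  obtain ⟨C, hC⟩ := hcomp.exists_bound_of_continuousOn (hg.mono (by
    rintro _ ⟨p, hp, rfl⟩
    exact hshift _ hp.1 _ hp.2))
  -- Continuity of g up to the real axis lets ε → 0, with the compact set of all shifted points
  -- supplying the bound.
  have hcont : ContinuousOn (fun ε : ℝ => contourIntegral Γ fun w => g (w + (ε : ℝ) * Complex.I))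
      (Icc 0 (δ / 2)) := by
    refine continuousOn_finsetSum _ fun i _ => ContinuousOn.const_smul ?_ _
    simp only [intervalIntegral.integral_of_le (Γ i).left_le]
    have hmem : ∀ᵐ s ∂volume.restrict (Ioc (Γ i).left (Γ i).right),
        (Γ i).path s ∈ contourImage Γ :=
      (ae_restrict_iff' measurableSet_Ioc).2 (ae_of_all _ fun s hs =>
        image_subset_contourImage Γ i ((Γ i).path_mem_image (Ioc_subset_Icc_self hs)))
    refine continuousOn_integral_of_local_bound (fun ε hε => ?_) ?_ fun ε₀ hε₀ =>
      ⟨1, one_pos, fun s => ‖(Γ i).velocity s‖ * C, (Γ i).integrable.1.norm.mul_const C, ?_⟩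
    · refine ((Γ i).intervalIntegrable (f := fun w => g (w + (ε : ℝ) * Complex.I))
        ?_).1.aestronglyMeasurable
      exact hg.comp (by fun_prop) fun w hw =>
        hshift w (image_subset_contourImage Γ i hw) ε hε
    · filter_upwards [hmem] with s hs
      exact continuousOn_const.smul (hg.comp (by fun_prop) fun ε hε => hshift _ hs ε hε)
    · filter_upwards [hmem] with s hs ε hε
      rw [norm_smul]
      exact mul_le_mul_of_nonneg_left (hC _ ⟨((Γ i).path s, ε), ⟨hs, hε.2⟩, rfl⟩) (norm_nonneg _)
  have h0 : (0 : ℝ) ∈ Icc 0 (δ / 2) := ⟨le_rfl, by positivity⟩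
  have hl : Tendsto (fun ε : ℝ => contourIntegral Γ fun w => g (w + (ε : ℝ) * Complex.I))
      (nhdsWithin 0 (Ioc 0 (δ / 2))) (nhds (contourIntegral Γ fun w =>
        g (w + ((0 : ℝ) : ℂ) * Complex.I))) :=
    (hcont 0 h0).mono Ioc_subset_Icc_self
  have hne : (nhdsWithin (0 : ℝ) (Ioc 0 (δ / 2))).NeBot := by
    refine mem_closure_iff_nhdsWithin_neBot.1 ?_
    rw [closure_Ioc (by positivity)]
    exact h0
  have hl0 : Tendsto (fun ε : ℝ => contourIntegral Γ fun w => g (w + (ε : ℝ) * Complex.I))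
      (nhdsWithin 0 (Ioc 0 (δ / 2))) (nhds 0) :=
    tendsto_const_nhds.congr' (eventually_mem_nhdsWithin.mono fun ε hε => (hzero ε hε).symm)
  have := tendsto_nhds_unique hl hl0
  simpa using this

end UpperHalfPlane

/-! ### Lifting the closed curve under squaring. -/

section Lift

variable {c : ℝ → ℂ} {a : ℝ} {S : Set ℂ} (hc : IsEncircling c a S)
include hc

lemma IsEncircling.exists_hasDerivAt : ∃ P : Set ℝ, P.Finite ∧
    ∀ s ∈ Ioo (0 : ℝ) 1 \ P, HasDerivAt c (deriv c s) s := by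
  obtain ⟨P, hP, hd, _⟩ := hc.piecewise
  exact ⟨P, hP, fun s hs => (hd s hs).hasDerivAt⟩

lemma IsEncircling.intervalIntegrable_deriv : IntervalIntegrable (deriv c) volume 0 1 := by
  obtain ⟨P, hP, _, _, C, hC⟩ := hc.piecewise
  rw [intervalIntegrable_iff_integrableOn_Ioo_of_le zero_le_one]
  refine MeasureTheory.Measure.integrableOn_of_bounded (M := C) (by simp)
    (stronglyMeasurable_deriv c).aestronglyMeasurable ?_
  have h1 : ∀ᵐ s ∂volume.restrict (Ioo (0 : ℝ) 1), s ∉ P :=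
    ae_restrict_of_ae (compl_mem_ae_iff.2 (hP.measure_zero _))
  filter_upwards [h1, ae_restrict_mem measurableSet_Ioo] with s hs hs'
  exact hC s ⟨hs', hs⟩

/-- The closed curve `c` as a contour. -/
def IsEncircling.piece : ContourPiece where
  path := c
  velocity := deriv c
  left := 0
  right := 1
  mult := 1
  left_le := zero_le_one
  continuousOn := hc.continuous
  hasDerivAt := by
    obtain ⟨P, hP, hd⟩ := hc.exists_hasDerivAt
    exact ⟨P, hP.countable, hd⟩
  integrable := hc.intervalIntegrable_deriv

lemma IsEncircling.isCycle_piece : IsCycle fun _ : Unit => hc.piece := by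
  intro F
  simp [IsEncircling.piece, hc.start, hc.finish]

lemma IsEncircling.contourIntegral_piece (f : ℂ → E) :
    contourIntegral (fun _ : Unit => hc.piece) f = ∫ s in (0 : ℝ)..1, deriv c s • f (c s) := by
  simp [contourIntegral, ContourPiece.integral, IsEncircling.piece]

lemma IsEncircling.contourImage_piece :
    contourImage (fun _ : Unit => hc.piece) = c '' Icc 0 1 := by
  simp [contourImage, ContourPiece.image, IsEncircling.piece, iUnion_const]

lemma IsEncircling.index_piece (z : ℂ) :
    contourIntegral (fun _ : Unit => hc.piece) (fun w => (w - z)⁻¹) =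
      2 * Real.pi * Complex.I * winding c z := by
  rw [hc.contourIntegral_piece, winding, ← mul_assoc, mul_inv_cancel₀ Complex.two_pi_I_ne_zero,
    one_mul]
  simp only [smul_eq_mul, div_eq_mul_inv]

/-- The points of the cut beyond `a` are not encircled. -/
lemma IsEncircling.winding_eq_zero {t : ℝ} (ht : a < t) : winding c t = 0 := by
  have hcut : ∀ s ∈ Icc (0 : ℝ) 1, ∀ r : ℝ, t ≤ r → c s ≠ r := by
    intro s hs r hr h
    rcases eq_or_lt_of_le hs.1 with h0 | h0
    · rw [← h0, hc.start] at h
      exact (ht.trans_le hr).ne (by exact_mod_cast h)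
    rcases eq_or_lt_of_le hs.2 with h1 | h1
    · rw [h1, hc.finish] at h
      exact (ht.trans_le hr).ne (by exact_mod_cast h)
    · exact hc.off_cut s ⟨h0, h1⟩ r ((hc.pos.trans ht).le.trans hr) h
  have htim : (t : ℂ) ∉ contourImage fun _ : Unit => hc.piece := by
    rw [hc.contourImage_piece]
    rintro ⟨s, hs, h⟩
    exact hcut s hs t le_rfl h
  -- The curve does not meet [t, ∞), so t - w avoids the cut of the logarithm.
  have h := hc.isCycle_piece.contourIntegral_eq_zero (f := fun w => (w - t)⁻¹)
    (F := fun w => Complex.log (t - w)) (fun w hw => ?_) (continuousOn_inv_sub htim)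
  · rw [hc.index_piece] at h
    exact (mul_eq_zero.1 h).resolve_left Complex.two_pi_I_ne_zero
  · have hne : w - t ≠ 0 := fun h => htim (by rwa [← sub_eq_zero.1 h])
    have hne' : t - w ≠ 0 := fun h => hne (by rw [← neg_sub, h, neg_zero])
    have hs : t - w ∈ Complex.slitPlane := by
      rw [Complex.mem_slitPlane_iff]
      by_contra hcon
      rw [not_or, not_lt, not_not] at hcon
      rw [hc.contourImage_piece] at hw
      obtain ⟨s, hs, rfl⟩ := hw
      have h1 := hcon.1
      have h2 := hcon.2
      simp at h1 h2
      exact hcut s hs (c s).re h1 (Complex.ext (by simp) (by simpa using h2))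
    have hd : HasDerivAt (fun w => (t : ℂ) - w) (-1) w := (hasDerivAt_id w).const_sub _
    refine (hd.clog hs).congr_deriv ?_
    field_simp
    ring

variable (hS : (0 : ℂ) ∈ S)
include hS

lemma IsEncircling.ne_zero {s : ℝ} (hs : s ∈ Icc (0 : ℝ) 1) : c s ≠ 0 := fun h =>
  (hc.encircles 0 hS).1 ⟨s, hs, h⟩

lemma IsEncircling.intervalIntegrable_logDeriv :
    IntervalIntegrable (fun s => deriv c s / c s) volume 0 1 := by
  simp only [div_eq_mul_inv]
  refine hc.intervalIntegrable_deriv.mul_continuousOn ?_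
  rw [uIcc_of_le zero_le_one]
  exact hc.continuous.inv₀ fun s hs => hc.ne_zero hS hs

omit hc hS in
/-- The logarithm of `c s / c 0`, continued along the curve. -/
def logAlong (c : ℝ → ℂ) (s : ℝ) : ℂ := ∫ u in (0 : ℝ)..s, deriv c u / c u

lemma IsEncircling.continuousOn_logAlong : ContinuousOn (logAlong c) (Icc 0 1) := by
  have := intervalIntegral.continuousOn_primitive_interval'
    (hc.intervalIntegrable_logDeriv hS) (a := 0) left_mem_uIcc
  rwa [uIcc_of_le zero_le_one] at this

lemma IsEncircling.hasDerivAt_logAlong : ∃ P : Set ℝ, P.Finite ∧ ∀ s ∈ Ioo (0 : ℝ) 1 \ P,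
    HasDerivAt c (deriv c s) s ∧ HasDerivAt (logAlong c) (deriv c s / c s) s := by
  obtain ⟨P, hP, hd, hcont, _⟩ := hc.piecewise
  refine ⟨P, hP, fun s hs => ⟨(hd s hs).hasDerivAt, ?_⟩⟩
  have hopen : IsOpen (Ioo (0 : ℝ) 1 \ P) := isOpen_Ioo.sdiff hP.isClosed
  have hco : ContinuousOn (fun s => deriv c s / c s) (Ioo (0 : ℝ) 1 \ P) :=
    hcont.div (hc.continuous.mono fun u hu => Ioo_subset_Icc_self hu.1)
      fun u hu => hc.ne_zero hS (Ioo_subset_Icc_self hu.1)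
  refine intervalIntegral.integral_hasDerivAt_right ?_
    (hco.stronglyMeasurableAtFilter hopen s hs) (hco.continuousAt (hopen.mem_nhds hs))
  refine (hc.intervalIntegrable_logDeriv hS).mono_set ?_
  rw [uIcc_of_le zero_le_one, uIcc_of_le hs.1.1.le]
  exact Icc_subset_Icc_right hs.1.2.le

/-- The product c · exp(-logAlong) is continuous with zero derivative off a finite set, hence
constant. -/
lemma IsEncircling.eq_exp_logAlong {s : ℝ} (hs : s ∈ Icc (0 : ℝ) 1) :
    c s = a * Complex.exp (logAlong c s) := by
  obtain ⟨P, hP, hd⟩ := hc.hasDerivAt_logAlong hS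
  have hsub : Icc 0 s ⊆ Icc (0 : ℝ) 1 := Icc_subset_Icc_right hs.2
  have h := MeasureTheory.integral_eq_of_hasDerivAt_off_countable_of_le
    (fun u => c u * Complex.exp (-logAlong c u)) (fun _ => 0) hs.1 hP.countable
    ((hc.continuous.mono hsub).mul (((hc.continuousOn_logAlong hS).mono hsub).neg.cexp))
    (fun u hu => ?_) (by simp)
  · have h0 : logAlong c 0 = 0 := by simp [logAlong]
    simp only [intervalIntegral.integral_zero, h0, neg_zero, Complex.exp_zero, mul_one,
      hc.start] at h
    have h1 := sub_eq_zero.1 h.symm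
    rw [← h1, mul_assoc, ← Complex.exp_add]
    simp
  · have hu' : u ∈ Ioo (0 : ℝ) 1 \ P := ⟨⟨hu.1.1, hu.1.2.trans_le hs.2⟩, hu.2⟩
    have hcu := hc.ne_zero hS (Ioo_subset_Icc_self hu'.1)
    refine ((hd u hu').1.mul (hd u hu').2.neg.cexp).congr_deriv ?_
    field_simp
    ring

/-- Winding once around 0 adds 2πi to the logarithm; half of it reverses the sign of the square
root, so the lift ends at -√a. -/
lemma IsEncircling.logAlong_one : logAlong c 1 = 2 * Real.pi * Complex.I := by
  have := (hc.encircles 0 hS).2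
  rw [winding] at this
  simp only [sub_zero] at this
  exact ((inv_mul_eq_one₀ Complex.two_pi_I_ne_zero).1 this).symm

/-- The lift of the curve under `w ↦ w ^ 2`. -/
def IsEncircling.lift : ContourPiece where
  path s := (Real.sqrt a : ℂ) * Complex.exp (logAlong c s / 2)
  velocity s := (Real.sqrt a : ℂ) * Complex.exp (logAlong c s / 2) * (deriv c s / c s / 2)
  left := 0
  right := 1
  mult := 1
  left_le := zero_le_one
  continuousOn := continuousOn_const.mul ((hc.continuousOn_logAlong hS).div_const 2).cexp
  hasDerivAt := by
    obtain ⟨P, hP, hd⟩ := hc.hasDerivAt_logAlong hS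
    refine ⟨P, hP.countable, fun s hs => ?_⟩
    rw [mul_assoc]
    exact ((hd s hs).2.div_const 2).cexp.const_mul _
  integrable := by
    refine ((hc.intervalIntegrable_logDeriv hS).div_const 2).continuousOn_mul ?_
    rw [uIcc_of_le zero_le_one]
    exact continuousOn_const.mul ((hc.continuousOn_logAlong hS).div_const 2).cexp

lemma IsEncircling.lift_sq {s : ℝ} (hs : s ∈ Icc (0 : ℝ) 1) : (hc.lift hS).path s ^ 2 = c s := by
  rw [IsEncircling.lift, mul_pow, ← Complex.ofReal_pow, Real.sq_sqrt hc.pos.le, ← Complex.exp_nat_mul,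
    hc.eq_exp_logAlong hS hs]
  push_cast
  rw [mul_div_cancel₀ _ two_ne_zero]

lemma IsEncircling.lift_zero : (hc.lift hS).path 0 = Real.sqrt a := by
  simp [IsEncircling.lift, logAlong]

lemma IsEncircling.lift_one : (hc.lift hS).path 1 = -Real.sqrt a := by
  simp only [IsEncircling.lift]
  rw [hc.logAlong_one hS, mul_assoc, mul_div_cancel_left₀ _ two_ne_zero, Complex.exp_pi_mul_I]
  ring

lemma IsEncircling.lift_velocity {s : ℝ} (hs : s ∈ Icc (0 : ℝ) 1) :
    (hc.lift hS).velocity s * (2 * (hc.lift hS).path s) = deriv c s := by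
  have h1 := hc.lift_sq hS hs
  have h2 := hc.ne_zero hS hs
  have h3 : (hc.lift hS).velocity s = (hc.lift hS).path s * (deriv c s / c s / 2) := rfl
  rw [h3]
  field_simp
  linear_combination deriv c s * h1

/-- A real value of the lift would have its square on the cut, which c avoids, so the imaginary part
keeps one sign. The argument runs from 0 to π and therefore equals π/2 somewhere, where the sign is
positive. -/
lemma IsEncircling.lift_im_pos {s : ℝ} (hs : s ∈ Ioo (0 : ℝ) 1) :
    0 < ((hc.lift hS).path s).im := by
  set τ := (hc.lift hS).path with hτ
  have hne : ∀ u ∈ Ioo (0 : ℝ) 1, (τ u).im ≠ 0 := by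
    intro u hu h0
    have h1 : τ u = ((τ u).re : ℂ) := Complex.ext rfl (by simpa using h0)
    refine hc.off_cut u hu ((τ u).re ^ 2) (sq_nonneg _) ?_
    rw [← hc.lift_sq hS (Ioo_subset_Icc_self hu), ← hτ, h1]
    simp
  have hcont : ContinuousOn (fun u => (τ u).im) (Ioo 0 1) :=
    Complex.continuous_im.comp_continuousOn
      ((hc.lift hS).continuousOn.mono (Ioo_subset_Icc_self : Ioo (0 : ℝ) 1 ⊆ Icc 0 1))
  have hθ : ContinuousOn (fun u => (logAlong c u / 2).im) (Icc 0 1) :=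
    Complex.continuous_im.comp_continuousOn ((hc.continuousOn_logAlong hS).div_const 2)
  obtain ⟨v, hv, hv2⟩ : Real.pi / 2 ∈ (fun u => (logAlong c u / 2).im) '' Ioo (0 : ℝ) 1 := by
    refine intermediate_value_Ioo zero_le_one hθ ?_
    have hπ := Real.pi_pos
    rw [hc.logAlong_one hS, mul_assoc, mul_div_cancel_left₀ _ two_ne_zero]
    simp only [logAlong, intervalIntegral.integral_same]
    constructor
    · simp; positivity
    · simp; linarith
  have hvpos : 0 < (τ v).im := by
    simp only at hv2
    simp only [hτ, IsEncircling.lift, Complex.im_ofReal_mul,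
      Complex.exp_im, hv2, Real.sin_pi_div_two, mul_one]
    have := Real.sqrt_pos.2 hc.pos
    positivity
  by_contra hcon
  have hsn : (τ s).im < 0 := lt_of_le_of_ne (not_lt.1 hcon) (hne s hs)
  obtain ⟨u, hu, hu0⟩ := isPreconnected_Ioo.intermediate_value hs hv hcont ⟨hsn.le, hvpos.le⟩
  exact hne u hu hu0

lemma IsEncircling.upperSqrt_eq {s : ℝ} (hs : s ∈ Ioo (0 : ℝ) 1) :
    upperSqrt (c s) = (hc.lift hS).path s := by
  rw [← hc.lift_sq hS (Ioo_subset_Icc_self hs), upperSqrt_sq (hc.lift_im_pos hS hs)]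

lemma IsEncircling.lift_mem_Omega {s : ℝ} (hs : s ∈ Icc (0 : ℝ) 1) :
    (hc.lift hS).path s ∈ Omega := by
  refine ⟨?_, fun h => hc.ne_zero hS hs ?_⟩
  · rcases eq_or_lt_of_le hs.1 with h0 | h0
    · rw [← h0, hc.lift_zero]; simp
    rcases eq_or_lt_of_le hs.2 with h1 | h1
    · rw [h1, hc.lift_one]; simp
    · exact (hc.lift_im_pos hS ⟨h0, h1⟩).le
  · rw [← hc.lift_sq hS hs, h]; simp

end Lift

end MatrixSchrodinger

namespace MatrixSchrodinger

open Filter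

/-! ### The keyhole contour in the rho-plane. -/

variable {E : Type*} [NormedAddCommGroup E] [NormedSpace ℂ E]

/-- The lift `σ √t` of a segment of the cut. -/
def sqrtPiece (σ : ℂ) (a b : ℝ) (ha : 0 < a) (hab : a ≤ b) : ContourPiece where
  path t := σ * Real.sqrt t
  velocity t := σ * ((1 / (2 * Real.sqrt t) : ℝ) : ℂ)
  left := a
  right := b
  mult := -σ
  left_le := hab
  continuousOn := by fun_prop
  hasDerivAt := by
    refine ⟨∅, countable_empty, fun t ht => ?_⟩
    exact ((hasDerivAt_id t).sqrt (ha.trans ht.1.1).ne').ofReal_comp.const_mul σ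
  integrable := by
    refine ContinuousOn.intervalIntegrable ?_
    rw [uIcc_of_le hab]
    refine continuousOn_const.mul (Complex.continuous_ofReal.comp_continuousOn ?_)
    refine continuousOn_const.div (by fun_prop) fun t ht => ?_
    have := Real.sqrt_pos.2 (ha.trans_le ht.1)
    positivity

/-- The substitution mu = rho², dmu = 2 rho drho. The multiplicity -σ orients the upper side (σ = 1)
towards a and the lower side (σ = -1) away from it. -/
lemma sqrtPiece_integral {σ : ℂ} (hσ : σ ^ 2 = 1) {a b : ℝ} (ha : 0 < a) (hab : a ≤ b)
    (G : ℂ → E) : (sqrtPiece σ a b ha hab).integral (fun w => (2 * w) • G w) =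
      -σ • ∫ t in a..b, G (σ * Real.sqrt t) := by
  rw [ContourPiece.integral]
  refine congrArg (fun v : E => -σ • v) (intervalIntegral.integral_congr fun t ht => ?_)
  have ht' : t ∈ Icc a b := by rwa [← uIcc_of_le hab]
  have h1 := (Real.sqrt_pos.2 (ha.trans_le ht'.1)).ne'
  have h2 : (Real.sqrt t : ℂ) ≠ 0 := by exact_mod_cast h1
  have h3 : σ * ((1 / (2 * Real.sqrt t) : ℝ) : ℂ) * (2 * (σ * Real.sqrt t)) = 1 := by
    push_cast
    field_simp
    exact hσ
  simp only [sqrtPiece, smul_smul, h3, one_smul]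

/-- The upper half of the circle of radius `R`. -/
def arcPiece (R : ℝ) : ContourPiece where
  path θ := R * Complex.exp (θ / 2 * Complex.I)
  velocity θ := R * (Complex.exp (θ / 2 * Complex.I) * (1 / 2 * Complex.I))
  left := 0
  right := 2 * Real.pi
  mult := -1
  left_le := Real.two_pi_pos.le
  continuousOn := by fun_prop
  hasDerivAt := by
    refine ⟨∅, countable_empty, fun t _ => ?_⟩
    exact (((hasDerivAt_id (t : ℂ)).div_const 2).mul_const Complex.I).comp_ofReal.cexp.const_mul _
  integrable := Continuous.intervalIntegrable (by fun_prop) _ _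

/-- The angle is θ/2, so squaring runs once through the full circle of radius R². The multiplicity
-1 lets the arc close the contour from -R back to R. -/
lemma arcPiece_integral (R : ℝ) (G : ℂ → E) :
    (arcPiece R).integral (fun w => (2 * w) • G w) =
      -∫ θ in (0 : ℝ)..2 * Real.pi, (Complex.I * (arcPiece R).path θ ^ 2) •
        G ((arcPiece R).path θ) := by
  rw [ContourPiece.integral, ← neg_one_smul ℂ]
  refine congrArg (fun v : E => (-1 : ℂ) • v) (intervalIntegral.integral_congr fun t _ => ?_)
  simp only [arcPiece, smul_smul]
  congr 1
  ring

lemma norm_arcPiece {R : ℝ} (hR : 0 ≤ R) (θ : ℝ) : ‖(arcPiece R).path θ‖ = R := by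
  simp only [arcPiece]
  rw [norm_mul, show (θ / 2 * Complex.I : ℂ) = ((θ / 2 : ℝ) : ℂ) * Complex.I by push_cast; ring,
    Complex.norm_exp_ofReal_mul_I, mul_one, Complex.norm_real, Real.norm_of_nonneg hR]

lemma arcPiece_mem_Omega {R : ℝ} (hR : 0 < R) {θ : ℝ} (hθ : θ ∈ Icc 0 (2 * Real.pi)) :
    (arcPiece R).path θ ∈ Omega := by
  refine ⟨?_, norm_pos_iff.1 (by rwa [norm_arcPiece hR.le])⟩
  simp only [arcPiece]
  rw [show (θ / 2 * Complex.I : ℂ) = ((θ / 2 : ℝ) : ℂ) * Complex.I by push_cast; ring,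
    Complex.im_ofReal_mul, Complex.exp_ofReal_mul_I_im]
  exact mul_nonneg hR.le (Real.sin_nonneg_of_nonneg_of_le_pi (by linarith [hθ.1])
    (by linarith [hθ.2]))

lemma arcPiece_sq (R θ : ℝ) : (arcPiece R).path θ ^ 2 = circleMap 0 (R ^ 2) θ := by
  simp only [arcPiece, circleMap_zero]
  rw [mul_pow, ← Complex.exp_nat_mul]
  push_cast
  congr 2
  ring

section Keyhole

variable {c : ℝ → ℂ} {a : ℝ} {S : Set ℂ} (hc : IsEncircling c a S) (hS : (0 : ℂ) ∈ S) {R : ℝ}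
  (hR : 0 < R) (haR : a ≤ R ^ 2)

/-- The lift of the part of the contour `γ` inside the disc of radius `R ^ 2`, closed by the
circle. -/
def IsEncircling.keyhole : Fin 4 → ContourPiece :=
  ![sqrtPiece 1 a (R ^ 2) hc.pos haR, hc.lift hS, sqrtPiece (-1) a (R ^ 2) hc.pos haR, arcPiece R]

include hR in
lemma IsEncircling.isCycle_keyhole : IsCycle (hc.keyhole hS haR) := by
  intro F
  have hsR : Real.sqrt (R ^ 2) = R := Real.sqrt_sq hR.le
  have h2 : (arcPiece R).path (2 * Real.pi) = -R := by
    simp only [arcPiece]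
    push_cast
    rw [mul_div_cancel_left₀ _ two_ne_zero, Complex.exp_pi_mul_I]
    ring
  have h0 : (arcPiece R).path 0 = R := by simp [arcPiece]
  have hl : (hc.lift hS).left = 0 := rfl
  have hr : (hc.lift hS).right = 1 := rfl
  have hm : (hc.lift hS).mult = 1 := rfl
  have hl4 : (arcPiece R).left = 0 := rfl
  have hr4 : (arcPiece R).right = 2 * Real.pi := rfl
  have hm4 : (arcPiece R).mult = -1 := rfl
  simp only [IsEncircling.keyhole, Fin.sum_univ_four, Matrix.cons_val, hl, hr, hm, hl4, hr4, hm4,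
    h0, h2, hc.lift_zero, hc.lift_one, sqrtPiece, hsR, one_mul, neg_mul]
  ring

lemma IsEncircling.keyhole_integral (G : ℂ → E) :
    contourIntegral (hc.keyhole hS haR) (fun w => (2 * w) • G w) =
      -(∫ t in a..R ^ 2, G (Real.sqrt t)) +
      (∫ s in (0 : ℝ)..1, deriv c s • G ((hc.lift hS).path s)) +
      (∫ t in a..R ^ 2, G (-(Real.sqrt t : ℂ))) -
      ∫ θ in (0 : ℝ)..2 * Real.pi, (Complex.I * (arcPiece R).path θ ^ 2) •
        G ((arcPiece R).path θ) := by
  have hl : (hc.lift hS).integral (fun w => (2 * w) • G w) =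
      ∫ s in (0 : ℝ)..1, deriv c s • G ((hc.lift hS).path s) := by
    rw [ContourPiece.integral]
    refine (one_smul ℂ _).trans (intervalIntegral.integral_congr fun s hs => ?_)
    rw [uIcc_of_le (hc.lift hS).left_le] at hs
    simp only [smul_smul, hc.lift_velocity hS hs]
  simp only [contourIntegral, IsEncircling.keyhole, Fin.sum_univ_four, Matrix.cons_val, hl,
    sqrtPiece_integral (one_pow 2), sqrtPiece_integral (neg_one_sq), arcPiece_integral,
    neg_neg, one_smul, one_mul, neg_one_mul, sub_eq_add_neg, neg_smul]

lemma IsEncircling.keyhole_forall {p : ℂ → Prop}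
    (h1 : ∀ t ∈ Icc a (R ^ 2), p (Real.sqrt t) ∧ p (-(Real.sqrt t : ℂ)))
    (h2 : ∀ s ∈ Icc (0 : ℝ) 1, p ((hc.lift hS).path s))
    (h3 : ∀ θ ∈ Icc 0 (2 * Real.pi), p ((arcPiece R).path θ)) :
    ∀ w ∈ contourImage (hc.keyhole hS haR), p w := by
  intro w hw
  obtain ⟨i, s, hs, rfl⟩ := mem_iUnion.1 hw
  fin_cases i
  · simpa [IsEncircling.keyhole, sqrtPiece] using (h1 s hs).1
  · exact h2 s hs
  · simpa [IsEncircling.keyhole, sqrtPiece] using (h1 s hs).2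
  · exact h3 s hs

include hR in
lemma IsEncircling.keyhole_subset_Omega : contourImage (hc.keyhole hS haR) ⊆ Omega := by
  refine hc.keyhole_forall hS haR (fun t ht => ?_) (fun s hs => hc.lift_mem_Omega hS hs)
    fun θ hθ => arcPiece_mem_Omega hR hθ
  have h1 := (Real.sqrt_pos.2 (hc.pos.trans_le ht.1)).ne'
  have h2 : (Real.sqrt t : ℂ) ≠ 0 := by exact_mod_cast h1
  exact ⟨⟨by simp, h2⟩, ⟨by simp, neg_ne_zero.2 h2⟩⟩

include hR in
/-- The index of the keyhole contour about a point inside the circle whose square is encircled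
by `c`. -/
lemma IsEncircling.keyhole_index {k : ℂ} (hk : 0 < k.im) (hkR : ‖k‖ < R)
    (hk' : k ∉ contourImage (hc.keyhole hS haR)) (hw : winding c (k ^ 2) = 1) :
    contourIntegral (hc.keyhole hS haR) (fun w => (w - k)⁻¹) = 0 := by
  have hΩ := hc.keyhole_subset_Omega hS hR haR
  have hcyc := hc.isCycle_keyhole hS hR haR
  have hmk : (-k) ∉ contourImage (hc.keyhole hS haR) := fun h => by
    have := (hΩ h).1; simp at this; linarith
  have h1 : contourIntegral (hc.keyhole hS haR) (fun w => (w - -k)⁻¹) = 0 :=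
    hcyc.index_eq_zero_of_im_neg (fun w hw => (hΩ hw).1) (by simpa using hk)
  -- Partial fractions. The point -k lies below the contour and has index zero, so the index of k
  -- becomes an integral of 1/(mu - k²) over γ and the circle. There the two sides of the cut
  -- cancel, and c and the circle contribute 2πi and -2πi.
  have hsum : EqOn (fun w => (2 * w) • (w ^ 2 - k ^ 2)⁻¹ - (w - -k)⁻¹) (fun w => (w - k)⁻¹)
      (contourImage (hc.keyhole hS haR)) := by
    intro w hw
    have e1 : w - k ≠ 0 := fun h => hk' (by rwa [← sub_eq_zero.1 h])
    have e2 : w + k ≠ 0 := fun h => hmk (by rwa [← eq_neg_of_add_eq_zero_left h])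
    have e3 : w ^ 2 - k ^ 2 = (w - k) * (w + k) := by ring
    simp only [e3, smul_eq_mul, sub_neg_eq_add]
    field_simp
    ring
  have hcont : ContinuousOn (fun w => (2 * w) • (w ^ 2 - k ^ 2)⁻¹)
      (contourImage (hc.keyhole hS haR)) := by
    refine (by fun_prop : Continuous fun w : ℂ => 2 * w).continuousOn.smul
      (ContinuousOn.inv₀ (by fun_prop) fun w hw => ?_)
    rw [show w ^ 2 - k ^ 2 = (w - k) * (w - -k) by ring]
    exact mul_ne_zero (fun h => hk' (by rwa [← sub_eq_zero.1 h]))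
      fun h => hmk (by rwa [← sub_eq_zero.1 h])
  rw [← contourIntegral_congr hsum, contourIntegral_sub hcont (continuousOn_inv_sub hmk), h1,
    sub_zero, hc.keyhole_integral hS haR fun w => (w ^ 2 - k ^ 2)⁻¹]
  have e2 : (∫ s in (0 : ℝ)..1, deriv c s • (((hc.lift hS).path s) ^ 2 - k ^ 2)⁻¹) =
      2 * Real.pi * Complex.I := by
    have := hc.index_piece (k ^ 2)
    rw [hw, mul_one, hc.contourIntegral_piece] at this
    rw [← this]
    refine intervalIntegral.integral_congr fun s hs => ?_
    rw [uIcc_of_le zero_le_one] at hs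
    simp only [hc.lift_sq hS hs]
  have e3 : (∫ θ in (0 : ℝ)..2 * Real.pi, (Complex.I * (arcPiece R).path θ ^ 2) •
      ((arcPiece R).path θ ^ 2 - k ^ 2)⁻¹) = 2 * Real.pi * Complex.I := by
    have hk2 : k ^ 2 ∈ Metric.ball (0 : ℂ) (R ^ 2) := by
      rw [mem_ball_zero_iff, norm_pow]
      exact pow_lt_pow_left₀ hkR (norm_nonneg _) two_ne_zero
    rw [← circleIntegral.integral_sub_inv_of_mem_ball hk2, circleIntegral]
    refine intervalIntegral.integral_congr fun θ _ => ?_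
    simp only [arcPiece_sq, deriv_circleMap, mul_comm]
  rw [e2, e3]
  simp

end Keyhole

end MatrixSchrodinger

namespace MatrixSchrodinger

open Filter Asymptotics

variable {n : ℕ} {Q Qt : ℝ → Mat n} {A h ht : Mat n}

/-! ### The kernel D and analyticity in the spectral parameters. -/

section Adjoint

variable (hQ : IntegrableOn Q (Ioi 0)) (Z₀ Z₁ : Mat n)
include hQ

lemma adjIvpSol_differentiable {x : ℝ} (hx : 0 ≤ x) :
    Differentiable ℂ fun lam => adjIvpSol Q Z₀ Z₁ lam x := by
  have h1 := ivpSol_differentiable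
    (intervalIntegrable_of_integrableOn (integrableOn_transpose hQ)) Z₀ᵀ Z₁ᵀ hx
  exact ((transposeCLM n).differentiable.comp h1.fst).prodMk
    ((transposeCLM n).differentiable.comp h1.snd)

lemma adjIvpSol_continuousOn (lam : ℂ) : ContinuousOn (adjIvpSol Q Z₀ Z₁ lam) (Ici 0) := by
  have h1 := ivpSol_continuousOn
    (intervalIntegrable_of_integrableOn (integrableOn_transpose hQ)) Z₀ᵀ Z₁ᵀ lam
  exact ((transposeCLM n).continuous.comp_continuousOn h1.fst).prodMk
    ((transposeCLM n).continuous.comp_continuousOn h1.snd)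

lemma exists_bound_adjIvpSol (B : ℝ) {b : ℝ} (hb : 0 ≤ b) :
    ∃ C, ∀ lam : ℂ, ‖lam‖ ≤ B → ∀ x ∈ Icc 0 b, ‖adjIvpSol Q Z₀ Z₁ lam x‖ ≤ C := by
  obtain ⟨C, hC⟩ := exists_bound_ivpSol
    (intervalIntegrable_of_integrableOn (integrableOn_transpose hQ)) Z₀ᵀ Z₁ᵀ B hb
  refine ⟨‖transposeCLM n‖ * C, fun lam hlam x hx => ?_⟩
  have h1 := hC lam hlam x hx
  refine norm_prod_le_iff.2 ⟨?_, ?_⟩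
  · exact ((transposeCLM n).le_opNorm _).trans
      (mul_le_mul_of_nonneg_left ((norm_fst_le _).trans h1) (norm_nonneg _))
  · exact ((transposeCLM n).le_opNorm _).trans
      (mul_le_mul_of_nonneg_left ((norm_snd_le _).trans h1) (norm_nonneg _))

end Adjoint

section Kernel

/-- The kernel `kernelD`, in terms of `ivpSol` and `adjIvpSol`. -/
def ivpKernel (Q : ℝ → Mat n) (A h : Mat n) (x : ℝ) (lam mu : ℂ) : Mat n :=
  ∫ t in (0 : ℝ)..x,
    (adjIvpSol Q A (perp A + h) mu t).1 * (ivpSol Q A (perp A + h) lam t).1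

variable (hQ : IntegrableOn Q (Ioi 0)) {x : ℝ} (hx : 0 ≤ x)
include hQ hx

lemma kernelD_eq (lam mu : ℂ) : kernelD Q A h x lam mu = ivpKernel Q A h x lam mu := by
  refine intervalIntegral.integral_congr fun t ht => ?_
  rw [uIcc_of_le hx] at ht
  simp only [(phi_eq hQ A h lam ht.1).1, (phiStar_eq hQ A h mu ht.1).1]

/-- The integrated Lagrange identity; the Wronskian at 0 vanishes because A commutes with A^⊥ + h.
Kept free of division, it also holds for lam = mu. -/
lemma ivpKernel_formula (H : IsBoundaryData A h) (lam mu : ℂ) :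
    (lam - mu) • ivpKernel Q A h x lam mu =
      (adjIvpSol Q A (perp A + h) mu x).2 * (ivpSol Q A (perp A + h) lam x).1 -
        (adjIvpSol Q A (perp A + h) mu x).1 * (ivpSol Q A (perp A + h) lam x).2 := by
  have hq := intervalIntegrable_of_integrableOn hQ
  have hw := ((ivpSol_solvesWith hq A (perp A + h) lam).wronskian
    (adjIvpSol_solvesWith hQ A (perp A + h) mu)).eq x hx
  rw [hw, adjIvpSol_zero hQ, ivpSol_zero hq, ivpKernel, ← intervalIntegral.integral_smul]
  have h0 : (perp A + h) * A - A * (perp A + h) = 0 := by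
    rw [add_mul, mul_add, H.perp_mul, H.mul_perp, ← H.left, ← H.right]
    abel
  rw [h0, zero_add]

lemma ivpKernel_intervalIntegrable (lam mu : ℂ) : IntervalIntegrable (fun t =>
    (adjIvpSol Q A (perp A + h) mu t).1 * (ivpSol Q A (perp A + h) lam t).1) volume 0 x := by
  refine ContinuousOn.intervalIntegrable ?_
  rw [uIcc_of_le hx]
  have h1 := (adjIvpSol_continuousOn hQ A (perp A + h) mu).fst.mono (Icc_subset_Ici_self : Icc 0 x ⊆ Ici 0)
  have h2 := (ivpSol_continuousOn (intervalIntegrable_of_integrableOn hQ) A (perp A + h)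
    lam).fst.mono (Icc_subset_Ici_self : Icc 0 x ⊆ Ici 0)
  exact h1.mul h2

lemma exists_bound_ivpSol_mul (B : ℝ) : ∃ C, ∀ lam mu : ℂ, ‖lam‖ ≤ B → ‖mu‖ ≤ B →
    ∀ t ∈ Icc 0 x,
      ‖(adjIvpSol Q A (perp A + h) mu t).1 * (ivpSol Q A (perp A + h) lam t).1‖ ≤ C := by
  obtain ⟨C₁, h1⟩ := exists_bound_adjIvpSol hQ A (perp A + h) B hx
  obtain ⟨C₂, h2⟩ := exists_bound_ivpSol (intervalIntegrable_of_integrableOn hQ) A (perp A + h)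
    B hx
  refine ⟨C₁ * C₂, fun lam mu hl hm t ht => ?_⟩
  have e1 := (norm_fst_le _).trans (h1 mu hm t ht)
  exact (norm_mul_le _ _).trans (mul_le_mul e1 ((norm_fst_le _).trans (h2 lam hl t ht))
    (norm_nonneg _) ((norm_nonneg _).trans e1))

lemma exists_bound_ivpKernel (B : ℝ) : ∃ C, ∀ lam mu : ℂ, ‖lam‖ ≤ B → ‖mu‖ ≤ B →
    ‖ivpKernel Q A h x lam mu‖ ≤ C := by
  obtain ⟨C, hC⟩ := exists_bound_ivpSol_mul (A := A) (h := h) hQ hx B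
  refine ⟨C * |x - 0|, fun lam mu hl hm =>
    intervalIntegral.norm_integral_le_of_norm_le_const fun t ht => ?_⟩
  rw [uIoc_of_le hx] at ht
  exact hC lam mu hl hm t (Ioc_subset_Icc_self ht)

lemma ivpKernel_differentiable_left (mu : ℂ) :
    Differentiable ℂ fun lam => ivpKernel Q A h x lam mu := by
  simp only [ivpKernel, intervalIntegral.integral_of_le hx]
  rw [← differentiableOn_univ]
  have hmem : ∀ᵐ t ∂volume.restrict (Ioc 0 x), t ∈ Icc 0 x :=
    (ae_restrict_iff' measurableSet_Ioc).2 (ae_of_all _ fun s hs => Ioc_subset_Icc_self hs)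
  refine differentiableOn_integral isOpen_univ (fun lam _ =>
    (ivpKernel_intervalIntegrable hQ hx lam mu).1.aestronglyMeasurable) ?_ fun lam₀ _ => ?_
  · filter_upwards [hmem] with t ht
    exact ((ivpSol_differentiable (intervalIntegrable_of_integrableOn hQ) A (perp A + h)
      ht.1).fst.const_mul _).differentiableOn
  · obtain ⟨C, hC⟩ := exists_bound_ivpSol_mul (A := A) (h := h) hQ hx (max (‖lam₀‖ + 1) ‖mu‖)
    refine ⟨1, one_pos, fun _ => C, integrable_const C, ?_⟩
    filter_upwards [hmem] with t ht lam hlam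
    refine hC lam mu (le_max_of_le_left ?_) (le_max_right _ _) t ht
    have h1 := mem_ball_iff_norm.1 hlam.1
    linarith [norm_le_norm_add_norm_sub' lam lam₀]

lemma ivpKernel_differentiable_right (lam : ℂ) :
    Differentiable ℂ fun mu => ivpKernel Q A h x lam mu := by
  simp only [ivpKernel, intervalIntegral.integral_of_le hx]
  rw [← differentiableOn_univ]
  have hmem : ∀ᵐ t ∂volume.restrict (Ioc 0 x), t ∈ Icc 0 x :=
    (ae_restrict_iff' measurableSet_Ioc).2 (ae_of_all _ fun s hs => Ioc_subset_Icc_self hs)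
  refine differentiableOn_integral isOpen_univ (fun mu _ =>
    (ivpKernel_intervalIntegrable hQ hx lam mu).1.aestronglyMeasurable) ?_ fun mu₀ _ => ?_
  · filter_upwards [hmem] with t ht
    exact ((adjIvpSol_differentiable hQ A (perp A + h) ht.1).fst.mul_const _).differentiableOn
  · obtain ⟨C, hC⟩ := exists_bound_ivpSol_mul (A := A) (h := h) hQ hx (max (‖mu₀‖ + 1) ‖lam‖)
    refine ⟨1, one_pos, fun _ => C, integrable_const C, ?_⟩
    filter_upwards [hmem] with t ht mu hmu
    refine hC lam mu (le_max_right _ _) (le_max_of_le_left ?_) t ht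
    have h1 := mem_ball_iff_norm.1 hmu.1
    linarith [norm_le_norm_add_norm_sub' mu mu₀]

/-- The formula for `kernelD` in terms of the Wronskian. -/
lemma kernelD_eq_wronskian (H : IsBoundaryData A h) {lam mu : ℂ} (hne : mu ≠ lam) :
    kernelD Q A h x lam mu = (lam - mu)⁻¹ • wronskian (phiStar Q A h mu) (phi Q A h lam) x := by
  have h1 := ivpKernel_formula hQ hx H lam mu
  rw [wronskian, (phi_eq hQ A h lam hx).1, (phi_eq hQ A h lam hx).2,
    (phiStar_eq hQ A h mu hx).1, (phiStar_eq hQ A h mu hx).2, ← h1, kernelD_eq hQ hx,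
    inv_smul_smul₀ (sub_ne_zero.2 hne.symm)]

end Kernel

section Regularity

variable (hQ : IntegrableOn Q (Ioi 0))
include hQ

lemma jostMatrix_continuousOn (A h : Mat n) : ContinuousOn (jostMatrix Q A h) Omega := by
  have h1 := jostU_continuousOn_param hQ (le_refl 0)
  have h2 := jostV_continuousOn_param hQ (le_refl 0)
  have h3 : ContinuousOn (fun rho => A * (jostV Q rho 0 - h * jostU Q rho 0) -
      perp A * jostU Q rho 0) Omega :=
    (continuousOn_const.mul (h2.sub (continuousOn_const.mul h1))).sub (continuousOn_const.mul h1)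
  exact h3.congr fun rho hrho => jostMatrix_eq hQ hrho A h

lemma jostMatrix_differentiableOn (A h : Mat n) :
    DifferentiableOn ℂ (jostMatrix Q A h) {rho | 0 < rho.im} := by
  have h1 := jostU_differentiableOn_param hQ (le_refl 0)
  have h2 := jostV_differentiableOn_param hQ (le_refl 0)
  have h3 : DifferentiableOn ℂ (fun rho => A * (jostV Q rho 0 - h * jostU Q rho 0) -
      perp A * jostU Q rho 0) {rho | 0 < rho.im} :=
    ((h2.sub (h1.const_mul _)).const_mul _).sub (h1.const_mul _)
  exact h3.congr fun rho hrho => jostMatrix_eq hQ (upper_half_subset_Omega hrho) A h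

omit hQ in
lemma differentiableAt_matrix_inv {B : Mat n} (hB : B.det ≠ 0) :
    DifferentiableAt ℂ (fun B : Mat n => B⁻¹) B := by
  have h1 : IsUnit B := (Matrix.isUnit_iff_isUnit_det B).2 (isUnit_iff_ne_zero.2 hB)
  have h2 := differentiableAt_inverse (𝕜 := ℂ) h1
  refine h2.congr_of_eventuallyEq (Eventually.of_forall fun C => ?_)
  exact Matrix.nonsing_inv_eq_ringInverse C

lemma weylMatrix_continuousOn (A h : Mat n) : ContinuousOn (weylMatrix Q A h)
    {rho | rho ∈ Omega ∧ (jostMatrix Q A h rho).det ≠ 0} := by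
  set s := {rho | rho ∈ Omega ∧ (jostMatrix Q A h rho).det ≠ 0}
  have hs : s ⊆ Omega := fun rho hrho => hrho.1
  have h1 := (jostU_continuousOn_param hQ (le_refl 0)).mono hs
  have h2 := (jostV_continuousOn_param hQ (le_refl 0)).mono hs
  have h3 := (jostMatrix_continuousOn hQ A h).mono hs
  have h4 : ContinuousOn (fun rho => (A * jostU Q rho 0 + perp A * jostV Q rho 0) *
      (jostMatrix Q A h rho)⁻¹) s := by
    refine ((continuousOn_const.mul h1).add (continuousOn_const.mul h2)).mul fun rho hrho => ?_
    exact (differentiableAt_matrix_inv hrho.2).continuousAt.comp_continuousWithinAt (h3 rho hrho)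
  exact h4.congr fun rho hrho => weylMatrix_eq hQ hrho.1 A h

lemma weylMatrix_differentiableOn (A h : Mat n) : DifferentiableOn ℂ (weylMatrix Q A h)
    {rho | 0 < rho.im ∧ (jostMatrix Q A h rho).det ≠ 0} := by
  set s := {rho : ℂ | 0 < rho.im ∧ (jostMatrix Q A h rho).det ≠ 0}
  have hs : s ⊆ {rho | 0 < rho.im} := fun rho hrho => hrho.1
  have h1 := (jostU_differentiableOn_param hQ (le_refl 0)).mono hs
  have h2 := (jostV_differentiableOn_param hQ (le_refl 0)).mono hs
  have h3 := (jostMatrix_differentiableOn hQ A h).mono hs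
  have h4 : DifferentiableOn ℂ (fun rho => (A * jostU Q rho 0 + perp A * jostV Q rho 0) *
      (jostMatrix Q A h rho)⁻¹) s := by
    refine ((h1.const_mul _).add (h2.const_mul _)).mul fun rho hrho => ?_
    exact (differentiableAt_matrix_inv hrho.2).comp_differentiableWithinAt rho (h3 rho hrho)
  exact h4.congr fun rho hrho => weylMatrix_eq hQ (upper_half_subset_Omega hrho.1) A h

omit hQ in
lemma continuous_det_mat : Continuous fun B : Mat n => B.det := by
  simp only [Matrix.det_apply]
  refine continuous_finsetSum _ fun σ _ => Continuous.const_smul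
    (continuous_finsetProd _ fun i _ => ?_) _
  exact ((Matrix.entryLinearMap ℂ ℂ (σ i) i).toContinuousLinearMap : Mat n →L[ℂ] ℂ).continuous

end Regularity

/-- The points of `Omega` at which both Weyl matrices are regular. -/
def regularSet (Q Qt : ℝ → Mat n) (A h ht : Mat n) : Set ℂ :=
  {rho | rho ∈ Omega ∧ (jostMatrix Q A h rho).det * (jostMatrix Qt A ht rho).det ≠ 0}

/-- The factor `φ (M - M̃)` of the integrand. -/
def weylFactor (Q Qt : ℝ → Mat n) (A h ht : Mat n) (x : ℝ) (rho : ℂ) : Mat n :=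
  (ivpSol Q A (perp A + h) (rho ^ 2) x).1 * (weylMatrix Q A h rho - weylMatrix Qt A ht rho)

/-- The integrand `φ r̃`. -/
def gammaIntegrand (Q Qt : ℝ → Mat n) (A h ht : Mat n) (x : ℝ) (lam rho : ℂ) : Mat n :=
  weylFactor Q Qt A h ht x rho * ivpKernel Qt A ht x lam (rho ^ 2)

/-! ### Bounds for the integrand, uniform for bounded lam. -/

section Integrand

variable (hQ : IntegrableOn Q (Ioi 0)) (hQt : IntegrableOn Qt (Ioi 0)) {x : ℝ} (hx : 0 ≤ x)
include hQ hQt hx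

lemma weylFactor_continuousOn :
    ContinuousOn (weylFactor Q Qt A h ht x) (regularSet Q Qt A h ht) := by
  have h1 : ContinuousOn (weylMatrix Q A h) (regularSet Q Qt A h ht) :=
    (weylMatrix_continuousOn hQ A h).mono fun _ hrho => ⟨hrho.1, left_ne_zero_of_mul hrho.2⟩
  have h2 : ContinuousOn (weylMatrix Qt A ht) (regularSet Q Qt A h ht) :=
    (weylMatrix_continuousOn hQt A ht).mono fun _ hrho => ⟨hrho.1, right_ne_zero_of_mul hrho.2⟩
  have h3 := (ivpSol_differentiable (intervalIntegrable_of_integrableOn hQ) A (perp A + h)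
    hx).continuous.fst.comp (continuous_pow 2)
  exact h3.continuousOn.mul (h1.sub h2)

lemma gammaIntegrand_continuousOn (lam : ℂ) :
    ContinuousOn (gammaIntegrand Q Qt A h ht x lam) (regularSet Q Qt A h ht) :=
  (weylFactor_continuousOn hQ hQt hx).mul
    ((ivpKernel_differentiable_right hQt hx lam).continuous.comp (continuous_pow 2)).continuousOn

lemma exists_bound_gammaIntegrand {K : Set ℂ} (hK : IsCompact K)
    (hKr : K ⊆ regularSet Q Qt A h ht) (B : ℝ) : ∃ C, ∀ lam : ℂ, ‖lam‖ ≤ B → ∀ rho ∈ K,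
      ‖gammaIntegrand Q Qt A h ht x lam rho‖ ≤ C := by
  obtain ⟨C₁, h1⟩ := hK.exists_bound_of_continuousOn ((weylFactor_continuousOn hQ hQt hx).mono hKr)
  obtain ⟨C₂, h2⟩ := hK.exists_bound_of_continuousOn (continuous_pow 2 : Continuous
    fun z : ℂ => z ^ 2).continuousOn
  obtain ⟨C₃, h3⟩ := exists_bound_ivpKernel (A := A) (h := ht) hQt hx (max B C₂)
  refine ⟨C₁ * C₃, fun lam hlam rho hrho => (norm_mul_le _ _).trans ?_⟩
  exact mul_le_mul (h1 rho hrho) (h3 lam _ (hlam.trans (le_max_left _ _))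
    ((h2 rho hrho).trans (le_max_right _ _))) (norm_nonneg _) ((norm_nonneg _).trans (h1 rho hrho))

/-- One factor 1/rho comes from `weyl_difference_asymptotics`, whose exponentials have modulus 1 on
the real axis, and 1/rho² comes from 1/(lam - rho²) in the Wronskian form of the kernel. -/
lemma gammaIntegrand_far (H : IsBoundaryData A h) (Ht : IsBoundaryData A ht) (B : ℝ) :
    ∃ R > 0, ∃ C, ∀ lam : ℂ, ‖lam‖ ≤ B → ∀ rho ∈ Omega, rho.im = 0 → R ≤ ‖rho‖ →
      ‖gammaIntegrand Q Qt A h ht x lam rho‖ ≤ C * (‖rho‖ ^ 3)⁻¹ := by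
  obtain ⟨hG1, hG2⟩ := weyl_difference_asymptotics hQ hQt H Ht hx
  obtain ⟨C₁, h1⟩ := hG1.bound
  obtain ⟨C₂, h2⟩ := hG2.bound
  obtain ⟨C₀, h0⟩ := exists_bound_ivpSol (intervalIntegrable_of_integrableOn hQt) A (perp A + ht)
    B hx
  have hev := h1.and h2
  rw [farFilter, eventually_inf_principal, eventually_comap] at hev
  obtain ⟨R₀, hR₀⟩ := eventually_atTop.1 hev
  -- The second threshold forces |lam - rho²| ≥ |rho|²/2 for all |lam| ≤ B; this is also the source
  -- of the factor 2.
  refine ⟨max R₀ (2 * |B| + 2), lt_max_of_lt_right (by positivity), 2 * (C₂ * C₀ + C₁ * C₀),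
    fun lam hlam rho hrho him hR => ?_⟩
  obtain ⟨e1, e2⟩ := hR₀ ‖rho‖ ((le_max_left _ _).trans hR) rho rfl hrho
  have hexp : ‖Complex.exp (Complex.I * rho * x)‖ = 1 := by rw [norm_cexp_I_mul, him]; simp
  rw [norm_smul, norm_smul, hexp, one_mul, one_mul, norm_inv] at e1 e2
  have hr1 : 2 * |B| + 2 ≤ ‖rho‖ := (le_max_right _ _).trans hR
  have hB0 := abs_nonneg B
  have hrpos : 0 < ‖rho‖ := by linarith
  have hsub : ‖rho‖ ^ 2 / 2 ≤ ‖lam - rho ^ 2‖ := by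
    have k1 := norm_sub_norm_le (rho ^ 2) lam
    rw [norm_sub_rev, norm_pow] at k1
    have k2 : ‖lam‖ ≤ |B| := hlam.trans (le_abs_self B)
    nlinarith
  have hne : lam - rho ^ 2 ≠ 0 := norm_pos_iff.1 (lt_of_lt_of_le (by positivity) hsub)
  have hl := h0 lam hlam x (right_mem_Icc.2 hx)
  have hl1 := (norm_fst_le _).trans hl
  have hl2 := (norm_snd_le _).trans hl
  have hform : gammaIntegrand Q Qt A h ht x lam rho = (lam - rho ^ 2)⁻¹ •
      (weylFactor Q Qt A h ht x rho * (adjIvpSol Qt A (perp A + ht) (rho ^ 2) x).2 *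
        (ivpSol Qt A (perp A + ht) lam x).1 -
      weylFactor Q Qt A h ht x rho * (adjIvpSol Qt A (perp A + ht) (rho ^ 2) x).1 *
        (ivpSol Qt A (perp A + ht) lam x).2) := by
    rw [gammaIntegrand, mul_assoc (weylFactor _ _ _ _ _ _ _),
      mul_assoc (weylFactor _ _ _ _ _ _ _), ← mul_sub, ← ivpKernel_formula hQt hx Ht lam,
      mul_smul_comm, inv_smul_smul₀ hne]
  rw [hform, norm_smul, norm_inv]
  have hC1 : 0 ≤ C₁ * ‖rho‖⁻¹ := (norm_nonneg _).trans e1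
  have hC2 : 0 ≤ C₂ * ‖rho‖⁻¹ := (norm_nonneg _).trans e2
  have hC0 : 0 ≤ C₀ := (norm_nonneg _).trans hl
  have hnum : ‖weylFactor Q Qt A h ht x rho * (adjIvpSol Qt A (perp A + ht) (rho ^ 2) x).2 *
        (ivpSol Qt A (perp A + ht) lam x).1 -
      weylFactor Q Qt A h ht x rho * (adjIvpSol Qt A (perp A + ht) (rho ^ 2) x).1 *
        (ivpSol Qt A (perp A + ht) lam x).2‖ ≤
      C₂ * ‖rho‖⁻¹ * C₀ + C₁ * ‖rho‖⁻¹ * C₀ :=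
    (norm_sub_le _ _).trans (add_le_add
      ((norm_mul_le _ _).trans (mul_le_mul e2 hl1 (norm_nonneg _) hC2))
      ((norm_mul_le _ _).trans (mul_le_mul e1 hl2 (norm_nonneg _) hC1)))
  calc _ ≤ (‖rho‖ ^ 2 / 2)⁻¹ * (C₂ * ‖rho‖⁻¹ * C₀ + C₁ * ‖rho‖⁻¹ * C₀) :=
        mul_le_mul (inv_anti₀ (by positivity) hsub) hnum (norm_nonneg _) (by positivity)
    _ = _ := by field_simp

/-- The bound far out is extended to all of the cut by compactness: where |rho| < R a constant bound
C₂ is at most C₂ R³/|rho|³. -/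
lemma gammaIntegrand_real (H : IsBoundaryData A h) (Ht : IsBoundaryData A ht) {a : ℝ}
    (ha : 0 < a) (hreg : ∀ rho : ℂ, rho.im = 0 → a ≤ ‖rho‖ ^ 2 → rho ∈ regularSet Q Qt A h ht)
    (B : ℝ) : ∃ C, ∀ lam : ℂ, ‖lam‖ ≤ B → ∀ rho : ℂ, rho.im = 0 → a ≤ ‖rho‖ ^ 2 →
      ‖gammaIntegrand Q Qt A h ht x lam rho‖ ≤ C * (‖rho‖ ^ 3)⁻¹ := by
  obtain ⟨R, hR, C₁, h1⟩ := gammaIntegrand_far (x := x) hQ hQt hx H Ht B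
  have hK : IsCompact {rho : ℂ | ‖rho‖ ≤ R ∧ rho.im = 0 ∧ a ≤ ‖rho‖ ^ 2} := by
    refine (isCompact_closedBall (0 : ℂ) R).of_isClosed_subset ?_ fun rho hrho => by
      simpa using hrho.1
    exact (isClosed_le continuous_norm continuous_const).inter
      ((isClosed_eq Complex.continuous_im continuous_const).inter
        (isClosed_le continuous_const (continuous_norm.pow 2)))
  obtain ⟨C₂, h2⟩ := exists_bound_gammaIntegrand (x := x) hQ hQt hx hK
    (fun rho hrho => hreg rho hrho.2.1 hrho.2.2) B
  refine ⟨max C₁ (C₂ * R ^ 3), fun lam hlam rho him ha' => ?_⟩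
  have hpos : 0 < ‖rho‖ := by
    by_contra hcon
    have : ‖rho‖ = 0 := le_antisymm (not_lt.1 hcon) (norm_nonneg _)
    rw [this] at ha'
    norm_num at ha'
    linarith
  by_cases hle : R ≤ ‖rho‖
  · refine (h1 lam hlam rho (hreg rho him ha').1 him hle).trans ?_
    gcongr
    exact le_max_left _ _
  · have hle' := (not_le.1 hle).le
    have k := h2 lam hlam rho ⟨hle', him, ha'⟩
    have hC2 : 0 ≤ C₂ := (norm_nonneg _).trans k
    calc _ ≤ C₂ := k
      _ = C₂ * ‖rho‖ ^ 3 * (‖rho‖ ^ 3)⁻¹ := by field_simp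
      _ ≤ C₂ * R ^ 3 * (‖rho‖ ^ 3)⁻¹ := by gcongr
      _ ≤ _ := by gcongr; exact le_max_right _ _

omit hQ in
-- The integrand depends on lam only through the entire kernel, so domination locally uniform in lam
-- suffices. Used for the two sides of the cut and for the loop alike.
lemma gammaIntegrand_integral_entire {ν : Measure ℝ} {p w : ℝ → ℂ}
    (hm : ∀ lam, AEStronglyMeasurable
      (fun s => w s • gammaIntegrand Q Qt A h ht x lam (p s)) ν)
    (hb : ∀ B : ℝ, ∃ g : ℝ → ℝ, Integrable g ν ∧ ∀ᵐ s ∂ν, ∀ lam : ℂ, ‖lam‖ ≤ B →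
      ‖w s • gammaIntegrand Q Qt A h ht x lam (p s)‖ ≤ g s) :
    (∀ lam, Integrable (fun s => w s • gammaIntegrand Q Qt A h ht x lam (p s)) ν) ∧
    Differentiable ℂ fun lam => ∫ s, w s • gammaIntegrand Q Qt A h ht x lam (p s) ∂ν := by
  constructor
  · intro lam
    obtain ⟨g, hg, hbd⟩ := hb ‖lam‖
    exact hg.mono' (hm lam) (hbd.mono fun s hs => hs lam le_rfl)
  · rw [← differentiableOn_univ]
    refine differentiableOn_integral isOpen_univ (fun lam _ => hm lam) (ae_of_all _ fun s => ?_)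
      fun lam₀ _ => ?_
    · exact (((ivpKernel_differentiable_left hQt hx (p s ^ 2)).const_mul
        (weylFactor Q Qt A h ht x (p s))).const_smul (w s)).differentiableOn
    · obtain ⟨g, hg, hbd⟩ := hb (‖lam₀‖ + 1)
      refine ⟨1, one_pos, g, hg, hbd.mono fun s hs lam hlam => hs lam ?_⟩
      have h1 := mem_ball_iff_norm.1 hlam.1
      linarith [norm_le_norm_add_norm_sub' lam lam₀]

end Integrand

end MatrixSchrodinger

namespace MatrixSchrodinger

open Filter Asymptotics

variable {n : ℕ} {Q Qt : ℝ → Mat n} {A h ht : Mat n}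

/-! ### Absolute convergence and entire dependence on lam. -/

section Encircling

variable {c : ℝ → ℂ} {a : ℝ}
  (hc : IsEncircling c a (Lam Q A h ∪ Lam Qt A ht ∪ {0}))

lemma zero_mem_excluded : (0 : ℂ) ∈ Lam Q A h ∪ Lam Qt A ht ∪ {0} := Or.inr (mem_singleton 0)

lemma mem_regularSet {rho : ℂ} (hrho : rho ∈ Omega) (h1 : rho ^ 2 ∉ Lam Q A h ∪ Lam Qt A ht) :
    rho ∈ regularSet Q Qt A h ht :=
  ⟨hrho, mul_ne_zero (fun h => h1 (Or.inl ⟨rho, hrho, h, rfl⟩))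
    fun h => h1 (Or.inr ⟨rho, hrho, h, rfl⟩)⟩

include hc

/-- No singular point lies on the cut from a on: the curve winds once around singular points but not
around points beyond a, and a itself is on the curve. -/
lemma IsEncircling.mem_regularSet_of_real {rho : ℂ} (him : rho.im = 0) (ha : a ≤ ‖rho‖ ^ 2) :
    rho ∈ regularSet Q Qt A h ht := by
  have h1 : rho ^ 2 = ((‖rho‖ ^ 2 : ℝ) : ℂ) := by
    have : rho = (rho.re : ℂ) := Complex.ext rfl (by simpa using him)
    rw [this, Complex.norm_real, Real.norm_eq_abs, sq_abs]
    push_cast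
    rfl
  have hpos := hc.pos
  refine mem_regularSet ⟨him.ge, ?_⟩ fun hmem => ?_
  · rintro rfl
    norm_num at ha
    linarith
  · obtain ⟨h2, h3⟩ := hc.encircles (rho ^ 2) (Or.inl hmem)
    rw [h1] at h2 h3
    rcases ha.eq_or_lt with h4 | h4
    · exact h2 ⟨0, left_mem_Icc.2 zero_le_one, by rw [hc.start, h4]⟩
    · rw [hc.winding_eq_zero h4] at h3
      exact zero_ne_one h3

lemma IsEncircling.lift_mem_regularSet {s : ℝ} (hs : s ∈ Icc (0 : ℝ) 1) :
    (hc.lift zero_mem_excluded).path s ∈ regularSet Q Qt A h ht := by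
  refine mem_regularSet (hc.lift_mem_Omega _ hs) fun hmem => ?_
  rw [hc.lift_sq _ hs] at hmem
  exact (hc.encircles _ (Or.inl hmem)).1 ⟨s, hs, rfl⟩

lemma IsEncircling.ae_upperSqrt_eq : ∀ᵐ s ∂volume, s ∈ uIoc (0 : ℝ) 1 →
    upperSqrt (c s) = (hc.lift zero_mem_excluded).path s := by
  filter_upwards [compl_mem_ae_iff.2 (measure_singleton (1 : ℝ))] with s hs1 hs
  rw [uIoc_of_le zero_le_one] at hs
  exact hc.upperSqrt_eq _ ⟨hs.1, lt_of_le_of_ne hs.2 hs1⟩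

lemma IsEncircling.gammaIntegral_eq (F : ℂ → Mat n) : gammaIntegral c a F =
    -(∫ t in Ioi a, F (Real.sqrt t : ℂ)) +
    (∫ s in (0 : ℝ)..1, deriv c s • F ((hc.lift zero_mem_excluded).path s)) +
    ∫ t in Ioi a, F (-(Real.sqrt t : ℂ)) := by
  have : (∫ s in (0 : ℝ)..1, deriv c s • F (upperSqrt (c s))) =
      ∫ s in (0 : ℝ)..1, deriv c s • F ((hc.lift zero_mem_excluded).path s) :=
    intervalIntegral.integral_congr_ae
      (hc.ae_upperSqrt_eq.mono fun s hs hs' => by rw [hs hs'])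
  rw [gammaIntegral, this]

lemma IsEncircling.gammaIntegrable_of {F : ℂ → Mat n}
    (h1 : IntervalIntegrable (fun s => deriv c s • F ((hc.lift zero_mem_excluded).path s)) volume 0 1)
    (h2 : IntegrableOn (fun t : ℝ => F (Real.sqrt t : ℂ)) (Ioi a))
    (h3 : IntegrableOn (fun t : ℝ => F (-(Real.sqrt t : ℂ))) (Ioi a)) : GammaIntegrable c a F := by
  refine ⟨h1.congr_ae ((ae_restrict_iff' measurableSet_uIoc).2 ?_), h2, h3⟩
  exact hc.ae_upperSqrt_eq.mono fun s hs hs' => by simp only [hs hs']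

end Encircling

section Entire

variable (hQ : IntegrableOn Q (Ioi 0)) (hQt : IntegrableOn Qt (Ioi 0)) (H : IsBoundaryData A h)
  (Ht : IsBoundaryData A ht) {c : ℝ → ℂ} {a : ℝ}
  (hc : IsEncircling c a (Lam Q A h ∪ Lam Qt A ht ∪ {0})) {x : ℝ} (hx : 0 ≤ x)
include hQ hQt H Ht hc hx

/-- The part of the integral along one side of the cut converges and is entire in `lam`. -/
lemma gammaIntegrand_ray {σ : ℂ} (hσ : σ = 1 ∨ σ = -1) :
    (∀ lam, IntegrableOn (fun t : ℝ => gammaIntegrand Q Qt A h ht x lam (σ * Real.sqrt t))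
      (Ioi a)) ∧ Differentiable ℂ fun lam =>
        ∫ t in Ioi a, gammaIntegrand Q Qt A h ht x lam (σ * Real.sqrt t) := by
  have hnorm : ∀ t : ℝ, ‖σ * (Real.sqrt t : ℂ)‖ = Real.sqrt t := by
    intro t
    rcases hσ with rfl | rfl <;> simp [abs_of_nonneg (Real.sqrt_nonneg t)]
  have him : ∀ t : ℝ, (σ * (Real.sqrt t : ℂ)).im = 0 := by
    intro t
    rcases hσ with rfl | rfl <;> simp
  have hle : ∀ t ∈ Ioi a, a ≤ ‖σ * (Real.sqrt t : ℂ)‖ ^ 2 := by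
    intro t ht
    rw [hnorm, Real.sq_sqrt (hc.pos.trans ht).le]
    exact (mem_Ioi.1 ht).le
  have key := gammaIntegrand_integral_entire (Q := Q) (h := h) (A := A) (ht := ht) hQt hx
    (ν := volume.restrict (Ioi a)) (p := fun t => σ * Real.sqrt t) (w := fun _ => 1)
    (fun lam => ?_) fun B => ?_
  · simp only [one_smul] at key
    exact key
  · simp only [one_smul]
    refine ContinuousOn.aestronglyMeasurable ?_ measurableSet_Ioi
    exact (gammaIntegrand_continuousOn hQ hQt hx lam).comp (by fun_prop)
      fun t ht => hc.mem_regularSet_of_real (him t) (hle t ht)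
  · obtain ⟨C, hC⟩ := gammaIntegrand_real (x := x) hQ hQt hx H Ht hc.pos
      (fun rho h1 h2 => hc.mem_regularSet_of_real h1 h2) B
    -- This is C/|rho|³ at rho = ±√t; the exponent -3/2 is integrable at infinity, and a > 0 keeps t
    -- away from 0.
    refine ⟨fun t => C * t ^ (-(3 / 2) : ℝ),
      (integrableOn_Ioi_rpow_of_lt (by norm_num) hc.pos).const_mul C, ?_⟩
    filter_upwards [ae_restrict_mem measurableSet_Ioi] with t ht lam hlam
    have h1 := hC lam hlam _ (him t) (hle t ht)
    have ht0 : 0 < t := hc.pos.trans ht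
    have h2 : (Real.sqrt t ^ 3)⁻¹ = t ^ (-(3 / 2) : ℝ) := by
      rw [Real.rpow_neg ht0.le, Real.sqrt_eq_rpow, ← Real.rpow_natCast, ← Real.rpow_mul ht0.le]
      norm_num
    rw [hnorm, h2] at h1
    simpa only [one_smul] using h1

omit H Ht in
lemma gammaIntegrand_loop :
    (∀ lam, IntervalIntegrable (fun s => deriv c s • gammaIntegrand Q Qt A h ht x lam
      ((hc.lift zero_mem_excluded).path s)) volume 0 1) ∧ Differentiable ℂ fun lam =>
        ∫ s in (0 : ℝ)..1, deriv c s • gammaIntegrand Q Qt A h ht x lam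
          ((hc.lift zero_mem_excluded).path s) := by
  have hcont := (hc.lift zero_mem_excluded).continuousOn
  have hInt : ∀ lam, IntervalIntegrable (fun s => deriv c s • gammaIntegrand Q Qt A h ht x lam
      ((hc.lift zero_mem_excluded).path s)) volume 0 1 := by
    intro lam
    refine hc.intervalIntegrable_deriv.smul_continuousOn ?_
    rw [uIcc_of_le zero_le_one]
    exact (gammaIntegrand_continuousOn hQ hQt hx lam).comp hcont
      fun s hs => hc.lift_mem_regularSet hs
  refine ⟨hInt, ?_⟩
  simp only [intervalIntegral.integral_of_le (zero_le_one (α := ℝ))]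
  refine (gammaIntegrand_integral_entire hQt hx (ν := volume.restrict (Ioc 0 1))
    (p := (hc.lift zero_mem_excluded).path) (w := deriv c)
    (fun lam => (hInt lam).1.aestronglyMeasurable) fun B => ?_).2
  obtain ⟨C, hC⟩ := exists_bound_gammaIntegrand (x := x) hQ hQt hx
    (isCompact_Icc.image_of_continuousOn hcont)
    (by rintro _ ⟨s, hs, rfl⟩; exact hc.lift_mem_regularSet hs) B
  refine ⟨fun s => ‖deriv c s‖ * C, hc.intervalIntegrable_deriv.1.norm.mul_const C, ?_⟩
  filter_upwards [ae_restrict_mem measurableSet_Ioc] with s hs lam hlam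
  rw [norm_smul]
  exact mul_le_mul_of_nonneg_left
    (hC lam hlam _ (mem_image_of_mem _ (Ioc_subset_Icc_self hs))) (norm_nonneg _)

lemma gammaIntegrable_gammaIntegrand (lam : ℂ) :
    GammaIntegrable c a (gammaIntegrand Q Qt A h ht x lam) := by
  refine hc.gammaIntegrable_of ((gammaIntegrand_loop hQ hQt hc hx).1 lam) ?_ ?_
  · simpa only [one_mul] using
      (gammaIntegrand_ray hQ hQt H Ht hc hx (σ := 1) (Or.inl rfl)).1 lam
  · simpa only [neg_one_mul] using
      (gammaIntegrand_ray hQ hQt H Ht hc hx (σ := -1) (Or.inr rfl)).1 lam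

lemma gammaIntegral_differentiable :
    Differentiable ℂ fun lam => gammaIntegral c a (gammaIntegrand Q Qt A h ht x lam) := by
  simp only [hc.gammaIntegral_eq]
  have h1 := (gammaIntegrand_ray hQ hQt H Ht hc hx (σ := 1) (Or.inl rfl)).2
  have h2 := (gammaIntegrand_ray hQ hQt H Ht hc hx (σ := -1) (Or.inr rfl)).2
  simp only [one_mul] at h1
  simp only [neg_one_mul] at h2
  exact (h1.neg.add (gammaIntegrand_loop hQ hQt hc hx).2).add h2

end Entire

/-! ### The corrected integrand and its limit on large circles. -/

section Comparison

/-- The entire part of the comparison of the two problems. -/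
def entirePart (Q Qt : ℝ → Mat n) (A h ht : Mat n) (x : ℝ) (lam mu : ℂ) : Mat n :=
  ((ivpSol Q (-perp A) A mu x).1 * (adjIvpSol Qt A (perp A + ht) mu x).2 -
    (ivpSol Q A (perp A + h) mu x).1 * (adjIvpSol Qt (-perp A) A mu x).2) *
      (ivpSol Qt A (perp A + ht) lam x).1 -
  ((ivpSol Q (-perp A) A mu x).1 * (adjIvpSol Qt A (perp A + ht) mu x).1 -
    (ivpSol Q A (perp A + h) mu x).1 * (adjIvpSol Qt (-perp A) A mu x).1) *
      (ivpSol Qt A (perp A + ht) lam x).2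

/-- The integrand corrected by the entire part; it is small in the upper half-plane. -/
def decayingIntegrand (Q Qt : ℝ → Mat n) (A h ht : Mat n) (x : ℝ) (lam rho : ℂ) : Mat n :=
  gammaIntegrand Q Qt A h ht x lam rho + (lam - rho ^ 2)⁻¹ • entirePart Q Qt A h ht x lam (rho ^ 2)

variable (hQ : IntegrableOn Q (Ioi 0)) (hQt : IntegrableOn Qt (Ioi 0)) {x : ℝ} (hx : 0 ≤ x)
include hQt hx

/-- Inserting Φ = S + φ M and Φ̃* = S̃* + M̃ φ̃* splits Φ φ̃* - φ Φ̃* into φ (M - M̃) φ̃*, from the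
integrand, and S φ̃* - φ S̃*, from the entire part. -/
lemma decayingIntegrand_eq (Ht : IsBoundaryData A ht) {lam rho : ℂ} (hne : rho ^ 2 ≠ lam) :
    decayingIntegrand Q Qt A h ht x lam rho = (lam - rho ^ 2)⁻¹ •
      ((weylFun Q A h x rho * (adjIvpSol Qt A (perp A + ht) (rho ^ 2) x).2 -
        (ivpSol Q A (perp A + h) (rho ^ 2) x).1 * (adjWeylFun Qt A ht x rho).2) *
          (ivpSol Qt A (perp A + ht) lam x).1 -
      (weylFun Q A h x rho * (adjIvpSol Qt A (perp A + ht) (rho ^ 2) x).1 -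
        (ivpSol Q A (perp A + h) (rho ^ 2) x).1 * (adjWeylFun Qt A ht x rho).1) *
          (ivpSol Qt A (perp A + ht) lam x).2) := by
  have hne' : lam - rho ^ 2 ≠ 0 := sub_ne_zero.2 hne.symm
  have h1 : gammaIntegrand Q Qt A h ht x lam rho = (lam - rho ^ 2)⁻¹ •
      (weylFactor Q Qt A h ht x rho * ((adjIvpSol Qt A (perp A + ht) (rho ^ 2) x).2 *
        (ivpSol Qt A (perp A + ht) lam x).1 - (adjIvpSol Qt A (perp A + ht) (rho ^ 2) x).1 *
        (ivpSol Qt A (perp A + ht) lam x).2)) := by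
    rw [← ivpKernel_formula hQt hx Ht, mul_smul_comm, inv_smul_smul₀ hne', gammaIntegrand]
  rw [decayingIntegrand, h1, ← smul_add]
  congr 1
  simp only [entirePart, weylFactor, weylFun, adjWeylFun]
  noncomm_ring

include hQ

omit hQ in
-- At equal parameters the expression regroups as S ⟨φ̃*, φ̃⟩ - φ ⟨S̃*, φ̃⟩. Both Wronskians are
-- constant in x, with values 0 and I read off at 0.
lemma entirePart_self (Ht : IsBoundaryData A ht) (lam : ℂ) :
    entirePart Q Qt A h ht x lam lam = -(ivpSol Q A (perp A + h) lam x).1 := by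
  have hqt := intervalIntegrable_of_integrableOn hQt
  have h1 := ivpKernel_formula hQt hx Ht lam lam
  rw [sub_self, zero_smul] at h1
  have h2 := ((ivpSol_solvesWith hqt A (perp A + ht) lam).wronskian
    (adjIvpSol_solvesWith hQt (-perp A) A lam)).eq x hx
  rw [adjIvpSol_zero hQt, ivpSol_zero hqt] at h2
  have h3 : A * A - -perp A * (perp A + ht) = 1 := by
    rw [neg_mul, mul_add, Ht.perp_mul_perp, Ht.perp_mul_h, Ht.idem, ← add_perp A]
    abel
  simp only [sub_self, zero_smul, intervalIntegral.integral_zero, add_zero, h3] at h2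
  have h4 : entirePart Q Qt A h ht x lam lam = (ivpSol Q (-perp A) A lam x).1 *
      ((adjIvpSol Qt A (perp A + ht) lam x).2 * (ivpSol Qt A (perp A + ht) lam x).1 -
        (adjIvpSol Qt A (perp A + ht) lam x).1 * (ivpSol Qt A (perp A + ht) lam x).2) -
      (ivpSol Q A (perp A + h) lam x).1 *
      ((adjIvpSol Qt (-perp A) A lam x).2 * (ivpSol Qt A (perp A + ht) lam x).1 -
        (adjIvpSol Qt (-perp A) A lam x).1 * (ivpSol Qt A (perp A + ht) lam x).2) := by
    rw [entirePart]
    noncomm_ring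
  rw [h4, ← h1, h2]
  simp

lemma entirePart_differentiable (lam : ℂ) :
    Differentiable ℂ fun mu => entirePart Q Qt A h ht x lam mu := by
  have hq := intervalIntegrable_of_integrableOn hQ
  have h1 := ivpSol_differentiable hq (-perp A) A hx
  have h2 := ivpSol_differentiable hq A (perp A + h) hx
  have h3 := adjIvpSol_differentiable hQt A (perp A + ht) hx
  have h4 := adjIvpSol_differentiable hQt (-perp A) A hx
  exact (((h1.fst.mul h3.snd).sub (h2.fst.mul h4.snd)).mul_const _).sub
    (((h1.fst.mul h3.fst).sub (h2.fst.mul h4.fst)).mul_const _)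

lemma gammaIntegrand_differentiableOn (lam : ℂ) :
    DifferentiableOn ℂ (gammaIntegrand Q Qt A h ht x lam) {rho | 0 < rho.im ∧
      (jostMatrix Q A h rho).det * (jostMatrix Qt A ht rho).det ≠ 0} := by
  have h1 := (weylMatrix_differentiableOn hQ A h).mono
    (show {rho : ℂ | 0 < rho.im ∧ (jostMatrix Q A h rho).det * (jostMatrix Qt A ht rho).det ≠ 0} ⊆
      {rho | 0 < rho.im ∧ (jostMatrix Q A h rho).det ≠ 0} from
        fun _ hrho => ⟨hrho.1, left_ne_zero_of_mul hrho.2⟩)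
  have h2 := (weylMatrix_differentiableOn hQt A ht).mono
    (show {rho : ℂ | 0 < rho.im ∧ (jostMatrix Q A h rho).det * (jostMatrix Qt A ht rho).det ≠ 0} ⊆
      {rho | 0 < rho.im ∧ (jostMatrix Qt A ht rho).det ≠ 0} from
        fun _ hrho => ⟨hrho.1, right_ne_zero_of_mul hrho.2⟩)
  have h3 := (ivpSol_differentiable (intervalIntegrable_of_integrableOn hQ) A (perp A + h)
    hx).fst.comp (differentiable_pow (𝕜 := ℂ) (𝔸 := ℂ) 2)
  have h4 := (ivpKernel_differentiable_right (A := A) (h := ht) hQt hx lam).comp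
    (differentiable_pow (𝕜 := ℂ) (𝔸 := ℂ) 2)
  exact (h3.differentiableOn.mul (h1.sub h2)).mul h4.differentiableOn

lemma decayingIntegrand_differentiableOn (lam : ℂ) :
    DifferentiableOn ℂ (decayingIntegrand Q Qt A h ht x lam) {rho | 0 < rho.im ∧
      (jostMatrix Q A h rho).det * (jostMatrix Qt A ht rho).det * (rho ^ 2 - lam) ≠ 0} := by
  set s := {rho : ℂ | 0 < rho.im ∧
      (jostMatrix Q A h rho).det * (jostMatrix Qt A ht rho).det * (rho ^ 2 - lam) ≠ 0}
  have h1 : DifferentiableOn ℂ (gammaIntegrand Q Qt A h ht x lam) s :=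
    (gammaIntegrand_differentiableOn hQ hQt hx lam).mono fun _ hrho => ⟨hrho.1, left_ne_zero_of_mul hrho.2⟩
  have h2 : DifferentiableOn ℂ (fun rho : ℂ => (lam - rho ^ 2)⁻¹) s :=
    DifferentiableOn.inv (by fun_prop) fun rho hrho hz => right_ne_zero_of_mul hrho.2
      (by rw [← neg_sub, hz, neg_zero])
  have h3 : DifferentiableOn ℂ (fun rho => entirePart Q Qt A h ht x lam (rho ^ 2)) s :=
    ((entirePart_differentiable hQ hQt hx lam).comp
      (differentiable_pow (𝕜 := ℂ) (𝔸 := ℂ) 2)).differentiableOn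
  exact h1.add (h2.fun_smul h3)

lemma decayingIntegrand_continuousOn (lam : ℂ) :
    ContinuousOn (decayingIntegrand Q Qt A h ht x lam) {rho | rho ∈ Omega ∧
      (jostMatrix Q A h rho).det * (jostMatrix Qt A ht rho).det * (rho ^ 2 - lam) ≠ 0} := by
  set s := {rho : ℂ | rho ∈ Omega ∧
      (jostMatrix Q A h rho).det * (jostMatrix Qt A ht rho).det * (rho ^ 2 - lam) ≠ 0}
  have h1 : ContinuousOn (gammaIntegrand Q Qt A h ht x lam) s :=
    (gammaIntegrand_continuousOn hQ hQt hx lam).mono fun _ hrho => ⟨hrho.1, left_ne_zero_of_mul hrho.2⟩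
  have h2 : ContinuousOn (fun rho : ℂ => (lam - rho ^ 2)⁻¹) s :=
    ContinuousOn.inv₀ (by fun_prop) fun rho hrho hz => right_ne_zero_of_mul hrho.2
      (by rw [← neg_sub, hz, neg_zero])
  have h3 : ContinuousOn (fun rho => entirePart Q Qt A h ht x lam (rho ^ 2)) s :=
    ((entirePart_differentiable hQ hQt hx lam).continuous.comp
      (continuous_pow 2)).continuousOn
  exact h1.add (h2.fun_smul h3)

/-- The factor mu/(lam - mu) tends to -1 and the comparison matrices to -I and 0, so only φ̃(lam) is
left. The factor i rho² is dmu/dθ on the circle. -/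
lemma tendsto_decayingIntegrand (H : IsBoundaryData A h) (Ht : IsBoundaryData A ht) (lam : ℂ) :
    Tendsto (fun rho => (Complex.I * rho ^ 2) • decayingIntegrand Q Qt A h ht x lam rho) farFilter
      (nhds (Complex.I • (ivpSol Qt A (perp A + ht) lam x).1)) := by
  have h1 := (comparison_asymptotics_fst hQ hQt H Ht hx).trans_tendsto tendsto_inv_farFilter
  have h2 := (comparison_asymptotics_snd hQ hQt H Ht hx).trans_tendsto tendsto_inv_farFilter
  have h3 := ((h1.sub_const 1).mul_const (ivpSol Qt A (perp A + ht) lam x).1).sub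
    (h2.mul_const (ivpSol Qt A (perp A + ht) lam x).2)
  have h4 : Tendsto (fun rho : ℂ => (lam * rho⁻¹ ^ 2 - 1)⁻¹) farFilter
      (nhds (lam * 0 ^ 2 - 1)⁻¹) :=
    (((tendsto_inv_farFilter.pow 2).const_mul lam).sub_const 1).inv₀ (by simp)
  have h5 := (h4.const_mul Complex.I).smul h3
  have h6 : (Complex.I * (lam * 0 ^ 2 - 1)⁻¹) • ((0 - 1) * (ivpSol Qt A (perp A + ht) lam x).1 -
      0 * (ivpSol Qt A (perp A + ht) lam x).2) =
      Complex.I • (ivpSol Qt A (perp A + ht) lam x).1 := by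
    norm_num
  rw [h6] at h5
  refine h5.congr' ?_
  filter_upwards [eventually_le_norm (‖lam‖ + 1)] with rho hrho
  have hlt : ‖lam‖ < ‖rho ^ 2‖ := by
    rw [norm_pow]
    nlinarith [norm_nonneg lam]
  have hne : rho ^ 2 ≠ lam := fun h => by rw [h] at hlt; exact lt_irrefl _ hlt
  have hrho0 : rho ≠ 0 := norm_pos_iff.1 (by linarith [norm_nonneg lam])
  have hsub : lam - rho ^ 2 ≠ 0 := sub_ne_zero.2 hne.symm
  have hsc : Complex.I * (lam * rho⁻¹ ^ 2 - 1)⁻¹ = Complex.I * rho ^ 2 * (lam - rho ^ 2)⁻¹ := by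
    have : lam * rho⁻¹ ^ 2 - 1 = (lam - rho ^ 2) * (rho ^ 2)⁻¹ := by field_simp
    rw [this, mul_inv, inv_inv]
    ring
  rw [decayingIntegrand_eq hQt hx Ht hne, smul_smul, hsc, add_sub_cancel_right]

end Comparison

/-- Convergence along `farFilter` is uniform over the closed arc, endpoints on the real axis
included, so the limit passes under the integral. -/
lemma tendsto_arcPiece {E : Type*} [NormedAddCommGroup E] [NormedSpace ℂ E] [CompleteSpace E]
    {ψ : ℂ → E} {v : E} (hψ : Tendsto ψ farFilter (nhds v))
    (hInt : ∀ᶠ R in atTop, IntervalIntegrable (fun θ => ψ ((arcPiece R).path θ)) volume 0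
      (2 * Real.pi)) :
    Tendsto (fun R => ∫ θ in (0 : ℝ)..2 * Real.pi, ψ ((arcPiece R).path θ)) atTop
      (nhds ((2 * Real.pi : ℝ) • v)) := by
  rw [Metric.tendsto_nhds]
  intro ε hε
  have hπ := Real.two_pi_pos
  have h1 := (Metric.tendsto_nhds.1 hψ) (ε / (2 * (2 * Real.pi))) (by positivity)
  rw [farFilter, eventually_inf_principal, eventually_comap] at h1
  filter_upwards [h1, hInt, eventually_gt_atTop 0] with R hR hi hR0
  have h2 : (2 * Real.pi : ℝ) • v = ∫ _ in (0 : ℝ)..2 * Real.pi, v := by simp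
  rw [h2, dist_eq_norm, ← intervalIntegral.integral_sub hi intervalIntegrable_const]
  have h3 : ‖∫ θ in (0 : ℝ)..2 * Real.pi, (ψ ((arcPiece R).path θ) - v)‖ ≤
      ε / (2 * (2 * Real.pi)) * |2 * Real.pi - 0| := by
    refine intervalIntegral.norm_integral_le_of_norm_le_const fun θ hθ => ?_
    rw [uIoc_of_le hπ.le] at hθ
    rw [← dist_eq_norm]
    exact (hR _ (norm_arcPiece hR0.le θ) (arcPiece_mem_Omega hR0 (Ioc_subset_Icc_self hθ))).le
  rw [sub_zero, abs_of_pos hπ] at h3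
  refine h3.trans_lt ?_
  have : ε / (2 * (2 * Real.pi)) * (2 * Real.pi) = ε / 2 := by field_simp
  rw [this]
  linarith

/-- Cauchy's formula for the curve `c`. -/
lemma IsEncircling.cauchy_formula {E : Type*} [NormedAddCommGroup E] [NormedSpace ℂ E]
    [CompleteSpace E] {c : ℝ → ℂ} {a : ℝ} {S : Set ℂ} (hc : IsEncircling c a S) {lam : ℂ}
    (hlam : lam ∉ c '' Icc 0 1) (hw : winding c lam = 1) {f : ℂ → E} (hf : Differentiable ℂ f) :
    (∫ s in (0 : ℝ)..1, deriv c s • (lam - c s)⁻¹ • f (c s)) =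
      -((2 * Real.pi * Complex.I : ℂ) • f lam) := by
  have hcont := hf.continuous.continuousOn (s := contourImage fun _ : Unit => hc.piece)
  have hlam' : lam ∉ contourImage fun _ : Unit => hc.piece := by rwa [hc.contourImage_piece]
  have hci := continuousOn_inv_sub hlam'
  have h1 := hc.isCycle_piece.contourIntegral_dslope_eq_zero isOpen_univ (subset_univ _)
    hf.differentiableOn (fun z hz => absurd (mem_univ z) hz) (mem_univ lam)
  have h2 : EqOn (dslope f lam) (fun w => -((lam - w)⁻¹ • f w) - (w - lam)⁻¹ • f lam)
      (contourImage fun _ : Unit => hc.piece) := by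
    intro w hw
    have hne : w ≠ lam := fun h => hlam' (h ▸ hw)
    simp only
    rw [dslope_of_ne _ hne, slope_def_module, smul_sub, ← neg_smul, ← inv_neg, neg_sub]
  have hci' : ContinuousOn (fun w => -((lam - w)⁻¹ • f w))
      (contourImage fun _ : Unit => hc.piece) := by
    refine (hci.fun_smul hcont).congr fun w _ => ?_
    rw [← neg_smul, ← inv_neg, neg_sub]
  rw [contourIntegral_congr h2, contourIntegral_sub hci' (hci.fun_smul continuousOn_const),
    contourIntegral_smul_const, hc.index_piece, hw, mul_one, hc.contourIntegral_piece] at h1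
  simp only [smul_neg, intervalIntegral.integral_neg] at h1
  rw [sub_eq_zero] at h1
  rw [← h1, neg_neg]

end MatrixSchrodinger

namespace MatrixSchrodinger

open Filter Asymptotics

variable {n : ℕ} {Q Qt : ℝ → Mat n} {A h ht : Mat n}

/-! ### Cauchy's theorem on the keyhole and the main identity. -/

section Main

variable (hQ : IntegrableOn Q (Ioi 0)) (hQt : IntegrableOn Qt (Ioi 0)) (H : IsBoundaryData A h)
  (Ht : IsBoundaryData A ht) {c : ℝ → ℂ} {a : ℝ}
  (hc : IsEncircling c a (Lam Q A h ∪ Lam Qt A ht ∪ {0})) {x : ℝ} (hx : 0 ≤ x)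
include hQ hQt H Ht hc hx

omit hc hx in
lemma eventually_regular (lam : ℂ) : ∀ᶠ R : ℝ in atTop, 0 < R ∧ a ≤ R ^ 2 ∧ ‖lam‖ < R ^ 2 ∧
    ∀ rho ∈ Omega, R ≤ ‖rho‖ → rho ∈ regularSet Q Qt A h ht := by
  have h1 := (jost_asymptotics hQ H).1.and (jost_asymptotics hQt Ht).1
  rw [farFilter, eventually_inf_principal, eventually_comap] at h1
  obtain ⟨R₀, hR₀⟩ := eventually_atTop.1 h1
  filter_upwards [eventually_ge_atTop R₀, eventually_gt_atTop 0,
    (tendsto_pow_atTop (α := ℝ) two_ne_zero).eventually_ge_atTop a,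
    (tendsto_pow_atTop (α := ℝ) two_ne_zero).eventually_gt_atTop ‖lam‖] with R k1 k2 k3 k4
  refine ⟨k2, k3, k4, fun rho hrho hR => ⟨hrho, ?_⟩⟩
  obtain ⟨e1, e2⟩ := hR₀ ‖rho‖ (k1.trans hR) rho rfl hrho
  exact mul_ne_zero e1 e2

omit H Ht hx hQ hQt in
-- Each condition on lam keeps the pole off one part of the contour: Re lam < 0 off the cut, |lam| <
-- |c s| off the curve, |lam| < R² off the circle.
lemma IsEncircling.keyhole_subset {lam : ℂ} (hre : lam.re < 0)
    (hlam : ∀ s ∈ Icc (0 : ℝ) 1, ‖lam‖ < ‖c s‖) {R : ℝ} (hR : 0 < R) (haR : a ≤ R ^ 2)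
    (hlR : ‖lam‖ < R ^ 2) (hreg : ∀ rho ∈ Omega, R ≤ ‖rho‖ → rho ∈ regularSet Q Qt A h ht) :
    contourImage (hc.keyhole zero_mem_excluded haR) ⊆ {rho | rho ∈ Omega ∧
      (jostMatrix Q A h rho).det * (jostMatrix Qt A ht rho).det * (rho ^ 2 - lam) ≠ 0} := by
  have hof : ∀ rho ∈ regularSet Q Qt A h ht, rho ^ 2 ≠ lam → rho ∈ {rho | rho ∈ Omega ∧
      (jostMatrix Q A h rho).det * (jostMatrix Qt A ht rho).det * (rho ^ 2 - lam) ≠ 0} :=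
    fun rho h1 h2 => ⟨h1.1, mul_ne_zero h1.2 (sub_ne_zero.2 h2)⟩
  have hreal : ∀ t ∈ Icc a (R ^ 2), (t : ℂ) ≠ lam := fun t ht h => by
    rw [← h, Complex.ofReal_re] at hre
    exact (hc.pos.trans_le ht.1).not_gt hre
  have hsq : ∀ t ∈ Icc a (R ^ 2), Real.sqrt t ^ 2 = t := fun t ht =>
    Real.sq_sqrt (hc.pos.trans_le ht.1).le
  refine hc.keyhole_forall _ haR (fun t ht => ⟨hof _ (hc.mem_regularSet_of_real (by simp) ?_) ?_,
    hof _ (hc.mem_regularSet_of_real (by simp) ?_) ?_⟩)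
    (fun s hs => hof _ (hc.lift_mem_regularSet hs) ?_) fun θ hθ => hof _ (hreg _
      (arcPiece_mem_Omega hR hθ) (norm_arcPiece hR.le θ).ge) ?_
  · rw [Complex.norm_real, Real.norm_eq_abs, sq_abs, hsq t ht]
    exact ht.1
  · rw [← Complex.ofReal_pow, hsq t ht]
    exact hreal t ht
  · rw [norm_neg, Complex.norm_real, Real.norm_eq_abs, sq_abs, hsq t ht]
    exact ht.1
  · rw [neg_sq, ← Complex.ofReal_pow, hsq t ht]
    exact hreal t ht
  · rw [hc.lift_sq _ hs]
    exact fun h => (hlam s hs).ne (by rw [h])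
  · intro h
    rw [← h, norm_pow, norm_arcPiece hR.le] at hlR
    exact lt_irrefl _ hlR

omit H Ht in
/-- Cauchy's theorem for the integrand corrected by the entire part. -/
lemma keyhole_decayingIntegrand {lam : ℂ} (hre : lam.re < 0)
    (hlam : ∀ s ∈ Icc (0 : ℝ) 1, ‖lam‖ < ‖c s‖) (hw : winding c lam = 1) {R : ℝ} (hR : 0 < R)
    (haR : a ≤ R ^ 2) (hlR : ‖lam‖ < R ^ 2)
    (hreg : ∀ rho ∈ Omega, R ≤ ‖rho‖ → rho ∈ regularSet Q Qt A h ht) :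
    contourIntegral (hc.keyhole zero_mem_excluded haR)
      (fun w => (2 * w) • decayingIntegrand Q Qt A h ht x lam w) = 0 := by
  have hsub := hc.keyhole_subset hre hlam hR haR hlR hreg
  have hf : ContinuousOn (fun rho => (jostMatrix Q A h rho).det * (jostMatrix Qt A ht rho).det *
      (rho ^ 2 - lam)) Omega :=
    ((continuous_det_mat.comp_continuousOn (jostMatrix_continuousOn hQ A h)).mul
      (continuous_det_mat.comp_continuousOn (jostMatrix_continuousOn hQt A ht))).mul (by fun_prop)
  have h2w : Differentiable ℂ fun w : ℂ => 2 * w := by fun_prop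
  refine (hc.isCycle_keyhole _ hR haR).cauchy_upper hf hsub
    (h2w.continuous.continuousOn.smul (decayingIntegrand_continuousOn hQ hQt hx lam))
    (h2w.differentiableOn.smul (decayingIntegrand_differentiableOn hQ hQt hx lam))
    fun k hk hfk => ?_
  have hkΩ := upper_half_subset_Omega hk
  have hkimg : k ∉ contourImage (hc.keyhole zero_mem_excluded haR) := fun h => (hsub h).2 hfk
  -- Either k is a zero of a Jost determinant, hence inside the circle by the choice of R and with
  -- encircled square, or k² = lam, which c also encircles.
  have hkind : ‖k‖ < R ∧ winding c (k ^ 2) = 1 := by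
    rcases mul_eq_zero.1 hfk with h0 | h0
    · refine ⟨?_, ?_⟩
      · by_contra hcon
        exact (hreg k hkΩ (not_lt.1 hcon)).2 h0
      · refine (hc.encircles _ (Or.inl ?_)).2
        rcases mul_eq_zero.1 h0 with h1 | h1
        · exact Or.inl ⟨k, hkΩ, h1, rfl⟩
        · exact Or.inr ⟨k, hkΩ, h1, rfl⟩
    · have hk2 : k ^ 2 = lam := sub_eq_zero.1 h0
      refine ⟨?_, by rw [hk2, hw]⟩
      rw [← hk2, norm_pow] at hlR
      exact lt_of_pow_lt_pow_left₀ 2 hR.le hlR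
  exact hc.keyhole_index _ hR haR hk hkind.1 hkimg hkind.2

/-- The main identity, for `lam` near the origin. -/
lemma gammaIntegral_eq_of_near_zero {lam : ℂ} (hre : lam.re < 0)
    (hlam : ∀ s ∈ Icc (0 : ℝ) 1, ‖lam‖ < ‖c s‖) :
    gammaIntegral c a (gammaIntegrand Q Qt A h ht x lam) = (2 * Real.pi * Complex.I : ℂ) •
      ((ivpSol Qt A (perp A + ht) lam x).1 - (ivpSol Q A (perp A + h) lam x).1) := by
  -- lam is closer to 0 than the curve is, so it has the same winding number as 0.
  have hw : winding c lam = 1 := by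
    have h1 := hc.isCycle_piece.index_eq (z := lam) (z₀ := 0) (by
      rw [hc.contourImage_piece]
      rintro _ ⟨s, hs, rfl⟩
      simpa using hlam s hs)
    rw [hc.index_piece, hc.index_piece, (hc.encircles 0 zero_mem_excluded).2] at h1
    exact mul_left_cancel₀ Complex.two_pi_I_ne_zero h1
  have hlimg : lam ∉ c '' Icc 0 1 := by
    rintro ⟨s, hs, h1⟩
    exact (hlam s hs).ne (by rw [h1])
  set E := entirePart Q Qt A h ht x lam with hE
  set G := gammaIntegrand Q Qt A h ht x lam with hG
  set F := decayingIntegrand Q Qt A h ht x lam with hF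
  set τ := hc.lift zero_mem_excluded with hτ
  have hEd : Differentiable ℂ E := entirePart_differentiable hQ hQt hx lam
  have hFeq : ∀ rho, F rho = G rho + (lam - rho ^ 2)⁻¹ • E (rho ^ 2) := fun rho => rfl
  have hloopE : (∫ s in (0 : ℝ)..1, deriv c s • (lam - c s)⁻¹ • E (c s)) =
      (2 * Real.pi * Complex.I : ℂ) • (ivpSol Q A (perp A + h) lam x).1 := by
    rw [hc.cauchy_formula hlimg hw hEd, hE, entirePart_self hQt hx Ht, smul_neg, neg_neg]
  have hloopEi : IntervalIntegrable (fun s => deriv c s • (lam - c s)⁻¹ • E (c s)) volume 0 1 := by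
    refine hc.intervalIntegrable_deriv.smul_continuousOn ?_
    rw [uIcc_of_le zero_le_one]
    exact ((continuousOn_const.sub hc.continuous).inv₀ fun s hs h0 =>
      hlimg ⟨s, hs, (sub_eq_zero.1 h0).symm⟩).smul (hEd.continuous.comp_continuousOn hc.continuous)
  have hloop : (∫ s in (0 : ℝ)..1, deriv c s • F (τ.path s)) =
      (∫ s in (0 : ℝ)..1, deriv c s • G (τ.path s)) +
        (2 * Real.pi * Complex.I : ℂ) • (ivpSol Q A (perp A + h) lam x).1 := by
    rw [← hloopE, ← intervalIntegral.integral_add ((gammaIntegrand_loop hQ hQt hc hx).1 lam)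
      hloopEi]
    refine intervalIntegral.integral_congr fun s hs => ?_
    rw [uIcc_of_le zero_le_one] at hs
    simp only [hFeq, hτ, hc.lift_sq _ hs, smul_add, hG]
  -- The entire part depends on rho² only, so its contribution does not see σ and cancels between
  -- the two sides of the cut.
  have hray : ∀ σ : ℂ, σ = 1 ∨ σ = -1 → ∀ R : ℝ, a ≤ R ^ 2 →
      (∫ t in a..R ^ 2, F (σ * Real.sqrt t)) = (∫ t in a..R ^ 2, G (σ * Real.sqrt t)) +
        ∫ t in a..R ^ 2, (lam - t)⁻¹ • E t := by
    intro σ hσ R haR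
    have hσ2 : σ ^ 2 = 1 := by rcases hσ with rfl | rfl <;> norm_num
    have hsq : ∀ t ∈ Icc a (R ^ 2), (σ * (Real.sqrt t : ℂ)) ^ 2 = t := fun t ht => by
      rw [mul_pow, hσ2, one_mul, ← Complex.ofReal_pow, Real.sq_sqrt (hc.pos.trans_le ht.1).le]
    rw [← intervalIntegral.integral_add]
    · refine intervalIntegral.integral_congr fun t ht => ?_
      rw [uIcc_of_le haR] at ht
      simp only [hFeq, hsq t ht]
    · exact (intervalIntegrable_iff_integrableOn_Ioc_of_le haR).2
        (((gammaIntegrand_ray hQ hQt H Ht hc hx hσ).1 lam).mono_set Ioc_subset_Ioi_self)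
    · refine ContinuousOn.intervalIntegrable ?_
      rw [uIcc_of_le haR]
      refine ContinuousOn.smul (f := fun t : ℝ => (lam - (t : ℂ))⁻¹) ?_
        (hEd.continuous.comp Complex.continuous_ofReal).continuousOn
      refine ContinuousOn.inv₀ (by fun_prop) fun t ht h0 => ?_
      rw [sub_eq_zero.1 h0, Complex.ofReal_re] at hre
      exact (hc.pos.trans_le ht.1).not_gt hre
  have hfin : ∀ᶠ R : ℝ in atTop, (∫ θ in (0 : ℝ)..2 * Real.pi,
      (Complex.I * (arcPiece R).path θ ^ 2) • F ((arcPiece R).path θ)) =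
      -(∫ t in a..R ^ 2, G (Real.sqrt t : ℂ)) + (∫ s in (0 : ℝ)..1, deriv c s • G (τ.path s)) +
        (∫ t in a..R ^ 2, G (-(Real.sqrt t : ℂ))) +
        (2 * Real.pi * Complex.I : ℂ) • (ivpSol Q A (perp A + h) lam x).1 := by
    filter_upwards [eventually_regular (a := a) hQ hQt H Ht lam] with R ⟨hR, haR, hlR, hreg⟩
    have h1 := keyhole_decayingIntegrand hQ hQt hc hx hre hlam hw hR haR hlR hreg
    have r1 := hray 1 (Or.inl rfl) R haR
    have r2 := hray (-1) (Or.inr rfl) R haR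
    simp only [one_mul] at r1
    simp only [neg_one_mul] at r2
    rw [hc.keyhole_integral _ haR, ← hτ, hloop, r1, r2, sub_eq_zero] at h1
    rw [← h1]
    abel
  have harc := tendsto_arcPiece (tendsto_decayingIntegrand hQ hQt hx H Ht lam) (by
    filter_upwards [eventually_regular (a := a) hQ hQt H Ht lam] with R ⟨hR, haR, hlR, hreg⟩
    refine ContinuousOn.intervalIntegrable ?_
    rw [uIcc_of_le Real.two_pi_pos.le]
    have hp : ContinuousOn (arcPiece R).path (Icc 0 (2 * Real.pi)) := (arcPiece R).continuousOn
    refine (continuousOn_const.mul (hp.pow 2)).smul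
      ((decayingIntegrand_continuousOn hQ hQt hx lam).comp hp fun θ hθ => ?_)
    refine hc.keyhole_subset hre hlam hR haR hlR hreg (image_subset_contourImage _ 3 ?_)
    exact (arcPiece R).path_mem_image hθ)
  have hR2 : Tendsto (fun R : ℝ => R ^ 2) atTop atTop := tendsto_pow_atTop two_ne_zero
  have g1 := (gammaIntegrand_ray hQ hQt H Ht hc hx (σ := 1) (Or.inl rfl)).1 lam
  have g2 := (gammaIntegrand_ray hQ hQt H Ht hc hx (σ := -1) (Or.inr rfl)).1 lam
  simp only [one_mul] at g1
  simp only [neg_one_mul] at g2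
  have t1 := intervalIntegral_tendsto_integral_Ioi a g1 hR2
  have t2 := intervalIntegral_tendsto_integral_Ioi a g2 hR2
  have hlim := ((t1.neg.add_const (∫ s in (0 : ℝ)..1, deriv c s • G (τ.path s))).add t2).add_const
    ((2 * Real.pi * Complex.I : ℂ) • (ivpSol Q A (perp A + h) lam x).1)
  have hu := tendsto_nhds_unique (hlim.congr' (hfin.mono fun R hR => hR.symm)) harc
  rw [hc.gammaIntegral_eq, smul_sub, eq_sub_iff_add_eq, hu, ← Complex.coe_smul, smul_smul]
  push_cast
  rfl

/-- The main identity. -/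
lemma gammaIntegral_eq_sub (lam : ℂ) :
    gammaIntegral c a (gammaIntegrand Q Qt A h ht x lam) = (2 * Real.pi * Complex.I : ℂ) •
      ((ivpSol Qt A (perp A + ht) lam x).1 - (ivpSol Q A (perp A + h) lam x).1) := by
  have h1 := gammaIntegral_differentiable hQ hQt H Ht hc hx
  have h2 : Differentiable ℂ fun lam => (2 * Real.pi * Complex.I : ℂ) •
      ((ivpSol Qt A (perp A + ht) lam x).1 - (ivpSol Q A (perp A + h) lam x).1) :=
    ((ivpSol_differentiable (intervalIntegrable_of_integrableOn hQt) A (perp A + ht) hx).fst.sub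
      (ivpSol_differentiable (intervalIntegrable_of_integrableOn hQ) A (perp A + h)
        hx).fst).fun_const_smul _
  obtain ⟨δ, hδ, hdist⟩ := exists_dist_le_of_disjoint
    (isCompact_Icc.image_of_continuousOn hc.continuous) (isClosed_singleton (x := (0 : ℂ)))
    (disjoint_singleton_right.2 (hc.encircles 0 zero_mem_excluded).1)
  have hev : (fun lam => gammaIntegral c a (gammaIntegrand Q Qt A h ht x lam)) =ᶠ[nhds
      (-(δ / 2 : ℝ) : ℂ)] fun lam => (2 * Real.pi * Complex.I : ℂ) •
      ((ivpSol Qt A (perp A + ht) lam x).1 - (ivpSol Q A (perp A + h) lam x).1) := by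
    -- With δ the distance kept by the curve from 0, the disc of radius δ/2 about -δ/2 lies in Re z
    -- < 0 and in |z| < δ.
    filter_upwards [Metric.ball_mem_nhds (-(δ / 2 : ℝ) : ℂ) (half_pos hδ)] with z hz
    rw [mem_ball_iff_norm] at hz
    refine gammaIntegral_eq_of_near_zero hQ hQt H Ht hc hx ?_ fun s hs => ?_
    · have k1 := (Complex.abs_re_le_norm (z - (-(δ / 2 : ℝ) : ℂ))).trans_lt hz
      rw [abs_lt] at k1
      have k2 : (z - (-(δ / 2 : ℝ) : ℂ)).re = z.re + δ / 2 := by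
        rw [sub_neg_eq_add, Complex.add_re, Complex.ofReal_re]
      rw [k2] at k1
      linarith [k1.2]
    · have k1 := norm_le_norm_add_norm_sub' z (-(δ / 2 : ℝ) : ℂ)
      have k2 := hdist (c s) (mem_image_of_mem _ hs) 0 rfl
      rw [sub_zero] at k2
      rw [norm_neg, Complex.norm_real, Real.norm_of_nonneg (half_pos hδ).le] at k1
      linarith
  exact congrFun (AnalyticOnNhd.eq_of_eventuallyEq (𝕜 := ℂ)
    (fun z _ => h1.analyticAt z) (fun z _ => h2.analyticAt z) hev) lam

end Main

end MatrixSchrodinger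

end

theorem theorem2 {n : ℕ}
    (Q Qt : ℝ → MatrixSchrodinger.Mat n) (A h ht : MatrixSchrodinger.Mat n)
    (hQ : IntegrableOn Q (Ioi 0)) (hQt : IntegrableOn Qt (Ioi 0))
    (hh : MatrixSchrodinger.IsBoundaryData A h) (hht : MatrixSchrodinger.IsBoundaryData A ht)
    (c : ℝ → ℂ) (a : ℝ)
    (hc : MatrixSchrodinger.IsEncircling c a
      (MatrixSchrodinger.Lam Q A h ∪ MatrixSchrodinger.Lam Qt A ht ∪ {0}))
    (x : ℝ) (hx : 0 ≤ x) (lam : ℂ) :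
    (∀ mu : ℂ, mu ≠ lam →
      MatrixSchrodinger.kernelD Qt A ht x lam mu =
        (lam - mu)⁻¹ • MatrixSchrodinger.wronskian
          (MatrixSchrodinger.phiStar Qt A ht mu) (MatrixSchrodinger.phi Qt A ht lam) x) ∧
    MatrixSchrodinger.GammaIntegrable c a (fun tau =>
      MatrixSchrodinger.phi Q A h (tau ^ 2) x * MatrixSchrodinger.rTilde Q Qt A h ht x lam tau) ∧
    MatrixSchrodinger.phi Qt A ht lam x =
      MatrixSchrodinger.phi Q A h lam x +
        (1 / (2 * Real.pi * Complex.I) : ℂ) • MatrixSchrodinger.gammaIntegral c a (fun tau =>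
          MatrixSchrodinger.phi Q A h (tau ^ 2) x *
            MatrixSchrodinger.rTilde Q Qt A h ht x lam tau) := by
  have hF : (fun tau => MatrixSchrodinger.phi Q A h (tau ^ 2) x *
      MatrixSchrodinger.rTilde Q Qt A h ht x lam tau) =
      MatrixSchrodinger.gammaIntegrand Q Qt A h ht x lam := by
    funext tau
    rw [MatrixSchrodinger.gammaIntegrand, MatrixSchrodinger.weylFactor, mul_assoc,
      MatrixSchrodinger.rTilde, MatrixSchrodinger.kernelD_eq hQt hx,
      (MatrixSchrodinger.phi_eq hQ A h _ hx).1]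
  rw [hF]
  refine ⟨fun mu hmu => MatrixSchrodinger.kernelD_eq_wronskian hQt hx hht hmu,
    MatrixSchrodinger.gammaIntegrable_gammaIntegrand hQ hQt hh hht hc hx lam, ?_⟩
  rw [MatrixSchrodinger.gammaIntegral_eq_sub hQ hQt hh hht hc hx, one_div,
    inv_smul_smul₀ Complex.two_pi_I_ne_zero, (MatrixSchrodinger.phi_eq hQ A h lam hx).1,
    (MatrixSchrodinger.phi_eq hQt A ht lam hx).1]
  abel
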